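/- Let $l\ge 0$ be an integer. For $x>0$ and $r\ge 0$, put $k=\sqrt{x}$ and let $$s(x,l;r)=\left[\frac{A(x,l)}{2(1-e^{-2\pi/k})}\right]^{1/2}\frac{(i/k)^{l+1}}{\Gamma(2l+2)}\,M_{i/k,\,l+\frac12}(-2ikr),\qquad A(x,l)=\prod_{j=0}^{l}(1+j^2x),$$ be the (real-valued) Coulomb wave function, where $M_{\kappa,\mu}(z)=e^{-z/2}z^{\mu+1/2}\,{}_1F_1(\mu-\kappa+\tfrac12;1+2\mu;z)$ is the Whittaker function. Equivalently, $s(x,l;\cdot)$ is the solution of $$\frac{d^2y}{dr^2}+\Bigl(x+\frac2r-\frac{l(l+1)}{r^2}\Bigr)y=0\qquad(r>0)$$ that vanishes at $r=0$ and satisfies $s(x,l;r)=\pi^{-1/2}x^{-1/4}\bigl[\sin\zeta(x,l;r)+O(1/r)\bigr]$ as $r\to\infty$, with $\zeta(x,l;r)=kr+\frac1k\ln(2kr)-\frac{l\pi}{2}+\arg\Gamma\bigl(l+1-\frac ik\bigr)$. Let $a>0$ and let $\phi:(0,\infty)\to\mathbb{R}$ be piecewise continuously differentiable; that is, every compact subinterval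 of $(0,\infty)$ contains only finitely many break points, away from the break points $\phi$ is continuously differentiable, and $\phi$ and $\phi'$ have finite one-sided limits at every point of $(0,\infty)$. Suppose that $$\int_0^1 x^{-1/4}|\phi(x)|\,dx<\infty\qquad\text{and}\qquad\int_1^\infty x^{-3/4}|\phi(x)|\,dx<\infty .$$ Then, for every $R>0$, the outer integral below converges absolutely (the inner integrand is continuous in $r$), and $$\lim_{R\to\infty}\int_0^\infty\phi(x)\int_0^R s(x,l;r)\,s(a,l;r)\,dr\,dx=\tfrac12\bigl[\phi(a^+)+\phi(a^-)\bigr].$$ -/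

import Mathlib

open MeasureTheory Filter Topology Set

/-- The Whittaker function `M_{κ,μ}(z) = e^{-z/2} z^{μ+1/2} ₁F₁(μ-κ+1/2; 1+2μ; z)`.
The regularized hypergeometric function of Mathlib is `₁F₁(a; b; z) / Γ(b)`, whence the factor
`Γ(1+2μ)`. -/
noncomputable def whittakerM (κ μ z : ℂ) : ℂ :=
  Complex.exp (-z / 2) * z ^ (μ + 1 / 2) *
    (Complex.Gamma (1 + 2 * μ) * Complex.regularizedHGFun {μ - κ + 1 / 2} {1 + 2 * μ} z)

/-- The unnormalized regular Coulomb function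
`f(x, l; r) = (i/k)^{l+1} / Γ(2l+2) * M_{i/k, l+1/2}(-2ikr)`, with `k = √x`.
It is the solution of `y'' + (x + 2/r - l(l+1)/r²) y = 0` with
`y ∼ (2r)^{l+1} / (2l+1)!` as `r → 0⁺`. -/
noncomputable def coulombF (x : ℝ) (l : ℕ) (r : ℝ) : ℂ :=
  (Complex.I / (√x : ℝ)) ^ (l + 1) / Complex.Gamma (2 * (l : ℂ) + 2) *
    whittakerM (Complex.I / (√x : ℝ)) ((l : ℂ) + 1 / 2) (-2 * Complex.I * (√x : ℝ) * (r : ℝ))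

/-- The polynomial `A(x, l) = ∏_{j=0}^{l} (1 + j² x)`, of degree `l` in `x`. -/
noncomputable def coulombA (x : ℝ) (l : ℕ) : ℝ :=
  ∏ j ∈ Finset.range (l + 1), (1 + (j : ℝ) ^ 2 * x)

/-- The Coulomb wave function
`s(x, l; r) = [A(x, l) / (2 (1 - e^{-2π/k}))]^{1/2} f(x, l; r)`, with `k = √x`, `x > 0`.
(The values of `f` are real there.) The constant is the one for which
`s(x, l; r) = π^{-1/2} x^{-1/4} (sin ζ + O(1/r))` as `r → ∞`, where
`ζ = k r + k⁻¹ ln (2 k r) - l π / 2 + arg Γ(l + 1 - i/k)`. -/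
noncomputable def coulombS (x : ℝ) (l : ℕ) (r : ℝ) : ℝ :=
  √(coulombA x l / (2 * (1 - Real.exp (-(2 * Real.pi) / √x)))) * (coulombF x l r).re

/-- `φ` is piecewise continuously differentiable on `(0, ∞)`: away from a set of break points of
which only finitely many lie in each compact subinterval of `(0, ∞)`, it is continuously
differentiable, and `φ` and `φ'` have finite one-sided limits at every point of `(0, ∞)`. -/
def PiecewiseC1OnPos (φ : ℝ → ℝ) : Prop :=
  ∃ S : Set ℝ, (∀ c d : ℝ, 0 < c → (S ∩ Icc c d).Finite) ∧
    (∀ x ∈ Ioi (0 : ℝ) \ S, DifferentiableAt ℝ φ x ∧ ContinuousAt (deriv φ) x) ∧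
    ∀ x : ℝ, 0 < x →
      (∃ L : ℝ, Tendsto φ (𝓝[<] x) (𝓝 L)) ∧ (∃ L : ℝ, Tendsto φ (𝓝[>] x) (𝓝 L)) ∧
      (∃ L : ℝ, Tendsto (deriv φ) (𝓝[<] x) (𝓝 L)) ∧
      (∃ L : ℝ, Tendsto (deriv φ) (𝓝[>] x) (𝓝 L))

/-! The functions s(x,l;·) solve one radial Schrödinger equation with energy x, so the truncated
inner product K_R(x) = ∫₀^R s(x,l;r) s(a,l;r) dr obeys Lagrange's identity: (x - a) K_R(x) is the
Wronskian W_R(x) of the two functions at R (`sub_mul_coulombKernel`). Everything is thereby moved to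
the endpoint R, where large-r asymptotics apply.

For r → ∞ one has s(x,l;r) = Im(b(x) e^{iΦ_r(x)}) + O(1/r) with Φ_r(x) = √x r + ln r / √x, and the
r-derivative is √x Re(b(x) e^{iΦ_r(x)}) + O(1/r) (`coulombS_asymptotic`). The normalization of s
gives |b(x)|² = 1/(π√x) (`normSq_coulombAmp`). Near x = a the quotient W_R(x)/(x - a) is therefore
(1/π) sin(Φ_R(x) - Φ_R(a))/(x - a) plus oscillating terms with continuous coefficients plus a small
error. The logarithm perturbs the phase only to lower order, so the Dirichlet integral π/2 gives K_R
mass 1/2 on each side of a, and a Riemann-Lebesgue lemma for Φ_R removes the other terms.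

To pass to φ, subtract its one-sided limits at a, each multiplied by the indicator of an interval
ending at a. The remainder ψ is O(|x - a|) at a, because φ' has one-sided limits there. Hence ψ/(x -
a) is integrable against the growth of s and s' in x, and ∫ ψ/(x - a) W_R dx → 0 by dominated
convergence and Riemann-Lebesgue.

Two analytic inputs carry the proof. The asymptotics come from Euler's integral for ₁F₁, rotated to
vertical rays and expanded by Watson's lemma (`eulerInt_asymptotic`). They are only locally uniform
in x, so domination needs bounds valid for all x > 0: s and s' are O(√(max(1,x)/√x)), for s' away
from r = 0 (`coulombS_bounds`). These follow by rescaling r with max(1,√x), using the power series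
on a bounded range and an almost conserved WKB energy beyond it. Dividing the bound by max(1,x), as
Lagrange's identity allows, leaves x^{-1/4} for x ≤ 1 and x^{-3/4} for x ≥ 1, the weights in the
hypotheses on φ. -/

/-! ### The Euler integral and its differential equation -/

/-- The phase `ρ u + η ln ((1 + u) / (1 - u))` of the Euler integral of the Coulomb function. -/
noncomputable def eulerPhase (η ρ u : ℝ) : ℝ := ρ * u + η * (Real.log (1 + u) - Real.log (1 - u))

/-- The `p`-th `ρ`-derivative of `∫_{-1}^1 (1 - u²)^l cos (ρ u + η ln ((1 + u) / (1 - u))) du`. -/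
noncomputable def eulerInt (l p : ℕ) (η ρ : ℝ) : ℝ :=
  ∫ u in (-1 : ℝ)..1, u ^ p * (1 - u ^ 2) ^ l * Real.cos (eulerPhase η ρ u + p * (Real.pi / 2))

theorem measurable_eulerPhase (η ρ : ℝ) : Measurable (eulerPhase η ρ) := by
  unfold eulerPhase; fun_prop

theorem abs_eulerInt_weight_le (l p : ℕ) {u : ℝ} (hu : u ∈ uIoc (-1 : ℝ) 1) (c : ℝ) (hc : |c| ≤ 1) :
    |u ^ p * (1 - u ^ 2) ^ l * c| ≤ 1 := by
  rw [uIoc_of_le (by norm_num), mem_Ioc] at hu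
  have h1 : |u| ≤ 1 := abs_le.2 ⟨hu.1.le, hu.2⟩
  have h2 : |1 - u ^ 2| ≤ 1 := by rw [abs_le]; constructor <;> nlinarith
  rw [abs_mul, abs_mul, abs_pow, abs_pow]
  have := pow_le_one₀ (n := p) (abs_nonneg _) h1
  have := pow_le_one₀ (n := l) (abs_nonneg _) h2
  exact mul_le_one₀ (mul_le_one₀ ‹_› (by positivity) ‹_›) (abs_nonneg _) hc

theorem continuous_eulerInt (l p : ℕ) : Continuous (fun z : ℝ × ℝ => eulerInt l p z.1 z.2) := by
  unfold eulerInt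
  refine intervalIntegral.continuous_of_dominated_interval (bound := fun _ => 1) ?_ ?_ ?_ ?_
  · intro z
    have := measurable_eulerPhase z.1 z.2
    exact Measurable.aestronglyMeasurable (by fun_prop)
  · intro z
    exact Eventually.of_forall fun u hu =>
      abs_eulerInt_weight_le l p hu _ (Real.abs_cos_le_one _)
  · exact intervalIntegrable_const
  · refine Eventually.of_forall fun u _ => ?_
    unfold eulerPhase
    fun_prop

theorem hasDerivAt_eulerInt (l p : ℕ) (η ρ : ℝ) :
    HasDerivAt (eulerInt l p η) (eulerInt l (p + 1) η ρ) ρ := by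
  have hm : ∀ (p : ℕ) (ρ : ℝ), Measurable (fun u : ℝ => u ^ p * (1 - u ^ 2) ^ l *
      Real.cos (eulerPhase η ρ u + p * (Real.pi / 2))) := by
    intro p ρ
    have := measurable_eulerPhase η ρ
    fun_prop
  refine (intervalIntegral.hasDerivAt_integral_of_dominated_loc_of_deriv_le
    (F := fun ρ u => u ^ p * (1 - u ^ 2) ^ l * Real.cos (eulerPhase η ρ u + p * (Real.pi / 2)))
    (F' := fun ρ u => u ^ (p + 1) * (1 - u ^ 2) ^ l *
      Real.cos (eulerPhase η ρ u + (p + 1 : ℕ) * (Real.pi / 2)))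
    (bound := fun _ => 1) (s := univ) univ_mem ?_ ?_ ?_ ?_ ?_ ?_).2
  · exact Eventually.of_forall fun ρ => (hm p ρ).aestronglyMeasurable
  · refine (intervalIntegrable_const (c := (1 : ℝ))).mono_fun (hm p ρ).aestronglyMeasurable ?_
    refine (ae_restrict_iff' measurableSet_uIoc).2 (Eventually.of_forall fun u hu => ?_)
    simpa using abs_eulerInt_weight_le l p hu _ (Real.abs_cos_le_one _)
  · exact (hm (p + 1) ρ).aestronglyMeasurable
  · exact Eventually.of_forall fun u hu ρ _ =>
      abs_eulerInt_weight_le l (p + 1) hu _ (Real.abs_cos_le_one _)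
  · exact intervalIntegrable_const
  · refine Eventually.of_forall fun u _ ρ _ => ?_
    have h1 : HasDerivAt (fun ρ => eulerPhase η ρ u + p * (Real.pi / 2)) u ρ := by
      have := (((hasDerivAt_id ρ).mul_const u).add_const
        (η * (Real.log (1 + u) - Real.log (1 - u)))).add_const (p * (Real.pi / 2))
      exact this.congr_deriv (by simp)
    have h2 := (h1.cos).const_mul (u ^ p * (1 - u ^ 2) ^ l)
    refine h2.congr_deriv ?_
    have : eulerPhase η ρ u + ((p + 1 : ℕ) : ℝ) * (Real.pi / 2)
        = eulerPhase η ρ u + p * (Real.pi / 2) + Real.pi / 2 := by push_cast; ring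
    rw [this, Real.cos_add_pi_div_two]
    ring

theorem intervalIntegrable_eulerInt (l p : ℕ) (η ρ : ℝ) :
    IntervalIntegrable (fun u : ℝ => u ^ p * (1 - u ^ 2) ^ l *
      Real.cos (eulerPhase η ρ u + p * (Real.pi / 2))) volume (-1) 1 := by
  refine (intervalIntegrable_const (c := (1 : ℝ))).mono_fun ?_ ?_
  · have := measurable_eulerPhase η ρ
    exact Measurable.aestronglyMeasurable (by fun_prop)
  · refine (ae_restrict_iff' measurableSet_uIoc).2 (Eventually.of_forall fun u hu => ?_)
    simpa using abs_eulerInt_weight_le l p hu _ (Real.abs_cos_le_one _)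

/-- The confluent hypergeometric equation for the Euler integral. -/
theorem eulerInt_ode (l : ℕ) (η ρ : ℝ) :
    ρ * eulerInt l 2 η ρ + (2 * l + 2) * eulerInt l 1 η ρ + (ρ + 2 * η) * eulerInt l 0 η ρ = 0 := by
  set θ := eulerPhase η ρ with hθ
  -- The integrand of the combination is the exact derivative of (1 - u²)^(l+1) sin θ(u), because θ'
  -- = ρ + 2η/(1 - u²). The boundary terms vanish.
  have key : ∫ u in (-1 : ℝ)..1, (ρ * (u ^ 2 * (1 - u ^ 2) ^ l *
        Real.cos (θ u + (2 : ℕ) * (Real.pi / 2)))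
      + (2 * l + 2) * (u ^ 1 * (1 - u ^ 2) ^ l * Real.cos (θ u + (1 : ℕ) * (Real.pi / 2)))
      + (ρ + 2 * η) * (u ^ 0 * (1 - u ^ 2) ^ l * Real.cos (θ u + (0 : ℕ) * (Real.pi / 2))))
      = (1 - (1 : ℝ) ^ 2) ^ (l + 1) * Real.sin (θ 1)
        - (1 - (-1 : ℝ) ^ 2) ^ (l + 1) * Real.sin (θ (-1)) := by
    refine intervalIntegral.integral_eq_sub_of_hasDerivAt_of_le (by norm_num)
      (f := fun u => (1 - u ^ 2) ^ (l + 1) * Real.sin (θ u)) ?_ ?_ ?_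
    · intro u hu
      -- At u = ±1 the phase is singular, but the sine is bounded and its prefactor tends to 0.
      by_cases h : 1 - u ^ 2 = 0
      · have hz : Tendsto (fun u : ℝ => (1 - u ^ 2) ^ (l + 1)) (𝓝 u) (𝓝 0) := by
          have : Continuous (fun u : ℝ => (1 - u ^ 2) ^ (l + 1)) := by fun_prop
          simpa [h] using this.tendsto u
        have : Tendsto (fun u : ℝ => (1 - u ^ 2) ^ (l + 1) * Real.sin (θ u)) (𝓝 u) (𝓝 0) :=
          squeeze_zero_norm (a := fun u : ℝ => |(1 - u ^ 2) ^ (l + 1)|) (fun u => by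
            rw [norm_mul]
            exact mul_le_of_le_one_right (norm_nonneg _) (Real.abs_sin_le_one _))
            (by simpa using hz.abs)
        refine ContinuousAt.continuousWithinAt ?_
        simpa [ContinuousAt, h] using this
      · have h1 : 1 + u ≠ 0 := fun h' => h (by linear_combination (1 - u) * h')
        have h2 : 1 - u ≠ 0 := fun h' => h (by linear_combination (1 + u) * h')
        refine ContinuousAt.continuousWithinAt ?_
        simp only [hθ]
        unfold eulerPhase
        fun_prop (disch := assumption)
    · intro u hu
      have h1 : 1 + u ≠ 0 := by have := hu.1; intro h; linarith
      have h2 : 1 - u ≠ 0 := by have := hu.2; intro h; linarith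
      have d1 : HasDerivAt θ (ρ + η * (1 / (1 + u) - (-1) / (1 - u))) u := by
        have a1 : HasDerivAt (fun u : ℝ => 1 + u) 1 u := by
          simpa using (hasDerivAt_id u).const_add 1
        have a2 : HasDerivAt (fun u : ℝ => 1 - u) (-1) u := by
          simpa using (hasDerivAt_id u).const_sub 1
        have := ((hasDerivAt_id u).const_mul ρ).add (((a1.log h1).sub (a2.log h2)).const_mul η)
        exact this.congr_deriv (by simp)
      have d2 : HasDerivAt (fun u : ℝ => (1 - u ^ 2) ^ (l + 1))
          ((l + 1 : ℕ) * (1 - u ^ 2) ^ l * (-(2 * u))) u := by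
        have := ((hasDerivAt_pow 2 u).const_sub 1).pow (l + 1)
        exact this.congr_deriv (by simp)
      refine (d2.mul d1.sin).congr_deriv ?_
      have e2 : Real.cos (θ u + (2 : ℕ) * (Real.pi / 2)) = - Real.cos (θ u) := by
        rw [← Real.cos_add_pi]; congr 1; push_cast; ring
      have e1 : Real.cos (θ u + (1 : ℕ) * (Real.pi / 2)) = - Real.sin (θ u) := by
        rw [← Real.cos_add_pi_div_two]; congr 1; push_cast; ring
      rw [e1, e2]
      push_cast
      rw [pow_succ]
      simp only [zero_mul, add_zero]
      field_simp
      ring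
    · exact (((intervalIntegrable_eulerInt l 2 η ρ).const_mul _).add
        ((intervalIntegrable_eulerInt l 1 η ρ).const_mul _)).add
        ((intervalIntegrable_eulerInt l 0 η ρ).const_mul _)
  rw [intervalIntegral.integral_add (((intervalIntegrable_eulerInt l 2 η ρ).const_mul _).add
        ((intervalIntegrable_eulerInt l 1 η ρ).const_mul _))
        ((intervalIntegrable_eulerInt l 0 η ρ).const_mul _),
    intervalIntegral.integral_add ((intervalIntegrable_eulerInt l 2 η ρ).const_mul _)
        ((intervalIntegrable_eulerInt l 1 η ρ).const_mul _),
    intervalIntegral.integral_const_mul, intervalIntegral.integral_const_mul,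
    intervalIntegral.integral_const_mul] at key
  unfold eulerInt
  rw [key]
  norm_num

/-! ### The regular Coulomb function and the radial equation -/

/-- The regular Coulomb function with wave number `σ` and `y ∼ C r^{l+1}` at the origin. -/
noncomputable def regCoulomb (l : ℕ) (σ η r : ℝ) : ℝ := r ^ (l + 1) * eulerInt l 0 η (σ * r)

/-- The `r`-derivative of `regCoulomb`. -/
noncomputable def regCoulombDeriv (l : ℕ) (σ η r : ℝ) : ℝ :=
  (l + 1) * r ^ l * eulerInt l 0 η (σ * r) + r ^ (l + 1) * (σ * eulerInt l 1 η (σ * r))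

theorem hasDerivAt_eulerInt_mul (l p : ℕ) (η σ r : ℝ) :
    HasDerivAt (fun r => eulerInt l p η (σ * r)) (σ * eulerInt l (p + 1) η (σ * r)) r := by
  have h : HasDerivAt (fun r : ℝ => σ * r) σ r := by
    simpa using (hasDerivAt_id r).const_mul σ
  have := (hasDerivAt_eulerInt l p η (σ * r)).comp r h
  simpa [Function.comp_def, mul_comm] using this

theorem hasDerivAt_regCoulomb (l : ℕ) (σ η r : ℝ) :
    HasDerivAt (regCoulomb l σ η) (regCoulombDeriv l σ η r) r := by
  have := (hasDerivAt_pow (l + 1) r).mul (hasDerivAt_eulerInt_mul l 0 η σ r)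
  exact this.congr_deriv (by simp [regCoulombDeriv])

/-- Inserting r^(l+1) J(σr) into the radial equation leaves a multiple of `eulerInt_ode`. The
Coulomb case is ση = 1; keeping σ and η independent makes the equation stable under rescaling of r,
which the uniform bounds exploit. -/
theorem hasDerivAt_regCoulombDeriv (l : ℕ) (σ η : ℝ) {r : ℝ} (hr : r ≠ 0) :
    HasDerivAt (regCoulombDeriv l σ η)
      (-(σ ^ 2 + 2 * (σ * η) / r - l * (l + 1) / r ^ 2) * regCoulomb l σ η r) r := by
  have h0 := hasDerivAt_eulerInt_mul l 0 η σ r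
  have h1 := hasDerivAt_eulerInt_mul l 1 η σ r
  have := (((hasDerivAt_pow l r).const_mul ((l : ℝ) + 1)).mul h0).add
    ((hasDerivAt_pow (l + 1) r).mul (h1.const_mul σ))
  refine (this.congr_deriv ?_)
  have ode := eulerInt_ode l η (σ * r)
  unfold regCoulomb
  have hl : (l : ℝ) * r ^ (l - 1) = l * r ^ l / r := by
    rcases l with _ | l
    · simp
    · simp only [Nat.add_sub_cancel, pow_succ]
      field_simp
  have e : ((l : ℝ) + 1) * (l * r ^ (l - 1)) = (l + 1) * (l * r ^ l / r) := by rw [hl]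
  simp only [e, Nat.add_sub_cancel, pow_succ]
  push_cast
  have : eulerInt l 2 η (σ * r) * (σ * r) = - ((2 * l + 2) * eulerInt l 1 η (σ * r) + (σ * r + 2 * η) * eulerInt l 0 η (σ * r)) := by linear_combination ode
  clear ode h0 h1
  generalize eulerInt l 0 η (σ * r) = j0 at *
  generalize eulerInt l 1 η (σ * r) = j1 at *
  generalize eulerInt l 2 η (σ * r) = j2 at *
  field_simp
  linear_combination (σ * r) * this

/-! ### From the Whittaker function to the Euler integral -/

theorem hasSum_regularizedHGFun_one_one (a b z : ℂ) :
    HasSum (fun n : ℕ => (ascPochhammer ℂ n).eval a / (n.factorial * Complex.Gamma (b + n)) * z ^ n)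
      (Complex.regularizedHGFun {a} {b} z) := by
  have hr : (Complex.regularizedHGFunSeries {a} {b}).radius = ⊤ :=
    Complex.radius_regularizedHGFunSeries_eq_top (by simp)
  have := (Complex.regularizedHGFunSeries {a} {b}).hasSum (x := z) (by simp [hr])
  refine HasSum.congr_fun this fun n => ?_
  rw [Complex.regularizedHGFunSeries, FormalMultilinearSeries.ofScalars_apply_eq,
    Complex.regularizedHGFunCoeff]
  simp

/-- Euler's integral for the confluent hypergeometric function. -/
theorem Gamma_mul_regularizedHGFun (a c z : ℂ) (ha : 1 ≤ a.re) (hc : 1 ≤ c.re) :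
    Complex.Gamma a * Complex.Gamma c * Complex.regularizedHGFun {a} {a + c} z =
      ∫ t in (0 : ℝ)..1, Complex.exp (z * t) * ((t : ℂ) ^ (a - 1) * (1 - (t : ℂ)) ^ (c - 1)) := by
  have ha0 : 0 < a.re := by linarith
  have hc0 : 0 < c.re := by linarith
  set w : ℝ → ℂ := fun t => (t : ℂ) ^ (a - 1) * (1 - (t : ℂ)) ^ (c - 1) with hw
  have hwm : Measurable w := by
    simp only [hw]; fun_prop
  have hwb : ∀ t ∈ uIoc (0 : ℝ) 1, ‖w t‖ ≤ 1 := by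
    intro t ht
    rw [uIoc_of_le zero_le_one, mem_Ioc] at ht
    simp only [hw, norm_mul]
    have h1 : ‖(t : ℂ) ^ (a - 1)‖ ≤ 1 := by
      rw [Complex.norm_cpow_eq_rpow_re_of_pos ht.1]
      exact Real.rpow_le_one ht.1.le ht.2 (by simpa using ha)
    have h2 : ‖(1 - (t : ℂ)) ^ (c - 1)‖ ≤ 1 := by
      rcases eq_or_lt_of_le ht.2 with h | h
      · rw [h]
        by_cases hc' : c - 1 = 0
        · simp [hc']
        · simp [Complex.zero_cpow hc']
      · have : (1 - (t : ℂ)) = ((1 - t : ℝ) : ℂ) := by push_cast; ring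
        rw [this, Complex.norm_cpow_eq_rpow_re_of_pos (by linarith)]
        exact Real.rpow_le_one (by linarith) (by linarith [ht.1]) (by simpa using hc)
    exact mul_le_one₀ h1 (norm_nonneg _) h2
  -- Expanding the exponential turns each term into a Beta integral. Since Re a and Re c are at
  -- least 1, the weight has modulus at most 1, and the exponential series of ‖z‖ dominates.
  have h1 : HasSum (fun n : ℕ => ∫ t in (0 : ℝ)..1, (z * t) ^ n / n.factorial * w t)
      (∫ t in (0 : ℝ)..1, Complex.exp (z * t) * w t) := by
    refine intervalIntegral.hasSum_integral_of_dominated_convergence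
      (fun n _ => ‖z‖ ^ n / n.factorial) ?_ ?_ ?_ ?_ ?_
    · intro n
      exact Measurable.aestronglyMeasurable (by fun_prop)
    · intro n
      refine Eventually.of_forall fun t ht => ?_
      have := hwb t ht
      rw [uIoc_of_le zero_le_one, mem_Ioc] at ht
      rw [norm_mul, norm_div, norm_pow, norm_mul, Complex.norm_real, Complex.norm_natCast]
      have ht' : ‖t‖ ≤ 1 := by rw [Real.norm_of_nonneg ht.1.le]; exact ht.2
      have h3 : (‖z‖ * ‖t‖) ^ n ≤ ‖z‖ ^ n :=
        pow_le_pow_left₀ (by positivity) (mul_le_of_le_one_right (norm_nonneg _) ht') n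
      calc (‖z‖ * ‖t‖) ^ n / n.factorial * ‖w t‖ ≤ ‖z‖ ^ n / n.factorial * 1 := by gcongr
        _ = _ := mul_one _
    · exact Eventually.of_forall fun t _ => Real.summable_pow_div_factorial _
    · exact intervalIntegrable_const
    · refine Eventually.of_forall fun t _ => ?_
      have := (NormedSpace.expSeries_div_hasSum_exp (z * t : ℂ)).mul_right (w t)
      rwa [← Complex.exp_eq_exp_ℂ] at this
  have h2 := ((hasSum_regularizedHGFun_one_one a (a + c) z).mul_left
    (Complex.Gamma a * Complex.Gamma c))
  refine h2.unique (HasSum.congr_fun h1 fun n => ?_)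
  have hn : ∀ k : ℕ, a ≠ -k := fun k hk => by
    have := congrArg Complex.re hk
    simp at this
    have := k.cast_nonneg (α := ℝ)
    linarith
  have han : 0 < (a + n).re := by
    have := n.cast_nonneg (α := ℝ)
    simp; linarith
  have hB := Complex.betaIntegral_eq_Gamma_mul_div (a + n) c han hc0
  have hP := Complex.Gamma_add_nat_div_Gamma_eq (n := n) a hn
  have hG : Complex.Gamma a ≠ 0 := Complex.Gamma_ne_zero_of_re_pos ha0
  have hI : ∫ t in (0 : ℝ)..1, (z * t) ^ n / n.factorial * w t
      = z ^ n / n.factorial * Complex.betaIntegral (a + n) c := by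
    rw [Complex.betaIntegral, ← intervalIntegral.integral_const_mul]
    refine intervalIntegral.integral_congr_ae (Eventually.of_forall fun t ht => ?_)
    rw [uIoc_of_le zero_le_one, mem_Ioc] at ht
    have ht0 : (t : ℂ) ≠ 0 := by exact_mod_cast ht.1.ne'
    have : (t : ℂ) ^ (a + n - 1) = (t : ℂ) ^ (a - 1) * (t : ℂ) ^ n := by
      rw [← Complex.cpow_natCast, ← Complex.cpow_add _ _ ht0]
      congr 1; ring
    rw [this, mul_pow]
    simp only [hw]
    ring
  rw [hI, hB, ← hP, show a + c + n = a + n + c by ring]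
  field_simp

/-- The powers (i/k)^(l+1) and (-2ikr)^(l+1) combine to (2r)^(l+1), and Γ(2l+2) cancels. The lower
parameter is left as a sum of two conjugate numbers, the form taken by `Gamma_mul_regularizedHGFun`.
-/
theorem coulombF_eq (l : ℕ) {x r : ℝ} (hx : 0 < x) :
    coulombF x l r = (2 * (r : ℂ)) ^ (l + 1) * Complex.exp (Complex.I * √x * r) *
      Complex.regularizedHGFun {(l + 1 - Complex.I / √x : ℂ)}
        {(l + 1 - Complex.I / √x + (l + 1 + Complex.I / √x) : ℂ)} (-2 * Complex.I * √x * r) := by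
  have hk : ((√x : ℝ) : ℂ) ≠ 0 := by exact_mod_cast (Real.sqrt_pos.2 hx).ne'
  have hG : Complex.Gamma (2 * (l : ℂ) + 2) ≠ 0 := by
    apply Complex.Gamma_ne_zero_of_re_pos
    simp
    positivity
  unfold coulombF whittakerM
  rw [show 1 + 2 * ((l : ℂ) + 1 / 2) = 2 * (l : ℂ) + 2 by ring,
    show (l : ℂ) + 1 / 2 - Complex.I / √x + 1 / 2 = l + 1 - Complex.I / √x by ring,
    show (l + 1 - Complex.I / √x + (l + 1 + Complex.I / √x) : ℂ) = 2 * (l : ℂ) + 2 by ring,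
    show (l : ℂ) + 1 / 2 + 1 / 2 = ((l + 1 : ℕ) : ℂ) by push_cast; ring, Complex.cpow_natCast,
    show -(-2 * Complex.I * √x * r) / 2 = Complex.I * √x * r by ring]
  have h2 : (Complex.I / √x) ^ (l + 1) * (-2 * Complex.I * √x * r) ^ (l + 1)
      = (2 * (r : ℂ)) ^ (l + 1) := by
    rw [← mul_pow]
    congr 1
    field_simp
    linear_combination (-(r : ℂ)) * Complex.I_sq
  rw [← h2]
  generalize Complex.Gamma (2 * (l : ℂ) + 2) = G at *
  generalize Complex.regularizedHGFun _ _ _ = M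
  field_simp

/-- The parameter l + 1 - i/k blows up as x → 0, but it enters only through products with z: each
factor (a + n) z equals ((l + 1 + n) k - i)(-2ir). The factorials in the denominators absorb the
growth in n, so the series is dominated by that of exp(2rm), with no singularity at x = 0. -/
theorem norm_coulombF_le (l : ℕ) {x r m : ℝ} (hx : 0 < x) (hr : 0 ≤ r) (hm : 1 ≤ m)
    (hxm : √x ≤ m) : ‖coulombF x l r‖ ≤ (2 * r) ^ (l + 1) * Real.exp (2 * r * m) := by
  have hk : 0 < √x := Real.sqrt_pos.2 hx
  have hk' : ((√x : ℝ) : ℂ) ≠ 0 := by exact_mod_cast hk.ne'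
  rw [coulombF_eq l hx, norm_mul, norm_mul]
  have h1 : ‖(2 * (r : ℂ)) ^ (l + 1)‖ = (2 * r) ^ (l + 1) := by
    rw [norm_pow, norm_mul, Complex.norm_real, Real.norm_of_nonneg hr]
    simp
  have h2 : ‖Complex.exp (Complex.I * √x * r)‖ = 1 := by
    rw [Complex.norm_exp]; simp
  rw [h1, h2, mul_one]
  gcongr
  set a : ℂ := l + 1 - Complex.I / √x with ha
  set z : ℂ := -2 * Complex.I * √x * r with hz
  have hb : (l + 1 - Complex.I / √x + (l + 1 + Complex.I / √x) : ℂ) = ((2 * l + 1 : ℕ) + 1 : ℂ) := by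
    push_cast; ring
  rw [hb]
  have hs := hasSum_regularizedHGFun_one_one a ((2 * l + 1 : ℕ) + 1 : ℂ) z
  have hznorm : ‖z‖ = 2 * √x * r := by
    simp [hz, abs_of_nonneg hr]
  have hterm : ∀ n : ℕ, ‖(ascPochhammer ℂ n).eval a * z ^ n‖
      ≤ (2 * r * m) ^ n * ((2 * l + 1 + n).factorial : ℝ) := by
    intro n
    induction n with
    | zero => simp; exact_mod_cast Nat.one_le_iff_ne_zero.2 (Nat.factorial_ne_zero _)
    | succ n ih =>
      rw [ascPochhammer_succ_eval, pow_succ, pow_succ,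
        show (ascPochhammer ℂ n).eval a * (a + n) * (z ^ n * z)
          = (ascPochhammer ℂ n).eval a * z ^ n * ((a + n) * z) by ring, norm_mul,
        show 2 * l + 1 + (n + 1) = (2 * l + 1 + n) + 1 by ring, Nat.factorial_succ]
      have h3 : ‖(a + n) * z‖ ≤ 2 * r * m * ((2 * l + 1 + n + 1 : ℕ) : ℝ) := by
        have : (a + n) * z = ((l + 1 + n) * √x - Complex.I) * (-2 * Complex.I * r) := by
          rw [ha, hz]; field_simp; ring
        rw [this, norm_mul]
        have e1 : ‖((l + 1 + n) * √x - Complex.I : ℂ)‖ ≤ (l + 1 + n) * √x + 1 := by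
          refine (norm_sub_le _ _).trans ?_
          have : ((l + 1 + n) * √x : ℂ) = (((l + 1 + n) * √x : ℝ) : ℂ) := by push_cast; ring
          rw [this, Complex.norm_real, Complex.norm_I, Real.norm_of_nonneg (by positivity)]
        have e2 : ‖(-2 * Complex.I * r : ℂ)‖ = 2 * r := by simp [abs_of_nonneg hr]
        rw [e2]
        have e3 : ((l : ℝ) + 1 + n) * √x + 1 ≤ m * ((2 * l + 1 + n + 1 : ℕ) : ℝ) := by
          push_cast
          have : ((l : ℝ) + 1 + n) * √x ≤ (l + 1 + n) * m := by gcongr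
          have : (0 : ℝ) ≤ m * l := by positivity
          nlinarith
        calc _ ≤ ((l + 1 + n) * √x + 1) * (2 * r) := by gcongr
          _ ≤ m * ((2 * l + 1 + n + 1 : ℕ) : ℝ) * (2 * r) := by gcongr
          _ = _ := by ring
      calc _ ≤ ((2 * r * m) ^ n * ((2 * l + 1 + n).factorial : ℝ)) *
            (2 * r * m * ((2 * l + 1 + n + 1 : ℕ) : ℝ)) := by gcongr
        _ = _ := by push_cast; ring
  have hb2 : HasSum (fun n : ℕ => (2 * r * m) ^ n / n.factorial) (Real.exp (2 * r * m)) := by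
    have := NormedSpace.expSeries_div_hasSum_exp (2 * r * m)
    rwa [← Real.exp_eq_exp_ℝ] at this
  refine hs.norm_le_of_bounded hb2 fun n => ?_
  rw [show ((2 * l + 1 : ℕ) + 1 : ℂ) + n = ((2 * l + 1 + n : ℕ) : ℂ) + 1 by push_cast; ring,
    Complex.Gamma_nat_eq_factorial, div_mul_eq_mul_div, norm_div, norm_mul (n.factorial : ℂ),
    Complex.norm_natCast, Complex.norm_natCast]
  have p1 : (0 : ℝ) < ((2 * l + 1 + n).factorial : ℝ) := by exact_mod_cast Nat.factorial_pos _
  have p2 : (0 : ℝ) < (n.factorial : ℝ) := by exact_mod_cast Nat.factorial_pos _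
  rw [div_le_div_iff₀ (by positivity) p2]
  calc _ ≤ ((2 * r * m) ^ n * ((2 * l + 1 + n).factorial : ℝ)) * n.factorial := by
        gcongr; exact hterm n
    _ = _ := by ring

/-- With t = (1 - u)/2 the imaginary powers of t and 1 - t combine into the phase η ln((1 + u)/(1 -
u)), while the real powers give (1 - u²)^l up to 4^l. -/
theorem exp_mul_cpow_mul_cpow_re (l : ℕ) (η ρ : ℝ) {u : ℝ} (hu : u ∈ Ioo (-1 : ℝ) 1) :
    (Complex.exp (Complex.I * ρ * u) * ((((1 - u) / 2 : ℝ) : ℂ) ^ (l - Complex.I * η : ℂ) *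
      (((1 + u) / 2 : ℝ) : ℂ) ^ (l + Complex.I * η : ℂ))).re
      = (1 / 4) ^ l * ((1 - u ^ 2) ^ l * Real.cos (eulerPhase η ρ u)) := by
  have h1 : 0 < (1 - u) / 2 := by linarith [hu.2]
  have h2 : 0 < (1 + u) / 2 := by linarith [hu.1]
  have c1 : (((1 - u) / 2 : ℝ) : ℂ) ≠ 0 := by exact_mod_cast h1.ne'
  have c2 : (((1 + u) / 2 : ℝ) : ℂ) ≠ 0 := by exact_mod_cast h2.ne'
  rw [Complex.cpow_sub _ _ c1, Complex.cpow_add _ _ c2, Complex.cpow_natCast, Complex.cpow_natCast,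
    Complex.cpow_def_of_ne_zero c1, Complex.cpow_def_of_ne_zero c2, ← Complex.ofReal_log h1.le,
    ← Complex.ofReal_log h2.le, div_eq_mul_inv, ← Complex.exp_neg]
  have : Complex.exp (Complex.I * ρ * u) * ((((1 - u) / 2 : ℝ) : ℂ) ^ l *
      Complex.exp (-(↑(Real.log ((1 - u) / 2)) * (Complex.I * η))) *
      ((((1 + u) / 2 : ℝ) : ℂ) ^ l * Complex.exp (↑(Real.log ((1 + u) / 2)) * (Complex.I * η))))
      = (((1 / 4) ^ l * (1 - u ^ 2) ^ l : ℝ) : ℂ) *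
        Complex.exp ((eulerPhase η ρ u : ℝ) * Complex.I) := by
    have e : ((eulerPhase η ρ u : ℝ) : ℂ) * Complex.I = Complex.I * ρ * u
        + -(↑(Real.log ((1 - u) / 2)) * (Complex.I * η))
        + ↑(Real.log ((1 + u) / 2)) * (Complex.I * η) := by
      rw [Real.log_div (by linarith [hu.2]) two_ne_zero,
        Real.log_div (by linarith [hu.1]) two_ne_zero, eulerPhase]
      push_cast
      ring
    have e2 : (((1 / 4) ^ l * (1 - u ^ 2) ^ l : ℝ) : ℂ)
        = (((1 - u) / 2 : ℝ) : ℂ) ^ l * (((1 + u) / 2 : ℝ) : ℂ) ^ l := by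
      rw [← mul_pow, ← mul_pow]
      push_cast
      congr 1
      ring
    rw [e, Complex.exp_add, Complex.exp_add, e2]
    ring
  rw [this, Complex.re_ofReal_mul, Complex.exp_ofReal_mul_I_re]
  ring

/-- The two upper parameters in Euler's formula are conjugate, so their Gamma factors multiply to
|Γ|². The factor e^{ikr} recentres the exponential for the substitution t = (1 - u)/2, which
produces the integrand of `eulerInt`. -/
theorem coulombF_re (l : ℕ) {x : ℝ} (hx : 0 < x) (r : ℝ) :
    (coulombF x l r).re = (2 : ℝ) ^ (l + 1) * (1 / 4) ^ l / 2 /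
      Complex.normSq (Complex.Gamma (l + 1 - Complex.I * (1 / √x : ℝ))) *
      regCoulomb l (√x) (1 / √x) r := by
  set η : ℝ := 1 / √x with hη
  have hk : 0 < √x := Real.sqrt_pos.2 hx
  have hk' : ((√x : ℝ) : ℂ) ≠ 0 := by exact_mod_cast hk.ne'
  have ha : (l + 1 - Complex.I / √x : ℂ) = l + 1 - Complex.I * η := by
    rw [hη]; push_cast; ring
  have hc : (l + 1 + Complex.I / √x : ℂ) = l + 1 + Complex.I * η := by
    rw [hη]; push_cast; ring
  have hre1 : (l + 1 - Complex.I * η : ℂ).re = l + 1 := by simp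
  have hre2 : (l + 1 + Complex.I * η : ℂ).re = l + 1 := by simp
  have hconj : (l + 1 + Complex.I * η : ℂ) = (starRingEnd ℂ) (l + 1 - Complex.I * η) := by
    simp
  have hl0 : (0 : ℝ) ≤ l := l.cast_nonneg
  have hG : Complex.Gamma (l + 1 - Complex.I * η) ≠ 0 :=
    Complex.Gamma_ne_zero_of_re_pos (by rw [hre1]; positivity)
  have hE := Gamma_mul_regularizedHGFun (l + 1 - Complex.I * η) (l + 1 + Complex.I * η)
    (-2 * Complex.I * √x * r) (by rw [hre1]; linarith) (by rw [hre2]; linarith)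
  have hGG : Complex.Gamma (l + 1 - Complex.I * η) * Complex.Gamma (l + 1 + Complex.I * η)
      = (Complex.normSq (Complex.Gamma (l + 1 - Complex.I * η)) : ℂ) := by
    rw [hconj, Complex.Gamma_conj, Complex.mul_conj]
  set g : ℝ → ℂ := fun t => Complex.exp (-2 * Complex.I * √x * r * t) *
    ((t : ℂ) ^ (l + 1 - Complex.I * η - 1) * (1 - (t : ℂ)) ^ (l + 1 + Complex.I * η - 1)) with hg
  have hN : Complex.normSq (Complex.Gamma (l + 1 - Complex.I * η)) ≠ 0 := by
    simpa using hG
  rw [coulombF_eq l hx, ha, hc]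
  have h1 : Complex.regularizedHGFun {(l + 1 - Complex.I * η : ℂ)}
      {(l + 1 - Complex.I * η + (l + 1 + Complex.I * η) : ℂ)} (-2 * Complex.I * √x * r)
      = ((Complex.normSq (Complex.Gamma (l + 1 - Complex.I * η)))⁻¹ : ℝ) *
        ∫ t in (0 : ℝ)..1, g t := by
    rw [← hE, hGG, Complex.ofReal_inv, inv_mul_cancel_left₀ (by exact_mod_cast hN)]
  have h2 : ∫ t in (0 : ℝ)..1, g t = (1 / 2 : ℝ) * ∫ u in (-1 : ℝ)..1, g (1 / 2 - u / 2) := by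
    rw [intervalIntegral.integral_comp_sub_div _ two_ne_zero]
    norm_num
    rw [← mul_assoc]
    norm_num
  have hint : IntervalIntegrable (fun u : ℝ => Complex.exp (Complex.I * √x * r) * g (1 / 2 - u / 2))
      volume (-1) 1 := by
    refine (intervalIntegrable_const (c := (1 : ℝ))).mono_fun ?_ ?_
    · simp only [hg]
      exact Measurable.aestronglyMeasurable (by fun_prop)
    · refine (ae_restrict_iff' measurableSet_uIoc).2 ?_
      filter_upwards [Measure.ae_ne volume (1 : ℝ)] with u hu1 hu
      rw [uIoc_of_le (by norm_num), mem_Ioc] at hu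
      have p1 : 0 < 1 / 2 - u / 2 := by have := lt_of_le_of_ne hu.2 hu1; linarith
      have p2 : 0 < 1 - (1 / 2 - u / 2) := by linarith [hu.1]
      simp only [hg]
      rw [norm_mul, norm_mul, norm_mul, ← Complex.ofReal_one, ← Complex.ofReal_sub,
        Complex.norm_cpow_eq_rpow_re_of_pos p1, Complex.norm_cpow_eq_rpow_re_of_pos p2,
        Complex.norm_exp, Complex.norm_exp]
      simp only [Complex.ofReal_one]
      have e1 : (l + 1 - Complex.I * η - 1 : ℂ).re = l := by simp
      have e2 : (l + 1 + Complex.I * η - 1 : ℂ).re = l := by simp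
      rw [e1, e2]
      have q1 := Real.rpow_le_one p1.le (by linarith) hl0
      have q2 := Real.rpow_le_one p2.le (by linarith) hl0
      simp
      have := mul_le_one₀ q1 (by positivity) q2
      simpa using this
  have h3 : ∀ u ∈ Ioo (-1 : ℝ) 1, (Complex.exp (Complex.I * √x * r) * g (1 / 2 - u / 2)).re
      = (1 / 4) ^ l * (u ^ 0 * (1 - u ^ 2) ^ l *
        Real.cos (eulerPhase η (√x * r) u + (0 : ℕ) * (Real.pi / 2))) := by
    intro u hu
    have := exp_mul_cpow_mul_cpow_re l η (√x * r) hu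
    simp only [pow_zero, one_mul, CharP.cast_eq_zero, zero_mul, add_zero]
    rw [← this]
    congr 1
    simp only [hg]
    rw [← mul_assoc, ← Complex.exp_add]
    congr 2
    · push_cast; ring
    · congr 1
      · push_cast; ring
      · ring
    · congr 1
      · push_cast; ring
      · ring
  have h4 : (Complex.exp (Complex.I * √x * r) * ∫ u in (-1 : ℝ)..1, g (1 / 2 - u / 2)).re
      = (1 / 4) ^ l * eulerInt l 0 η (√x * r) := by
    rw [← intervalIntegral.integral_const_mul]
    have := intervalIntegral.intervalIntegral_re (𝕜 := ℂ) hint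
    simp only [RCLike.re_to_complex] at this
    rw [← this, eulerInt, ← intervalIntegral.integral_const_mul]
    refine intervalIntegral.integral_congr_ae ?_
    filter_upwards [Measure.ae_ne volume (1 : ℝ)] with u hu1 hu
    rw [uIoc_of_le (by norm_num), mem_Ioc] at hu
    exact h3 u ⟨hu.1, lt_of_le_of_ne hu.2 hu1⟩
  rw [h1, h2]
  have h5 : (2 * (r : ℂ)) ^ (l + 1) * Complex.exp (Complex.I * √x * r) *
      (((Complex.normSq (Complex.Gamma (l + 1 - Complex.I * η)))⁻¹ : ℝ) *
        ((1 / 2 : ℝ) * ∫ u in (-1 : ℝ)..1, g (1 / 2 - u / 2)))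
      = (((2 * r) ^ (l + 1) * (Complex.normSq (Complex.Gamma (l + 1 - Complex.I * η)))⁻¹ * (1 / 2)
        : ℝ) : ℂ) * (Complex.exp (Complex.I * √x * r) * ∫ u in (-1 : ℝ)..1, g (1 / 2 - u / 2)) := by
    push_cast
    ring
  rw [h5, Complex.re_ofReal_mul, h4, regCoulomb, mul_pow]
  ring

/-! ### Normalization constant and asymptotic amplitude -/

/-- For l = 0 this is the reflection formula at iη, using |Γ(1 - iη)|² = iη Γ(iη) Γ(1 - iη). The
functional equation supplies one factor of the product for each further l. -/
theorem normSq_Gamma_nat_add_one_sub_I_mul (l : ℕ) {η : ℝ} (hη : 0 < η) :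
    Complex.normSq (Complex.Gamma (l + 1 - Complex.I * η)) =
      (∏ j ∈ Finset.range l, (((j : ℝ) + 1) ^ 2 + η ^ 2)) *
        (Real.pi * η / Real.sinh (Real.pi * η)) := by
  induction l with
  | zero =>
    have h1 := Complex.Gamma_mul_Gamma_one_sub (Complex.I * η)
    have hne : Complex.I * (η : ℂ) ≠ 0 := mul_ne_zero Complex.I_ne_zero (by exact_mod_cast hη.ne')
    have h2 := Complex.Gamma_add_one _ hne
    have hs : Real.sinh (Real.pi * η) ≠ 0 := (Real.sinh_pos_iff.2 (by positivity)).ne'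
    have hsin : Complex.sin (Real.pi * (Complex.I * η)) = (Real.sinh (Real.pi * η) : ℝ) * Complex.I := by
      rw [show (Real.pi * (Complex.I * η) : ℂ) = ((Real.pi * η : ℝ) : ℂ) * Complex.I by
        push_cast; ring, Complex.sin_mul_I, Complex.ofReal_sinh]
    have h3 : Complex.Gamma (1 - Complex.I * η) * Complex.Gamma (Complex.I * η + 1)
        = ((Real.pi * η / Real.sinh (Real.pi * η) : ℝ) : ℂ) := by
      have hs' : ((Real.sinh (Real.pi * η) : ℝ) : ℂ) ≠ 0 := by exact_mod_cast hs
      calc _ = Complex.I * η *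
            (Complex.Gamma (Complex.I * η) * Complex.Gamma (1 - Complex.I * η)) := by rw [h2]; ring
        _ = _ := by
          rw [h1, hsin, Complex.ofReal_div, Complex.ofReal_mul]
          field_simp
    have h4 : Complex.I * (η : ℂ) + 1 = (starRingEnd ℂ) (1 - Complex.I * η) := by
      simp [add_comm]
    rw [h4, Complex.Gamma_conj, Complex.mul_conj] at h3
    simpa using Complex.ofReal_injective h3
  | succ l ih =>
    have hne : (l + 1 - Complex.I * η : ℂ) ≠ 0 := fun h => by
      have := congrArg Complex.re h
      simp at this
      have := l.cast_nonneg (α := ℝ)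
      linarith
    have h := Complex.Gamma_add_one _ hne
    rw [show ((l + 1 : ℕ) + 1 - Complex.I * η : ℂ) = l + 1 - Complex.I * η + 1 by
      push_cast; ring, h, Complex.normSq_mul, ih, Finset.prod_range_succ]
    have : Complex.normSq (l + 1 - Complex.I * η) = ((l : ℝ) + 1) ^ 2 + η ^ 2 := by
      rw [Complex.normSq_apply]; simp; ring
    rw [this]
    ring

/-- The constant relating `coulombS` to `regCoulomb`. -/
noncomputable def coulombConst (l : ℕ) (x : ℝ) : ℝ :=
  √(coulombA x l / (2 * (1 - Real.exp (-(2 * Real.pi) / √x)))) *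
    ((2 : ℝ) ^ (l + 1) * (1 / 4) ^ l / 2 /
      Complex.normSq (Complex.Gamma (l + 1 - Complex.I * (1 / √x : ℝ))))

theorem coulombS_eq (l : ℕ) {x : ℝ} (hx : 0 < x) (r : ℝ) :
    coulombS x l r = coulombConst l x * regCoulomb l (√x) (1 / √x) r := by
  rw [coulombS, coulombF_re l hx, coulombConst]
  ring

theorem coulombA_pos (l : ℕ) {x : ℝ} (hx : 0 ≤ x) : 0 < coulombA x l :=
  Finset.prod_pos fun j _ => by positivity

/-- Gives A the product that occurs in |Γ(l + 1 - iη)|² with η = 1/√x, so that the two cancel in the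
amplitude. -/
theorem coulombA_eq (l : ℕ) {x : ℝ} (hx : 0 < x) :
    coulombA x l = x ^ l * ∏ j ∈ Finset.range l, (((j : ℝ) + 1) ^ 2 + (1 / √x) ^ 2) := by
  rw [coulombA, Finset.prod_range_succ']
  simp only [Nat.cast_zero, Nat.cast_add, Nat.cast_one]
  rw [show x ^ l = ∏ _j ∈ Finset.range l, x by simp, ← Finset.prod_mul_distrib]
  have : ∀ j : ℕ, x * (((j : ℝ) + 1) ^ 2 + (1 / √x) ^ 2) = 1 + ((j : ℝ) + 1) ^ 2 * x := by
    intro j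
    rw [div_pow, Real.sq_sqrt hx.le]
    field_simp
    ring
  rw [Finset.prod_congr rfl fun j _ => this j]
  simp

theorem one_sub_exp_pos {x : ℝ} (hx : 0 < x) : 0 < 1 - Real.exp (-(2 * Real.pi) / √x) := by
  have : Real.exp (-(2 * Real.pi) / √x) < 1 := by
    rw [Real.exp_lt_one_iff]
    have := Real.sqrt_pos.2 hx
    exact div_neg_of_neg_of_pos (by linarith [Real.pi_pos]) this
  linarith

theorem coulombNorm_le (l : ℕ) : ∃ C : ℝ, 0 < C ∧ ∀ x m : ℝ, 0 < x → 1 ≤ m → √x ≤ m →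
    coulombA x l / (2 * (1 - Real.exp (-(2 * Real.pi) / √x))) ≤ C * m ^ (2 * l + 1) := by
  refine ⟨∏ j ∈ Finset.range l, (1 + ((j : ℝ) + 1) ^ 2), Finset.prod_pos fun j _ => by positivity,
    fun x m hx hm hxm => ?_⟩
  have hk : 0 < √x := Real.sqrt_pos.2 hx
  have hxm2 : x ≤ m ^ 2 := by
    rw [← Real.sq_sqrt hx.le]; gcongr
  have hA : coulombA x l ≤ (∏ j ∈ Finset.range l, (1 + ((j : ℝ) + 1) ^ 2)) * m ^ (2 * l) := by
    rw [coulombA, Finset.prod_range_succ', pow_mul,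
      show (m ^ 2) ^ l = ∏ _j ∈ Finset.range l, m ^ 2 by simp, ← Finset.prod_mul_distrib]
    simp only [Nat.cast_zero, Nat.cast_add, Nat.cast_one]
    norm_num
    refine Finset.prod_le_prod (fun j _ => by positivity) fun j _ => ?_
    have : ((j : ℝ) + 1) ^ 2 * x ≤ (j + 1) ^ 2 * m ^ 2 := by gcongr
    nlinarith
  -- Here 2π/√x ≥ 1/m, and 1 - e^{-t} ≥ t/2 for 0 ≤ t ≤ 1, taken at t = 1/m. This is the source of
  -- the extra power of m beyond m^(2l).
  have hE : 1 / m ≤ 2 * (1 - Real.exp (-(2 * Real.pi) / √x)) := by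
    have h1 : Real.exp (-(2 * Real.pi) / √x) ≤ Real.exp (-(1 / m)) := by
      rw [Real.exp_le_exp, neg_div, neg_le_neg_iff, div_le_div_iff₀ (by linarith) hk]
      nlinarith [Real.pi_gt_three]
    have h0 : 0 < 1 / m := by positivity
    have h3 : Real.exp (-(1 / m)) ≤ 1 / (1 + 1 / m) := by
      rw [Real.exp_neg, ← one_div]
      exact one_div_le_one_div_of_le (by positivity) (by linarith [Real.add_one_le_exp (1 / m)])
    have h4 : 1 / m ≤ 1 := by rw [div_le_one (by linarith)]; exact hm
    have h5 : 1 / (1 + 1 / m) ≤ 1 - 1 / m / 2 := by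
      rw [div_le_iff₀ (by positivity)]
      nlinarith
    linarith
  calc _ ≤ ((∏ j ∈ Finset.range l, (1 + ((j : ℝ) + 1) ^ 2)) * m ^ (2 * l)) / (1 / m) := by
        gcongr
    _ = _ := by rw [pow_succ]; field_simp

/-- The complex amplitude of the Coulomb function:
`s(x, l; r) = Im (b(x) exp (i (√x r + ln r / √x))) + O(1/r)`. -/
noncomputable def coulombAmp (l : ℕ) (x : ℝ) : ℂ :=
  Complex.I * (2 * coulombConst l x * Real.exp (-(Real.pi * (1 / √x)) / 2) * 2 ^ l / √x ^ (l + 1) : ℝ) *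
    ((-Complex.I) ^ (l + 1) * Complex.exp (Complex.I * (1 / √x * (Real.log 2 + Real.log √x) : ℝ)) *
      Complex.Gamma (l + 1 - Complex.I * (1 / √x : ℝ)))

theorem Gamma_nat_add_one_sub_I_mul_ne_zero (l : ℕ) (η : ℝ) :
    Complex.Gamma (l + 1 - Complex.I * η) ≠ 0 :=
  Complex.Gamma_ne_zero_of_re_pos (by simp; positivity)

/-- The product in A cancels that in |Γ|², and 1 - e^{-2πη} = 2 e^{-πη} sinh(πη) cancels the
exponential and the hyperbolic sine. As a consequence √a |b(a)|² = 1/π, which combines with the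
Dirichlet integral π/2 to give the factor 1/2 of the theorem. -/
theorem normSq_coulombAmp (l : ℕ) {x : ℝ} (hx : 0 < x) :
    Complex.normSq (coulombAmp l x) = 1 / (Real.pi * √x) := by
  have hk : 0 < √x := Real.sqrt_pos.2 hx
  set η := 1 / √x with hη
  have hη0 : 0 < η := by positivity
  have hηk : η * √x = 1 := by rw [hη]; field_simp
  have hG := normSq_Gamma_nat_add_one_sub_I_mul l hη0
  set P := ∏ j ∈ Finset.range l, (((j : ℝ) + 1) ^ 2 + η ^ 2) with hP
  have hP0 : 0 < P := Finset.prod_pos fun j _ => by positivity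
  have hE := one_sub_exp_pos hx
  have hsin : 0 < Real.sinh (Real.pi * η) := Real.sinh_pos_iff.2 (by positivity)
  have hexp : ∀ t : ℝ, Complex.normSq (Complex.exp (Complex.I * (t : ℝ))) = 1 := fun t => by
    rw [Complex.normSq_eq_norm_sq, mul_comm, Complex.norm_exp_ofReal_mul_I]; norm_num
  rw [coulombAmp, Complex.normSq_mul, Complex.normSq_mul, Complex.normSq_mul, Complex.normSq_mul,
    hexp, Complex.normSq_ofReal, map_pow, Complex.normSq_neg, Complex.normSq_I, one_pow, one_mul,
    one_mul, one_mul, coulombConst, ← hη]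
  have hN := Real.mul_self_sqrt
    (div_nonneg (coulombA_pos l hx.le).le (mul_nonneg two_pos.le hE.le))
  rw [coulombA_eq l hx, ← hη, ← hP] at *
  set N := √(x ^ l * P / (2 * (1 - Real.exp (-(2 * Real.pi) / √x)))) with hNdef
  have hexp2 : Real.exp (-(Real.pi * η) / 2) * Real.exp (-(Real.pi * η) / 2)
      = Real.exp (-(Real.pi * η)) := by rw [← Real.exp_add]; congr 1; ring
  have hexp3 : 1 - Real.exp (-(2 * Real.pi) / √x)
      = 2 * Real.exp (-(Real.pi * η)) * Real.sinh (Real.pi * η) := by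
    rw [Real.sinh_eq]
    have : Real.exp (-(2 * Real.pi) / √x) = Real.exp (-(Real.pi * η)) * Real.exp (-(Real.pi * η)) := by
      rw [← Real.exp_add, hη]; congr 1; ring
    rw [this, Real.exp_neg]
    field_simp
  rw [hexp3] at hN
  have e0 : Real.exp (-(Real.pi * η)) ≠ 0 := (Real.exp_pos _).ne'
  have hx2 : x ^ l = (√x) ^ (2 * l) := by rw [pow_mul, Real.sq_sqrt hx.le]
  have h4 : ((1 : ℝ) / 4) ^ l * 2 ^ l * 2 ^ l = 1 := by
    rw [← mul_pow, ← mul_pow]; norm_num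
  set G := Complex.normSq (Complex.Gamma (l + 1 - Complex.I * η)) with hGd
  have hG0 : 0 < G := by rw [hG]; positivity
  calc _ = 4 * (N * N) * (Real.exp (-(Real.pi * η) / 2) * Real.exp (-(Real.pi * η) / 2)) *
        (((1 : ℝ) / 4) ^ l * 2 ^ l * 2 ^ l) ^ 2 / (√x ^ (2 * l + 2) * G) := by
        field_simp
        ring
    _ = _ := by
        rw [hN, hexp2, h4, hG, hx2, pow_add]
        field_simp
        linear_combination (-4) * hηk

theorem differentiableAt_complex_ofReal {f : ℝ → ℝ} {x : ℝ} (hf : DifferentiableAt ℝ f x) :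
    DifferentiableAt ℝ (fun x => (f x : ℂ)) x :=
  Complex.ofRealCLM.differentiableAt.comp x hf

theorem differentiableAt_inv_sqrt {x : ℝ} (hx : 0 < x) :
    DifferentiableAt ℝ (fun x : ℝ => 1 / √x) x := by
  have : √x ≠ 0 := (Real.sqrt_pos.2 hx).ne'
  have := hx.ne'
  fun_prop (disch := assumption)

theorem differentiableAt_Gamma_line (l : ℕ) {x : ℝ} (hx : 0 < x) :
    DifferentiableAt ℝ (fun x : ℝ => Complex.Gamma (l + 1 - Complex.I * (1 / √x : ℝ))) x := by
  have h1 : DifferentiableAt ℂ Complex.Gamma (l + 1 - Complex.I * (1 / √x : ℝ)) := by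
    refine Complex.differentiableAt_Gamma _ fun m hm => ?_
    have := congrArg Complex.re hm
    simp at this
    have := l.cast_nonneg (α := ℝ)
    have := m.cast_nonneg (α := ℝ)
    linarith
  have h2 : DifferentiableAt ℝ (fun x : ℝ => (l + 1 - Complex.I * (1 / √x : ℝ) : ℂ)) x :=
    ((differentiableAt_complex_ofReal (differentiableAt_inv_sqrt hx)).const_mul _).const_sub _
  exact (h1.restrictScalars ℝ).comp x h2

theorem differentiableAt_coulombConst (l : ℕ) {x : ℝ} (hx : 0 < x) :
    DifferentiableAt ℝ (coulombConst l) x := by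
  have hk : √x ≠ 0 := (Real.sqrt_pos.2 hx).ne'
  have hx0 := hx.ne'
  have hE := one_sub_exp_pos hx
  have hA : DifferentiableAt ℝ (fun x => coulombA x l) x := by
    unfold coulombA
    fun_prop
  have hG := differentiableAt_Gamma_line l hx
  have hN : DifferentiableAt ℝ
      (fun x : ℝ => Complex.normSq (Complex.Gamma (l + 1 - Complex.I * (1 / √x : ℝ)))) x := by
    simp only [Complex.normSq_eq_norm_sq]
    exact hG.norm_sq ℝ
  have hN0 : Complex.normSq (Complex.Gamma (l + 1 - Complex.I * (1 / √x : ℝ))) ≠ 0 := by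
    simpa using Gamma_nat_add_one_sub_I_mul_ne_zero l (1 / √x)
  have hQ : coulombA x l / (2 * (1 - Real.exp (-(2 * Real.pi) / √x))) ≠ 0 :=
    (div_pos (coulombA_pos l hx.le) (by linarith)).ne'
  have hE2 : 2 * (1 - Real.exp (-(2 * Real.pi) / √x)) ≠ 0 := by linarith
  unfold coulombConst
  refine DifferentiableAt.mul (DifferentiableAt.sqrt (hA.div ?_ hE2) hQ) ?_
  · fun_prop (disch := assumption)
  · exact (differentiableAt_const _).div hN hN0

/-- Needed so that the difference quotient of the amplitude at a extends continuously through a. -/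
theorem differentiableAt_coulombAmp (l : ℕ) {x : ℝ} (hx : 0 < x) :
    DifferentiableAt ℝ (coulombAmp l) x := by
  have hk : √x ≠ 0 := (Real.sqrt_pos.2 hx).ne'
  have hk2 : √x ^ (l + 1) ≠ 0 := pow_ne_zero _ hk
  have hx0 := hx.ne'
  have hG := differentiableAt_Gamma_line l hx
  have hC := differentiableAt_coulombConst l hx
  have h1 : DifferentiableAt ℝ (fun x : ℝ => 2 * coulombConst l x *
      Real.exp (-(Real.pi * (1 / √x)) / 2) * 2 ^ l / √x ^ (l + 1)) x := by
    fun_prop (disch := assumption)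
  have h2 : DifferentiableAt ℝ (fun x : ℝ => 1 / √x * (Real.log 2 + Real.log √x)) x := by
    fun_prop (disch := assumption)
  unfold coulombAmp
  exact ((differentiableAt_complex_ofReal h1).const_mul _).mul
    ((((differentiableAt_complex_ofReal h2).const_mul _).cexp.const_mul _).mul hG)

/-! ### Bounds uniform in the energy, by a WKB energy -/

theorem hasDerivAt_coulombPotential (κ β L : ℝ) {r : ℝ} (hr : 0 < r) :
    HasDerivAt (fun r : ℝ => κ + 2 * β / r - L / r ^ 2) (-(2 * β) / r ^ 2 + 2 * L / r ^ 3) r := by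
  have h1 := ((hasDerivAt_inv hr.ne').const_mul (2 * β)).const_add κ
  have h2 := ((hasDerivAt_pow 2 r).inv (pow_ne_zero 2 hr.ne')).const_mul L
  refine (h1.sub h2).congr_deriv ?_
  field_simp
  ring

theorem hasDerivAt_coulombPotential_deriv (β L : ℝ) {r : ℝ} (hr : 0 < r) :
    HasDerivAt (fun r : ℝ => -(2 * β) / r ^ 2 + 2 * L / r ^ 3) (4 * β / r ^ 3 - 6 * L / r ^ 4) r := by
  have h1 := ((hasDerivAt_pow 2 r).inv (pow_ne_zero 2 hr.ne')).const_mul (-(2 * β))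
  have h2 := ((hasDerivAt_pow 3 r).inv (pow_ne_zero 3 hr.ne')).const_mul (2 * L)
  refine (h1.add h2).congr_deriv ?_
  field_simp
  ring

/-- A corrected WKB energy is almost conserved along solutions of `y'' = -Q y`. -/
theorem hasDerivAt_wkbEnergy {Q Q' y y1 : ℝ → ℝ} {Q'' r : ℝ} (hQ : HasDerivAt Q (Q' r) r)
    (hQ' : HasDerivAt Q' Q'' r) (hy : HasDerivAt y (y1 r) r)
    (hy1 : HasDerivAt y1 (-Q r * y r) r) (hpos : 0 < Q r) :
    HasDerivAt (fun r => √(Q r) * y r ^ 2 + y1 r ^ 2 / √(Q r) +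
        Q' r / (2 * (Q r * √(Q r))) * (y r * y1 r))
      ((Q'' / (2 * (Q r * √(Q r))) - 3 / 4 * Q' r ^ 2 / (Q r ^ 2 * √(Q r))) * (y r * y1 r)) r := by
  have hq : 0 < √(Q r) := Real.sqrt_pos.2 hpos
  have dq := hQ.sqrt hpos.ne'
  have d1 := dq.mul (hy.pow 2)
  have d2 := (hy1.pow 2).div dq hq.ne'
  have d3 := (hQ'.div ((hQ.mul dq).const_mul 2) (by simp; exact ⟨hpos.ne', hq.ne'⟩)).mul (hy.mul hy1)
  refine ((d1.add d2).add d3).congr_deriv ?_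
  simp only [Pi.mul_apply, Pi.pow_apply, Pi.div_apply]
  obtain ⟨q, hq', hQq⟩ : ∃ q, √(Q r) = q ∧ Q r = q ^ 2 := ⟨_, rfl, (Real.sq_sqrt hpos.le).symm⟩
  rw [hq'] at hq ⊢
  rw [hQq]
  field_simp
  ring

/-- After rescaling r by max(1, √x), the potential has κ = 1 (high energy) or β = 1 (low energy). In
either case Q ≥ 1/r once r ≥ L + 4. The worst case is κ = 0, β = 1, where Q is of order 1/r, and
even there the rate of change of the corrected energy is O(r^{-3/2}), hence integrable. -/
theorem coulombPotential_bounds {L κ β : ℝ} (hL : 0 ≤ L) (hκ : 0 ≤ κ) (hκ1 : κ ≤ 1) (hβ : 0 ≤ β)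
    (hβ1 : β ≤ 1) (hκβ : κ = 1 ∨ β = 1) {Q Q' : ℝ → ℝ}
    (hQdef : Q = fun r => κ + 2 * β / r - L / r ^ 2)
    (hQ'def : Q' = fun r => -(2 * β) / r ^ 2 + 2 * L / r ^ 3) {r : ℝ} (hr : L + 4 ≤ r) :
    1 / r ≤ Q r ∧ κ ≤ 2 * Q r ∧ Q r ≤ 4 ∧ |Q' r / (2 * (Q r * √(Q r)))| ≤ 1 ∧
      |(4 * β / r ^ 3 - 6 * L / r ^ 4) / (2 * (Q r * √(Q r)))
        - 3 / 4 * Q' r ^ 2 / (Q r ^ 2 * √(Q r))| ≤ 17 / (r * √r) := by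
  have hterm : ∀ r, L + 4 ≤ r → 0 ≤ L / r ^ 2 ∧ L / r ^ 2 ≤ 1 / r ∧ 1 / r ≤ 1 / 4 ∧
      0 ≤ β / r ∧ 0 < 1 / r ∧ β / r ≤ 1 / r := by
    intro r hr
    have hr0 : 0 < r := by linarith
    refine ⟨by positivity, ?_, ?_, by positivity, by positivity, by gcongr⟩
    · rw [div_le_div_iff₀ (by positivity) hr0]; nlinarith
    · rw [div_le_div_iff₀ hr0 (by norm_num)]; linarith
  have hQr : ∀ r, Q r = κ + 2 * (β / r) - L / r ^ 2 := fun r => by rw [hQdef]; ring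
  have hQlow : ∀ r, L + 4 ≤ r → 1 / r ≤ Q r := by
    intro r hr
    obtain ⟨h1, h2, h3, h4, h5, h6⟩ := hterm r hr
    rw [hQr]
    rcases hκβ with h | h
    · rw [h]; linarith
    · rw [h] at h4 ⊢; linarith
  have hQκ : ∀ r, L + 4 ≤ r → κ ≤ 2 * Q r := by
    intro r hr
    obtain ⟨h1, h2, h3, h4, h5, h6⟩ := hterm r hr
    rw [hQr]
    rcases hκβ with h | h
    · rw [h]; linarith
    · rw [h] at h4 ⊢; linarith
  have hQup : ∀ r, L + 4 ≤ r → Q r ≤ 4 := by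
    intro r hr
    obtain ⟨h1, h2, h3, h4, h5, h6⟩ := hterm r hr
    rw [hQr]; linarith
  have hαs : ∀ r, L + 4 ≤ r → |Q' r / (2 * (Q r * √(Q r)))| ≤ 1 ∧
      |(4 * β / r ^ 3 - 6 * L / r ^ 4) / (2 * (Q r * √(Q r)))
        - 3 / 4 * Q' r ^ 2 / (Q r ^ 2 * √(Q r))| ≤ 17 / (r * √r) := by
    intro r hr
    have hr0 : 0 < r := by linarith
    obtain ⟨s, hs, hrs⟩ : ∃ s, 0 < s ∧ r = s ^ 2 :=
      ⟨√r, Real.sqrt_pos.2 hr0, (Real.sq_sqrt hr0.le).symm⟩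
    have hs2 : 2 ≤ s := by nlinarith
    have hsr : √r = s := by rw [hrs, Real.sqrt_sq hs.le]
    have hq : 1 / s ≤ √(Q r) := by
      apply Real.le_sqrt_of_sq_le
      rw [div_pow, one_pow, ← hrs]; exact hQlow r hr
    have hQs : 1 / s ^ 2 ≤ Q r := by rw [← hrs]; exact hQlow r hr
    have hQ0 : 0 ≤ Q r := le_trans (by positivity) hQs
    have hp1 : 0 < 1 / s := by positivity
    have hp2 : 0 < 1 / s ^ 2 := by positivity
    have hden : 1 / s ^ 3 ≤ Q r * √(Q r) := by
      calc 1 / s ^ 3 = 1 / s ^ 2 * (1 / s) := by field_simp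
        _ ≤ _ := by gcongr
    have hden2 : 1 / s ^ 5 ≤ Q r ^ 2 * √(Q r) := by
      calc 1 / s ^ 5 = (1 / s ^ 2) ^ 2 * (1 / s) := by field_simp
        _ ≤ _ := by gcongr
    have hLs : L ≤ s ^ 2 := by rw [← hrs]; linarith
    have hQ's : |Q' r| ≤ 4 / s ^ 4 := by
      have e : Q' r = (-(2 * β) * s ^ 2 + 2 * L) / s ^ 6 := by
        simp only [hQ'def]; rw [hrs]; field_simp
      rw [e, abs_div, abs_of_pos (pow_pos hs 6), div_le_div_iff₀ (by positivity) (by positivity)]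
      have : |-(2 * β) * s ^ 2 + 2 * L| ≤ 4 * s ^ 2 := by
        rw [abs_le]; constructor <;> nlinarith [sq_nonneg s]
      calc _ ≤ 4 * s ^ 2 * s ^ 4 := by gcongr
        _ = _ := by ring
    have hQ''s : |4 * β / r ^ 3 - 6 * L / r ^ 4| ≤ 10 / s ^ 6 := by
      have e : 4 * β / r ^ 3 - 6 * L / r ^ 4 = (4 * β * s ^ 2 - 6 * L) / s ^ 8 := by
        rw [hrs]; field_simp
      rw [e, abs_div, abs_of_pos (pow_pos hs 8), div_le_div_iff₀ (by positivity) (by positivity)]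
      have : |4 * β * s ^ 2 - 6 * L| ≤ 10 * s ^ 2 := by
        rw [abs_le]; constructor <;> nlinarith [sq_nonneg s]
      calc _ ≤ 10 * s ^ 2 * s ^ 6 := by gcongr
        _ = _ := by ring
    have hd3 : 0 < 1 / s ^ 3 := by positivity
    have hd5 : 0 < 1 / s ^ 5 := by positivity
    constructor
    · rw [abs_div, abs_of_pos (by linarith : 0 < 2 * (Q r * √(Q r)))]
      calc _ ≤ 4 / s ^ 4 / (2 * (1 / s ^ 3)) := by gcongr
        _ = 2 / s := by field_simp; norm_num
        _ ≤ 1 := by rw [div_le_one hs]; exact hs2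
    · refine (abs_sub _ _).trans ?_
      rw [abs_div, abs_of_pos (by linarith : 0 < 2 * (Q r * √(Q r))), abs_div,
        abs_of_pos (by linarith : 0 < Q r ^ 2 * √(Q r)), abs_mul, abs_pow,
        abs_of_pos (by norm_num : (0 : ℝ) < 3 / 4)]
      -- With r = s² the two terms are 5/s³ and 12/s³, whence 17.
      calc _ ≤ 10 / s ^ 6 / (2 * (1 / s ^ 3)) + 3 / 4 * (4 / s ^ 4) ^ 2 / (1 / s ^ 5) := by gcongr
        _ = 17 / (r * √r) := by rw [hsr, hrs]; field_simp; norm_num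
  exact ⟨hQlow r hr, hQκ r hr, hQup r hr, hαs r hr⟩

/-- A Gronwall argument: the correction term is at most half of the leading energy √Q y² + y'²/√Q,
so E is comparable with it, and |E'| ≤ 17 r^{-3/2} E. The constants depend neither on κ nor on β. -/
theorem wkbEnergy_bound {L κ β : ℝ} (hL : 0 ≤ L) (hκ : 0 ≤ κ) (hκ1 : κ ≤ 1) (hβ : 0 ≤ β)
    (hβ1 : β ≤ 1) (hκβ : κ = 1 ∨ β = 1) {y y1 : ℝ → ℝ}
    (hy : ∀ r, 0 < r → HasDerivAt y (y1 r) r)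
    (hy1 : ∀ r, 0 < r → HasDerivAt y1 (-(κ + 2 * β / r - L / r ^ 2) * y r) r)
    {ξ r : ℝ} (hξ : L + 4 ≤ ξ) (hr : ξ ≤ r) :
    √κ * y r ^ 2 ≤ 12 * Real.exp 17 * √ξ * (y ξ ^ 2 + y1 ξ ^ 2) ∧
      y1 r ^ 2 ≤ 12 * Real.exp 17 * √ξ * (y ξ ^ 2 + y1 ξ ^ 2) := by
  set Q : ℝ → ℝ := fun r => κ + 2 * β / r - L / r ^ 2 with hQdef
  set Q' : ℝ → ℝ := fun r => -(2 * β) / r ^ 2 + 2 * L / r ^ 3 with hQ'def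
  have hb : ∀ r, L + 4 ≤ r → _ := fun r hr =>
    coulombPotential_bounds hL hκ hκ1 hβ hβ1 hκβ hQdef hQ'def hr
  have hQlow : ∀ r, L + 4 ≤ r → 1 / r ≤ Q r := fun r hr => (hb r hr).1
  have hQκ : ∀ r, L + 4 ≤ r → κ ≤ 2 * Q r := fun r hr => (hb r hr).2.1
  have hQup : ∀ r, L + 4 ≤ r → Q r ≤ 4 := fun r hr => (hb r hr).2.2.1
  have hαs : ∀ r, L + 4 ≤ r → |Q' r / (2 * (Q r * √(Q r)))| ≤ 1 ∧
      |(4 * β / r ^ 3 - 6 * L / r ^ 4) / (2 * (Q r * √(Q r)))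
        - 3 / 4 * Q' r ^ 2 / (Q r ^ 2 * √(Q r))| ≤ 17 / (r * √r) :=
    fun r hr => (hb r hr).2.2.2
  clear hb
  set E : ℝ → ℝ := fun r => √(Q r) * y r ^ 2 + y1 r ^ 2 / √(Q r) +
        Q' r / (2 * (Q r * √(Q r))) * (y r * y1 r) with hE
  have hqpos : ∀ r, L + 4 ≤ r → 0 < Q r ∧ 0 < √(Q r) := fun r hr => by
    have hr0 : 0 < r := by linarith
    have h := (one_div_pos.2 hr0).trans_le (hQlow r hr)
    exact ⟨h, Real.sqrt_pos.2 h⟩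
  have hcross : ∀ r, L + 4 ≤ r → |y r * y1 r| ≤ (√(Q r) * y r ^ 2 + y1 r ^ 2 / √(Q r)) / 2 := by
    intro r hr
    obtain ⟨h0, hq⟩ := hqpos r hr
    have h1 : √(Q r) * y r ^ 2 + y1 r ^ 2 / √(Q r)
        = ((√(Q r) * |y r|) ^ 2 + |y1 r| ^ 2) / √(Q r) := by
      rw [mul_pow, sq_abs, sq_abs]; field_simp
    rw [h1, abs_mul, div_div, le_div_iff₀ (by positivity)]
    nlinarith [sq_nonneg (√(Q r) * |y r| - |y1 r|)]
  have hEcmp : ∀ r, L + 4 ≤ r → (√(Q r) * y r ^ 2 + y1 r ^ 2 / √(Q r)) / 2 ≤ E r ∧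
      E r ≤ 3 / 2 * (√(Q r) * y r ^ 2 + y1 r ^ 2 / √(Q r)) := by
    intro r hr
    have h1 := hcross r hr
    have h2 := (hαs r hr).1
    have h3 : |Q' r / (2 * (Q r * √(Q r))) * (y r * y1 r)|
        ≤ (√(Q r) * y r ^ 2 + y1 r ^ 2 / √(Q r)) / 2 := by
      rw [abs_mul]
      calc _ ≤ 1 * ((√(Q r) * y r ^ 2 + y1 r ^ 2 / √(Q r)) / 2) := by gcongr
        _ = _ := one_mul _
    have := abs_le.1 h3
    simp only [hE]
    constructor <;> linarith
  -- The integrating factor: 34 r^{-1/2} has derivative -17 r^{-3/2}, which offsets the growth rate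
  -- of E.
  have hEd : ∀ r, L + 4 ≤ r → HasDerivAt (fun r => E r * Real.exp (34 * (√r)⁻¹))
      (((4 * β / r ^ 3 - 6 * L / r ^ 4) / (2 * (Q r * √(Q r)))
        - 3 / 4 * Q' r ^ 2 / (Q r ^ 2 * √(Q r))) * (y r * y1 r) * Real.exp (34 * (√r)⁻¹) +
        E r * (Real.exp (34 * (√r)⁻¹) * (-(17 / (r * √r))))) r := by
    intro r hr
    have hr0 : 0 < r := by linarith
    have hs : 0 < √r := Real.sqrt_pos.2 hr0
    have d1 := hasDerivAt_wkbEnergy (Q := Q) (Q' := Q') (hasDerivAt_coulombPotential κ β L hr0)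
      (hasDerivAt_coulombPotential_deriv β L hr0) (hy r hr0) (hy1 r hr0) (hqpos r hr).1
    have d2 := ((((hasDerivAt_id r).sqrt hr0.ne').inv hs.ne').const_mul 34).exp
    refine (d1.mul d2).congr_deriv ?_
    congr 3
    simp only [id]
    rw [Real.sq_sqrt hr0.le]
    field_simp
    norm_num
  have hanti : AntitoneOn (fun r => E r * Real.exp (34 * (√r)⁻¹)) (Ici (L + 4)) := by
    refine antitoneOn_of_deriv_nonpos (convex_Ici _)
      (fun r hr => (hEd r hr).continuousAt.continuousWithinAt)
      (fun r hr => (hEd r (interior_subset hr)).differentiableAt.differentiableWithinAt)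
      fun r hr => ?_
    have hr' : L + 4 ≤ r := interior_subset hr
    rw [(hEd r hr').deriv]
    have hr0 : 0 < r := by linarith
    have h1 := (hαs r hr').2
    have h2 := hcross r hr'
    have h3 := (hEcmp r hr').1
    have h4 : 0 < 17 / (r * √r) := by have := Real.sqrt_pos.2 hr0; positivity
    set α := (4 * β / r ^ 3 - 6 * L / r ^ 4) / (2 * (Q r * √(Q r)))
        - 3 / 4 * Q' r ^ 2 / (Q r ^ 2 * √(Q r))
    have h5 : α * (y r * y1 r) ≤ 17 / (r * √r) * E r := by
      calc α * (y r * y1 r) ≤ |α| * |y r * y1 r| := by rw [← abs_mul]; exact le_abs_self _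
        _ ≤ 17 / (r * √r) * E r := by gcongr; exact h2.trans h3
    have : α * (y r * y1 r) * Real.exp (34 * (√r)⁻¹) +
        E r * (Real.exp (34 * (√r)⁻¹) * (-(17 / (r * √r))))
        = Real.exp (34 * (√r)⁻¹) * (α * (y r * y1 r) - 17 / (r * √r) * E r) := by ring
    rw [this]
    exact mul_nonpos_of_nonneg_of_nonpos (Real.exp_pos _).le (by linarith)
  have hr' : L + 4 ≤ r := hξ.trans hr
  have hξ0 : 0 < ξ := by linarith
  have hsξ : 2 ≤ √ξ := Real.le_sqrt_of_sq_le (by linarith)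
  have hmono := hanti (show ξ ∈ Ici (L + 4) from hξ) (show r ∈ Ici (L + 4) from hr') hr
  simp only at hmono
  have hEr0 : 0 ≤ E r := by
    refine le_trans ?_ (hEcmp r hr').1
    have := (hqpos r hr').2
    positivity
  have hEξ0 : 0 ≤ E ξ := by
    refine le_trans ?_ (hEcmp ξ hξ).1
    have := (hqpos ξ hξ).2
    positivity
  -- Since ξ ≥ 4, the integrating factor at ξ is at most exp(34/2).
  have h1 : E r ≤ Real.exp 17 * E ξ := by
    have e1 : (1 : ℝ) ≤ Real.exp (34 * (√r)⁻¹) := Real.one_le_exp (by positivity)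
    have e2 : Real.exp (34 * (√ξ)⁻¹) ≤ Real.exp 17 := by
      rw [Real.exp_le_exp]
      have : (√ξ)⁻¹ ≤ 2⁻¹ := inv_anti₀ (by norm_num) hsξ
      linarith
    calc E r ≤ E r * Real.exp (34 * (√r)⁻¹) := le_mul_of_one_le_right hEr0 e1
      _ ≤ E ξ * Real.exp (34 * (√ξ)⁻¹) := hmono
      _ ≤ E ξ * Real.exp 17 := by gcongr
      _ = _ := mul_comm _ _
  have h2 : E ξ ≤ 3 / 2 * (√ξ * (y ξ ^ 2 + y1 ξ ^ 2)) := by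
    refine (hEcmp ξ hξ).2.trans ?_
    have hq2 : √(Q ξ) ≤ √ξ := by
      refine (Real.sqrt_le_sqrt (hQup ξ hξ)).trans (Real.sqrt_le_sqrt (by linarith))
    have hq1 : 1 / √(Q ξ) ≤ √ξ := by
      have := (hqpos ξ hξ).2
      have h : 1 / √ξ ≤ √(Q ξ) := by
        apply Real.le_sqrt_of_sq_le
        rw [div_pow, one_pow, Real.sq_sqrt hξ0.le]; exact hQlow ξ hξ
      rw [div_le_iff₀ (by linarith)] at h
      rw [div_le_iff₀ this]; linarith
    have a1 : √(Q ξ) * y ξ ^ 2 ≤ √ξ * y ξ ^ 2 := by gcongr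
    have a2 : y1 ξ ^ 2 / √(Q ξ) ≤ √ξ * y1 ξ ^ 2 := by
      calc y1 ξ ^ 2 / √(Q ξ) = 1 / √(Q ξ) * y1 ξ ^ 2 := by ring
        _ ≤ _ := by gcongr
    linarith
  have h3 := (hEcmp r hr').1
  obtain ⟨hQpos, hq⟩ := hqpos r hr'
  have hK : √(Q r) * y r ^ 2 + y1 r ^ 2 / √(Q r) ≤ 3 * Real.exp 17 * √ξ * (y ξ ^ 2 + y1 ξ ^ 2) := by
    have := mul_le_mul_of_nonneg_left h2 (Real.exp_pos 17).le
    calc _ ≤ 2 * E r := by linarith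
      _ ≤ 2 * (Real.exp 17 * (3 / 2 * (√ξ * (y ξ ^ 2 + y1 ξ ^ 2)))) := by linarith
      _ = _ := by ring
  set K := 3 * Real.exp 17 * √ξ * (y ξ ^ 2 + y1 ξ ^ 2) with hKd
  have hK0 : 0 ≤ K := by positivity
  have hgoal : 12 * Real.exp 17 * √ξ * (y ξ ^ 2 + y1 ξ ^ 2) = 4 * K := by rw [hKd]; ring
  rw [hgoal]
  have b1 : 0 ≤ √(Q r) * y r ^ 2 := by positivity
  have b2 : 0 ≤ y1 r ^ 2 / √(Q r) := by positivity
  constructor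
  · have : √κ ≤ 2 * √(Q r) := by
      rw [show (2 : ℝ) * √(Q r) = √(4 * Q r) by
        rw [Real.sqrt_mul (by norm_num), show √(4 : ℝ) = 2 by
          rw [show (4 : ℝ) = 2 ^ 2 by norm_num, Real.sqrt_sq (by norm_num)]]]
      exact Real.sqrt_le_sqrt (by linarith [hQκ r hr'])
    calc √κ * y r ^ 2 ≤ 2 * √(Q r) * y r ^ 2 := by gcongr
      _ = 2 * (√(Q r) * y r ^ 2) := by ring
      _ ≤ 4 * K := by linarith
  · have hq2 : √(Q r) ≤ 2 := by
      rw [show (2 : ℝ) = √4 by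
        rw [show (4 : ℝ) = 2 ^ 2 by norm_num, Real.sqrt_sq (by norm_num)]]
      exact Real.sqrt_le_sqrt (hQup r hr')
    calc y1 r ^ 2 = √(Q r) * (y1 r ^ 2 / √(Q r)) := by field_simp
      _ ≤ 2 * K := by
          refine mul_le_mul hq2 ?_ b2 (by norm_num)
          linarith
      _ ≤ 4 * K := by linarith

/-- The `r`-derivative of `coulombS`. -/
noncomputable def coulombSDeriv (x : ℝ) (l : ℕ) (r : ℝ) : ℝ :=
  coulombConst l x * regCoulombDeriv l (√x) (1 / √x) r

theorem regCoulomb_scale (l : ℕ) {k m η r : ℝ} (hm : 0 < m) :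
    m ^ (l + 1) * regCoulomb l k η r = regCoulomb l (k / m) η (m * r) := by
  rw [regCoulomb, regCoulomb, show k / m * (m * r) = k * r by field_simp, mul_pow]
  ring

theorem regCoulombDeriv_scale (l : ℕ) {k m η r : ℝ} (hm : 0 < m) :
    m ^ l * regCoulombDeriv l k η r = regCoulombDeriv l (k / m) η (m * r) := by
  rw [regCoulombDeriv, regCoulombDeriv, show k / m * (m * r) = k * r by field_simp, mul_pow,
    mul_pow, pow_succ]
  field_simp
  ring

/-- In the variable ρ = m r the equation has the form required by `wkbEnergy_bound`. The power
series controls the solution for ρ ≤ L + 5, with a bound free of x, and the WKB energy continues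
this control to infinity. -/
theorem exists_coulomb_uniform_bound (l : ℕ) : ∃ K r₁ : ℝ, 0 < K ∧ 0 < r₁ ∧
    ∀ x m B : ℝ, 0 < x → m = max 1 (√x) →
      B = (2 : ℝ) ^ (l + 1) * (1 / 4) ^ l / 2 /
        Complex.normSq (Complex.Gamma (l + 1 - Complex.I * (1 / √x : ℝ))) →
      (∀ ρ, 0 ≤ ρ → √x / m * (B * regCoulomb l (√x / m) (1 / √x) ρ) ^ 2 ≤ K) ∧
      (∀ ρ, r₁ ≤ ρ → (B * regCoulombDeriv l (√x / m) (1 / √x) ρ) ^ 2 ≤ K) := by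
  set L : ℝ := l * (l + 1) with hL
  have hL0 : 0 ≤ L := by positivity
  set M : ℝ := (2 * (L + 5)) ^ (l + 1) * Real.exp (2 * (L + 5)) with hM
  have hM0 : 0 < M := by positivity
  set K : ℝ := 12 * Real.exp 17 * √(L + 5) * (M ^ 2 + (2 * M) ^ 2) with hK
  refine ⟨K + M ^ 2, L + 5, by positivity, by positivity, fun x m B hx hm hB => ?_⟩
  have hk : 0 < √x := Real.sqrt_pos.2 hx
  have hm1 : 1 ≤ m := hm ▸ le_max_left _ _
  have hkm : √x ≤ m := hm ▸ le_max_right _ _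
  have hm0 : 0 < m := by linarith
  set σ := √x / m with hσ
  have hσ0 : 0 < σ := by positivity
  have hσ1 : σ ≤ 1 := (div_le_one hm0).2 hkm
  set y : ℝ → ℝ := fun ρ => B * regCoulomb l σ (1 / √x) ρ with hy
  set y1 : ℝ → ℝ := fun ρ => B * regCoulombDeriv l σ (1 / √x) ρ with hy1
  have hyM : ∀ ρ, 0 ≤ ρ → ρ ≤ L + 5 → |y ρ| ≤ M := by
    intro ρ h0 hρ
    -- At the unscaled radius ρ/m the exponent 2rm becomes 2ρ, and m^(l+1) cancels against the power
    -- of r.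
    have h1 := norm_coulombF_le l (r := ρ / m) hx (by positivity) hm1 hkm
    have h2 := coulombF_re l hx (ρ / m)
    rw [← hB] at h2
    have h3 : y ρ = m ^ (l + 1) * (coulombF x l (ρ / m)).re := by
      have := regCoulomb_scale l (k := √x) (η := 1 / √x) (r := ρ / m) hm0
      rw [mul_div_cancel₀ _ hm0.ne', ← hσ] at this
      rw [h2]; simp only [hy]; rw [← this]; ring
    rw [h3, abs_mul, abs_of_pos (by positivity)]
    calc _ ≤ m ^ (l + 1) * ((2 * (ρ / m)) ^ (l + 1) * Real.exp (2 * (ρ / m) * m)) := by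
          gcongr; exact (Complex.abs_re_le_norm _).trans h1
      _ = (2 * ρ) ^ (l + 1) * Real.exp (2 * ρ) := by
          rw [show 2 * (ρ / m) * m = 2 * ρ by field_simp, ← mul_assoc, ← mul_pow]
          congr 2; field_simp
      _ ≤ M := by rw [hM]; gcongr
  have hd : ∀ r, HasDerivAt y (y1 r) r := fun r =>
    (hasDerivAt_regCoulomb l σ (1 / √x) r).const_mul B
  have hd1 : ∀ r, 0 < r →
      HasDerivAt y1 (-(σ ^ 2 + 2 * (1 / m) / r - L / r ^ 2) * y r) r := by
    intro r hr
    refine ((hasDerivAt_regCoulombDeriv l σ (1 / √x) hr.ne').const_mul B).congr_deriv ?_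
    have : σ * (1 / √x) = 1 / m := by rw [hσ]; field_simp
    rw [this, hL]; simp only [hy]; ring
  -- The mean value theorem supplies a starting point where the derivative is controlled by values
  -- of y alone, so no separate estimate of y' is required.
  obtain ⟨ξ, hξ, hξd⟩ := exists_hasDerivAt_eq_slope y y1 (show L + 4 < L + 5 by linarith)
    (fun r _ => (hd r).continuousAt.continuousWithinAt) (fun r _ => hd r)
  have hξ0 : 0 < ξ := by linarith [hξ.1]
  have hyξ : y ξ ^ 2 ≤ M ^ 2 := sq_le_sq' (by linarith [(abs_le.1 (hyM ξ hξ0.le hξ.2.le)).1])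
    (abs_le.1 (hyM ξ hξ0.le hξ.2.le)).2
  have hy1ξ : y1 ξ ^ 2 ≤ (2 * M) ^ 2 := by
    have h1 := abs_le.1 (hyM (L + 4) (by linarith) (by linarith))
    have h2 := abs_le.1 (hyM (L + 5) (by linarith) le_rfl)
    rw [hξd, show L + 5 - (L + 4) = 1 by ring, div_one]
    exact sq_le_sq' (by linarith [h1.1, h1.2]) (by linarith [h1.1, h1.2])
  have hκβ : σ ^ 2 = 1 ∨ 1 / m = 1 := by
    rcases le_total (√x) 1 with h | h
    · right; rw [hm, max_eq_left h, div_one]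
    · left; rw [hσ, hm, max_eq_right h, div_self hk.ne', one_pow]
  have hbd : ∀ r, L + 5 ≤ r → σ * y r ^ 2 ≤ K ∧ y1 r ^ 2 ≤ K := by
    intro r hr
    have h := wkbEnergy_bound hL0 (sq_nonneg σ) (pow_le_one₀ hσ0.le hσ1)
      (show (0 : ℝ) ≤ 1 / m by positivity) ((div_le_one hm0).2 hm1) hκβ (fun r _ => hd r) hd1
      hξ.1.le (hξ.2.le.trans hr)
    rw [Real.sqrt_sq hσ0.le] at h
    have : 12 * Real.exp 17 * √ξ * (y ξ ^ 2 + y1 ξ ^ 2) ≤ K := by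
      rw [hK]
      have : √ξ ≤ √(L + 5) := Real.sqrt_le_sqrt hξ.2.le
      gcongr
    exact ⟨h.1.trans this, h.2.trans this⟩
  refine ⟨fun ρ hρ => ?_, fun ρ hρ => ?_⟩
  · rcases le_total (L + 5) ρ with h | h
    · exact (hbd ρ h).1.trans (by linarith [sq_nonneg M])
    · have h1 := abs_le.1 (hyM ρ hρ h)
      have h2 : y ρ ^ 2 ≤ M ^ 2 := sq_le_sq' (by linarith) h1.2
      have h3 : σ * y ρ ^ 2 ≤ 1 * M ^ 2 := by gcongr
      have hK0 : 0 ≤ K := by positivity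
      exact h3.trans (by linarith)
  · exact (hbd ρ hρ).2.trans (by linarith [sq_nonneg M])

/-- Uniform bounds for the Coulomb wave function and its derivative. -/
theorem coulombS_bounds (l : ℕ) : ∃ C r₁ : ℝ, 0 < C ∧ 0 < r₁ ∧ ∀ x : ℝ, 0 < x →
    (∀ r, 0 ≤ r → √x * coulombS x l r ^ 2 ≤ C) ∧
    (∀ r, r₁ ≤ max 1 (√x) * r → coulombSDeriv x l r ^ 2 ≤ C * max 1 (√x)) := by
  obtain ⟨K, r₁, hK, hr₁, hb⟩ := exists_coulomb_uniform_bound l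
  obtain ⟨C, hC, hN⟩ := coulombNorm_le l
  refine ⟨C * K, r₁, by positivity, hr₁, fun x hx => ?_⟩
  set m := max 1 (√x) with hm
  have hk : 0 < √x := Real.sqrt_pos.2 hx
  have hm1 : 1 ≤ m := hm ▸ le_max_left _ _
  have hkm : √x ≤ m := hm ▸ le_max_right _ _
  have hm0 : 0 < m := by linarith
  obtain ⟨b1, b2⟩ := hb x m _ hx hm rfl
  set B := (2 : ℝ) ^ (l + 1) * (1 / 4) ^ l / 2 /
        Complex.normSq (Complex.Gamma (l + 1 - Complex.I * (1 / √x : ℝ))) with hB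
  have hA0 : 0 ≤ coulombA x l / (2 * (1 - Real.exp (-(2 * Real.pi) / √x))) :=
    div_nonneg (coulombA_pos l hx.le).le (by linarith [one_sub_exp_pos hx])
  have hN2 := Real.sq_sqrt hA0
  have hNle := hN x m hx hm1 hkm
  rw [← hN2] at hNle
  have hconst : coulombConst l x
      = √(coulombA x l / (2 * (1 - Real.exp (-(2 * Real.pi) / √x)))) * B := rfl
  set N := √(coulombA x l / (2 * (1 - Real.exp (-(2 * Real.pi) / √x)))) with hNdef
  constructor
  · intro r hr
    have h := b1 (m * r) (by positivity)
    rw [← regCoulomb_scale l hm0] at h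
    rw [coulombS_eq l hx, hconst]
    set f := regCoulomb l (√x) (1 / √x) r
    -- The m^(2l+1) in the bound for N² cancels exactly against the powers of m from rescaling. For
    -- the derivative below one factor m remains.
    calc √x * (N * B * f) ^ 2 = N ^ 2 * (√x / m * (B * (m ^ (l + 1) * f)) ^ 2) / m ^ (2 * l + 1) := by
          field_simp
          ring
      _ ≤ C * m ^ (2 * l + 1) * K / m ^ (2 * l + 1) := by gcongr
      _ = C * K := by field_simp
  · intro r hr
    have h := b2 (m * r) hr
    rw [← regCoulombDeriv_scale l hm0] at h
    rw [coulombSDeriv, hconst]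
    set f := regCoulombDeriv l (√x) (1 / √x) r
    calc (N * B * f) ^ 2 = N ^ 2 * (B * (m ^ l * f)) ^ 2 / m ^ (2 * l) := by
          field_simp
          ring
      _ ≤ C * m ^ (2 * l + 1) * K / m ^ (2 * l) := by gcongr
      _ = C * K * m := by field_simp; ring

/-! ### Contour rotation and Watson's lemma -/

/-- The analytic continuation of the integrand of `eulerInt` to the upper half plane. -/
noncomputable def eulerIntegrand (l p : ℕ) (η ρ : ℝ) (z : ℂ) : ℂ :=
  (Complex.I * z) ^ p * Complex.exp (Complex.I * ρ * z) * (1 - z ^ 2) ^ l *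
    Complex.exp (Complex.I * η * (Complex.log (1 + z) - Complex.log (1 - z)))

theorem eulerIntegrand_ofReal_re (l p : ℕ) (η ρ : ℝ) {u : ℝ} (hu : u ∈ Ioo (-1 : ℝ) 1) :
    (eulerIntegrand l p η ρ u).re
      = u ^ p * (1 - u ^ 2) ^ l * Real.cos (eulerPhase η ρ u + p * (Real.pi / 2)) := by
  have h1 : Complex.log (1 + u) = (Real.log (1 + u) : ℝ) := by
    rw [Complex.ofReal_log (by linarith [hu.1])]; push_cast; rfl
  have h2 : Complex.log (1 - u) = (Real.log (1 - u) : ℝ) := by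
    rw [Complex.ofReal_log (by linarith [hu.2])]; push_cast; rfl
  have h3 : Complex.I ^ p = Complex.exp (p * (Real.pi / 2 * Complex.I)) := by
    rw [Complex.exp_nat_mul, Complex.exp_pi_div_two_mul_I]
  have : eulerIntegrand l p η ρ u = ((u ^ p * (1 - u ^ 2) ^ l : ℝ) : ℂ) *
      Complex.exp ((eulerPhase η ρ u + p * (Real.pi / 2) : ℝ) * Complex.I) := by
    have e : ((eulerPhase η ρ u + p * (Real.pi / 2) : ℝ) : ℂ) * Complex.I
        = Complex.I * ρ * u + Complex.I * η * (Real.log (1 + u) - Real.log (1 - u))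
          + p * (Real.pi / 2 * Complex.I) := by
      rw [eulerPhase]; push_cast; ring
    rw [e, Complex.exp_add, Complex.exp_add, ← h3, eulerIntegrand, h1, h2, mul_pow]
    push_cast
    ring
  rw [this, Complex.re_ofReal_mul, Complex.exp_ofReal_mul_I_re]

theorem pow_le_factorial_mul_exp (N : ℕ) {c t : ℝ} (hc : 0 < c) (ht : 0 ≤ t) :
    t ^ N ≤ N.factorial * (1 / c) ^ N * Real.exp (c * t) := by
  have h := Real.pow_div_factorial_le_exp (c * t) (by positivity) N
  rw [div_le_iff₀ (by positivity), mul_pow] at h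
  have h2 : t ^ N = (1 / c) ^ N * (c ^ N * t ^ N) := by
    rw [← mul_assoc, ← mul_pow]; simp [hc.ne']
  rw [h2]
  calc _ ≤ (1 / c) ^ N * (Real.exp (c * t) * N.factorial) := by gcongr
    _ = _ := by ring

theorem norm_exp_I_mul_log_le (η : ℝ) (z : ℂ) :
    ‖Complex.exp (Complex.I * η * Complex.log z)‖ ≤ Real.exp (|η| * Real.pi) := by
  rw [Complex.norm_exp, Real.exp_le_exp]
  have : (Complex.I * η * Complex.log z).re = -(η * z.arg) := by
    simp [Complex.log_im]
  rw [this]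
  calc -(η * z.arg) ≤ |η * z.arg| := neg_le_abs _
    _ ≤ |η| * Real.pi := by rw [abs_mul]; gcongr; exact Complex.abs_arg_le_pi z

/-- On the upper half strip e^{iρz} decays like e^{-ρv}. The logarithms contribute only bounded
factors, since their imaginary parts are arguments; half of the decay absorbs the polynomial growth.
-/
theorem norm_eulerIntegrand_le (l p : ℕ) (η : ℝ) {ρ : ℝ} (hρ : 0 < ρ) : ∃ C : ℝ, 0 < C ∧
    ∀ u v : ℝ, |u| ≤ 1 → 0 ≤ v →
      ‖eulerIntegrand l p η ρ (u + v * Complex.I)‖ ≤ C * Real.exp (-(ρ / 2) * v) := by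
  set N := p + 2 * l with hN
  set D := Real.exp (|η| * Real.pi) with hD
  refine ⟨N.factorial * (1 / (ρ / 2)) ^ N * Real.exp (ρ) * (D * D), by positivity,
    fun u v hu hv => ?_⟩
  set z : ℂ := u + v * Complex.I with hz
  have hzn : ‖z‖ ≤ 1 + v := by
    refine (norm_add_le _ _).trans ?_
    rw [norm_mul, Complex.norm_I, mul_one, Complex.norm_real, Complex.norm_real,
      Real.norm_of_nonneg hv]
    have : ‖u‖ ≤ 1 := hu
    linarith
  have h1 : ‖(Complex.I * z) ^ p‖ ≤ (2 + v) ^ p := by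
    rw [norm_pow, norm_mul, Complex.norm_I, one_mul]
    gcongr; linarith
  have h2 : ‖Complex.exp (Complex.I * ρ * z)‖ = Real.exp (-ρ * v) := by
    rw [Complex.norm_exp]; congr 1; simp [hz]
  have h3 : ‖(1 - z ^ 2) ^ l‖ ≤ (2 + v) ^ (2 * l) := by
    rw [norm_pow, pow_mul]
    gcongr
    refine (norm_sub_le _ _).trans ?_
    rw [norm_pow, norm_one]
    have : ‖z‖ ^ 2 ≤ (1 + v) ^ 2 := by gcongr
    nlinarith
  have h4 : ‖Complex.exp (Complex.I * η * (Complex.log (1 + z) - Complex.log (1 - z)))‖ ≤ D * D := by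
    rw [show Complex.I * η * (Complex.log (1 + z) - Complex.log (1 - z))
      = Complex.I * η * Complex.log (1 + z) + Complex.I * (-η : ℝ) * Complex.log (1 - z) by
        push_cast; ring, Complex.exp_add, norm_mul]
    have e1 := norm_exp_I_mul_log_le η (1 + z)
    have e2 := norm_exp_I_mul_log_le (-η) (1 - z)
    rw [abs_neg] at e2
    gcongr
  have h5 := pow_le_factorial_mul_exp N (c := ρ / 2) (t := 2 + v) (by positivity) (by positivity)
  have hexp : Real.exp (ρ / 2 * (2 + v)) * Real.exp (-ρ * v)
      = Real.exp ρ * Real.exp (-(ρ / 2) * v) := by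
    rw [← Real.exp_add, ← Real.exp_add]; congr 1; ring
  rw [eulerIntegrand, norm_mul, norm_mul, norm_mul, h2]
  calc _ ≤ (2 + v) ^ p * Real.exp (-ρ * v) * (2 + v) ^ (2 * l) * (D * D) := by gcongr
    _ = (2 + v) ^ N * Real.exp (-ρ * v) * (D * D) := by rw [hN, pow_add]; ring
    _ ≤ (N.factorial * (1 / (ρ / 2)) ^ N * Real.exp (ρ / 2 * (2 + v))) * Real.exp (-ρ * v) * (D * D) := by
        gcongr
    _ = N.factorial * (1 / (ρ / 2)) ^ N * (Real.exp (ρ / 2 * (2 + v)) * Real.exp (-ρ * v)) * (D * D) := by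
        ring
    _ = N.factorial * (1 / (ρ / 2)) ^ N * (Real.exp ρ * Real.exp (-(ρ / 2) * v)) * (D * D) := by
        rw [hexp]
    _ = _ := by ring

/-- The reflection z ↦ -z̄ exchanges the two vertical sides and conjugates the integrand, so their
contributions combine into a single imaginary part. -/
theorem eulerIntegrand_neg_conj (l p : ℕ) (η ρ v : ℝ) :
    eulerIntegrand l p η ρ (-1 + v * Complex.I)
      = (starRingEnd ℂ) (eulerIntegrand l p η ρ (1 + v * Complex.I)) := by
  have a1 : (1 + (1 + v * Complex.I)).arg ≠ Real.pi := by
    intro h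
    have := Complex.arg_eq_pi_iff.1 h
    norm_num at this
  have a2 : (1 - (1 + v * Complex.I)).arg ≠ Real.pi := by
    intro h
    have := Complex.arg_eq_pi_iff.1 h
    norm_num at this
  unfold eulerIntegrand
  rw [map_mul, map_mul, map_mul, map_pow, ← Complex.exp_conj, ← Complex.exp_conj, map_pow,
    map_mul (starRingEnd ℂ) (Complex.I * η),
    map_sub (starRingEnd ℂ) (Complex.log _), ← Complex.log_conj _ a1,
    ← Complex.log_conj _ a2]
  simp only [map_mul, map_add, map_sub, map_one, map_pow, Complex.conj_I, Complex.conj_ofReal]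
  congr 1
  · congr 1
    · congr 1
      · congr 1; ring_nf
      · congr 1; ring
    · congr 1; ring
  · congr 1
    rw [show (1 : ℂ) + (-1 + v * Complex.I) = 1 - (1 + v * -Complex.I) by ring,
      show (1 : ℂ) - (-1 + v * Complex.I) = 1 + (1 + v * -Complex.I) by ring]
    ring

theorem differentiableAt_eulerIntegrand (l p : ℕ) (η ρ : ℝ) {z : ℂ} (h1 : 1 + z ∈ Complex.slitPlane)
    (h2 : 1 - z ∈ Complex.slitPlane) : DifferentiableAt ℂ (eulerIntegrand l p η ρ) z := by
  unfold eulerIntegrand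
  fun_prop (disch := assumption)

theorem slitPlane_one_add_sub {z : ℂ} (h : -1 < z.re) (h' : z.re < 1) :
    1 + z ∈ Complex.slitPlane ∧ 1 - z ∈ Complex.slitPlane :=
  ⟨Or.inl (by simp; linarith), Or.inl (by simp; linarith)⟩

/-- Serves to move the vertical sides onto the branch points ±1, where the integrand need not be
holomorphic. Above the real axis it is continuous there, and `norm_eulerIntegrand_le` provides the
domination. -/
theorem tendsto_eulerIntegrand_vertical (l p : ℕ) (η : ℝ) {ρ c : ℝ} (hρ : 0 < ρ)
    {x : ℕ → ℝ} (hx : Tendsto x atTop (𝓝 c)) (hx1 : ∀ n, |x n| ≤ 1) :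
    Tendsto (fun n : ℕ => ∫ v in (0 : ℝ)..n, eulerIntegrand l p η ρ (x n + v * Complex.I)) atTop
      (𝓝 (∫ v in Ioi (0 : ℝ), eulerIntegrand l p η ρ (c + v * Complex.I))) := by
  obtain ⟨C, hC, hb⟩ := norm_eulerIntegrand_le l p η hρ
  have hmeas : Measurable (eulerIntegrand l p η ρ) := by
    unfold eulerIntegrand; fun_prop
  have hslit : ∀ v : ℝ, 0 < v → (1 + (c + v * Complex.I) ∈ Complex.slitPlane) ∧
      (1 - (c + v * Complex.I) ∈ Complex.slitPlane) := fun v hv =>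
    ⟨Or.inr (by simp [hv.ne']), Or.inr (by simp [hv.ne'])⟩
  have : ∀ n : ℕ, ∫ v in (0 : ℝ)..n, eulerIntegrand l p η ρ (x n + v * Complex.I)
      = ∫ v in Ioi (0 : ℝ), (Iic (n : ℝ)).indicator
        (fun v : ℝ => eulerIntegrand l p η ρ (x n + v * Complex.I)) v := by
    intro n
    rw [intervalIntegral.integral_of_le n.cast_nonneg, setIntegral_indicator measurableSet_Iic,
      Ioi_inter_Iic]
  simp only [this]
  refine tendsto_integral_of_dominated_convergence (fun v => C * Real.exp (-(ρ / 2) * v)) ?_ ?_ ?_ ?_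
  · intro n
    refine (Measurable.indicator ?_ measurableSet_Iic).aestronglyMeasurable
    exact hmeas.comp (by fun_prop)
  · exact (exp_neg_integrableOn_Ioi 0 (half_pos hρ)).const_mul C
  · intro n
    refine (ae_restrict_iff' measurableSet_Ioi).2 (Eventually.of_forall fun v hv => ?_)
    refine (norm_indicator_le_norm_self _ _).trans ?_
    exact hb _ _ (hx1 n) (le_of_lt hv)
  · refine (ae_restrict_iff' measurableSet_Ioi).2 (Eventually.of_forall fun v hv => ?_)
    have hcont := (differentiableAt_eulerIntegrand l p η ρ (hslit v hv).1 (hslit v hv).2).continuousAt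
    have h1 : Tendsto (fun n => (x n : ℂ) + v * Complex.I) atTop (𝓝 (c + v * Complex.I)) :=
      ((Complex.continuous_ofReal.tendsto c).comp hx).add_const _
    refine (hcont.tendsto.comp h1).congr' ?_
    filter_upwards [eventually_ge_atTop ⌈v⌉₊] with n hn
    rw [indicator_of_mem]
    · rfl
    · exact Nat.ceil_le.1 hn

/-- Rotating the contour of the Euler integral into the upper half plane. -/
theorem eulerInt_eq_vertical (l p : ℕ) (η : ℝ) {ρ : ℝ} (hρ : 0 < ρ) :
    eulerInt l p η ρ
      = 2 * (∫ v in Ioi (0 : ℝ), eulerIntegrand l p η ρ (1 + v * Complex.I)).im := by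
  obtain ⟨C, hC, hb⟩ := norm_eulerIntegrand_le l p η hρ
  set F := eulerIntegrand l p η ρ with hF
  have hmeas : Measurable F := by
    simp only [hF]; unfold eulerIntegrand; fun_prop
  -- Cauchy's theorem is applied to rectangles of half-width 1 - ε n and height n, which avoid the
  -- branch points ±1. The top side vanishes in the limit by exponential decay.
  set ε : ℕ → ℝ := fun n => 1 / ((n : ℝ) + 2) with hε
  have hε0 : ∀ n, 0 < ε n := fun n => by simp only [hε]; positivity
  have hε1 : ∀ n, ε n ≤ 1 := fun n => by
    simp only [hε]; rw [div_le_one (by positivity)]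
    have := n.cast_nonneg (α := ℝ); linarith
  have hεlim : Tendsto ε atTop (𝓝 0) := by
    have : Tendsto (fun n : ℕ => (n : ℝ) + 2) atTop atTop :=
      tendsto_atTop_add_const_right _ _ tendsto_natCast_atTop_atTop
    exact this.inv_tendsto_atTop.congr fun n => by simp [hε]
  have hrect : ∀ n : ℕ, (∫ u in (-(1 - ε n))..(1 - ε n), F u)
      = (∫ u in (-(1 - ε n))..(1 - ε n), F (u + n * Complex.I))
        - Complex.I * (∫ v in (0 : ℝ)..n, F (((1 - ε n : ℝ) : ℂ) + v * Complex.I))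
        + Complex.I * (∫ v in (0 : ℝ)..n, F (((-(1 - ε n) : ℝ) : ℂ) + v * Complex.I)) := by
    intro n
    have h := Complex.integral_boundary_rect_eq_zero_of_differentiableOn F
      (((-(1 - ε n) : ℝ) : ℂ)) (((1 - ε n : ℝ) : ℂ) + (n : ℝ) * Complex.I) ?_
    · simp only [Complex.ofReal_re, Complex.ofReal_im, Complex.add_re, Complex.add_im,
        Complex.re_ofReal_mul, Complex.im_ofReal_mul, Complex.I_re, Complex.I_im, mul_zero, mul_one,
        add_zero, zero_add, Complex.ofReal_zero, zero_mul, smul_eq_mul] at h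
      simp only [Complex.ofReal_natCast] at h
      linear_combination h
    · intro z hz
      have hz1 := hz.1
      simp only [Complex.ofReal_re, Complex.add_re,
        Complex.re_ofReal_mul, Complex.I_re, mul_zero, add_zero] at hz1
      have := hε0 n
      have := hε1 n
      rw [mem_preimage, uIcc_of_le (by linarith), mem_Icc] at hz1
      obtain ⟨s1, s2⟩ := slitPlane_one_add_sub (z := z) (by linarith) (by linarith)
      exact (differentiableAt_eulerIntegrand l p η ρ s1 s2).differentiableWithinAt
  have hx1 : ∀ n, |1 - ε n| ≤ 1 := fun n => by
    rw [abs_le]; constructor <;> linarith [hε0 n, hε1 n]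
  have l1 := tendsto_eulerIntegrand_vertical l p η hρ (c := 1) (x := fun n => 1 - ε n)
    (by simpa using hεlim.const_sub 1) hx1
  have l2 := tendsto_eulerIntegrand_vertical l p η hρ (c := -1) (x := fun n => -(1 - ε n))
    (by simpa using (hεlim.const_sub 1).neg) (fun n => by rw [abs_neg]; exact hx1 n)
  have l3 : Tendsto (fun n : ℕ => ∫ u in (-(1 - ε n))..(1 - ε n), F (u + n * Complex.I)) atTop (𝓝 0) := by
    have hg : Tendsto (fun n : ℕ => C * Real.exp (-(ρ / 2) * n) * 2) atTop (𝓝 0) := by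
      have : Tendsto (fun n : ℕ => -(ρ / 2) * (n : ℝ)) atTop atBot :=
        tendsto_natCast_atTop_atTop.const_mul_atTop_of_neg (by linarith)
      simpa using ((Real.tendsto_exp_atBot.comp this).const_mul C).mul_const 2
    refine squeeze_zero_norm (fun n => ?_) hg
    have := intervalIntegral.norm_integral_le_of_norm_le_const
      (f := fun u : ℝ => F (u + n * Complex.I)) (a := -(1 - ε n)) (b := 1 - ε n)
      (C := C * Real.exp (-(ρ / 2) * n)) ?_
    · refine this.trans ?_
      gcongr
      rw [abs_le]; constructor <;> linarith [hε0 n, hε1 n]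
    · intro u hu
      rw [uIoc_of_le (by linarith [hε1 n]), mem_Ioc] at hu
      have := hb u n (abs_le.2 ⟨by linarith [hε0 n], by linarith [hε0 n]⟩) n.cast_nonneg
      simpa using this
  have hI : IntervalIntegrable (fun u : ℝ => F u) volume (-1) 1 := by
    refine (intervalIntegrable_const (c := C)).mono_fun
      (hmeas.comp Complex.measurable_ofReal).aestronglyMeasurable ?_
    refine (ae_restrict_iff' measurableSet_uIoc).2 (Eventually.of_forall fun u hu => ?_)
    rw [uIoc_of_le (by norm_num), mem_Ioc] at hu
    have := hb u 0 (abs_le.2 ⟨hu.1.le, hu.2⟩) le_rfl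
    simpa [abs_of_pos hC] using this
  have l0 : Tendsto (fun n : ℕ => ∫ u in (-(1 - ε n))..(1 - ε n), F u) atTop
      (𝓝 (∫ u in (-1 : ℝ)..1, F u)) := by
    have hc := intervalIntegral.continuousOn_primitive_interval' (a := 0) hI (by simp)
    rw [uIcc_of_le (by norm_num)] at hc
    have hsub : ∀ a ∈ Icc (-1 : ℝ) 1, IntervalIntegrable (fun u : ℝ => F u) volume 0 a := fun a ha =>
      hI.mono_set (uIcc_subset_uIcc (by simp) (by rwa [uIcc_of_le (by norm_num)]))
    have hsplit : ∀ a ∈ Icc (-1 : ℝ) 1, ∀ b ∈ Icc (-1 : ℝ) 1,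
        ∫ u in a..b, F u = (∫ u in (0 : ℝ)..b, F u) - ∫ u in (0 : ℝ)..a, F u := fun a ha b hb =>
      (intervalIntegral.integral_interval_sub_left (hsub b hb) (hsub a ha)).symm
    have m1 : ∀ n, 1 - ε n ∈ Icc (-1 : ℝ) 1 := fun n => ⟨by linarith [hε1 n], by linarith [hε0 n]⟩
    have m2 : ∀ n, -(1 - ε n) ∈ Icc (-1 : ℝ) 1 := fun n =>
      ⟨by linarith [hε0 n], by linarith [hε1 n]⟩
    have t1 : Tendsto (fun n => 1 - ε n) atTop (𝓝[Icc (-1 : ℝ) 1] 1) :=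
      tendsto_nhdsWithin_iff.2 ⟨by simpa using hεlim.const_sub 1, Eventually.of_forall m1⟩
    have t2 : Tendsto (fun n => -(1 - ε n)) atTop (𝓝[Icc (-1 : ℝ) 1] (-1)) :=
      tendsto_nhdsWithin_iff.2 ⟨by simpa using (hεlim.const_sub 1).neg, Eventually.of_forall m2⟩
    rw [hsplit (-1) (by simp) 1 (by simp)]
    refine (((hc 1 (by simp)).tendsto.comp t1).sub ((hc (-1) (by simp)).tendsto.comp t2)).congr ?_
    intro n
    exact (hsplit _ (m2 n) _ (m1 n)).symm
  have hlim := tendsto_nhds_unique l0 ((((l3.sub (l1.const_mul Complex.I)).add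
    (l2.const_mul Complex.I))).congr fun n => (hrect n).symm)
  set A := ∫ v in Ioi (0 : ℝ), F (1 + v * Complex.I) with hA
  have hconj : ∫ v in Ioi (0 : ℝ), F (((-1 : ℝ) : ℂ) + v * Complex.I) = (starRingEnd ℂ) A := by
    rw [hA, ← integral_conj]
    refine setIntegral_congr_fun measurableSet_Ioi fun v _ => ?_
    simpa using eulerIntegrand_neg_conj l p η ρ v
  rw [← hF, hconj, Complex.ofReal_one, ← hA] at hlim
  have hre : eulerInt l p η ρ = (∫ u in (-1 : ℝ)..1, F u).re := by
    have := intervalIntegral.intervalIntegral_re (𝕜 := ℂ) hI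
    simp only [RCLike.re_to_complex] at this
    rw [← this, eulerInt]
    refine intervalIntegral.integral_congr_ae ?_
    filter_upwards [Measure.ae_ne volume (1 : ℝ)] with u hu1 hu
    rw [uIoc_of_le (by norm_num), mem_Ioc] at hu
    exact (eulerIntegrand_ofReal_re l p η ρ ⟨hu.1, lt_of_le_of_ne hu.2 hu1⟩).symm
  rw [hre, hlim]
  simp
  ring

/-- On the ray z = 1 + iv one has 1 - z = -iv, whose logarithm is ln v - iπ/2. This yields the power
v^(l - iη) and the factor e^{-πη/2}, and leaves a Gamma integrand times a factor smooth at v = 0.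
The exponent keeps the shape a - 1 of the Gamma integral. -/
theorem eulerIntegrand_one_add (l p : ℕ) (η ρ : ℝ) {v : ℝ} (hv : 0 < v) :
    eulerIntegrand l p η ρ (1 + v * Complex.I) =
      (Complex.exp (Complex.I * ρ) * (-Complex.I) ^ l * Real.exp (-(Real.pi * η) / 2)) *
      (((v : ℂ) ^ (l + 1 - Complex.I * η - 1) * Complex.exp (-(ρ * v))) *
      ((Complex.I - v) ^ p * (2 + v * Complex.I) ^ l *
        Complex.exp (Complex.I * η * Complex.log (2 + v * Complex.I)))) := by
  have hv0 : (v : ℂ) ≠ 0 := by exact_mod_cast hv.ne'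
  have hlog : Complex.log (1 - (1 + v * Complex.I)) = Real.log v - Real.pi / 2 * Complex.I := by
    have : (1 - (1 + v * Complex.I) : ℂ) = (v : ℝ) * (-Complex.I) := by ring
    rw [this, Complex.log_ofReal_mul hv (by simp), Complex.log_neg_I]
    ring
  have hcpow : (v : ℂ) ^ (l + 1 - Complex.I * η - 1)
      = (v : ℂ) ^ l * Complex.exp (-(Complex.I * η * Real.log v)) := by
    rw [show (l + 1 - Complex.I * η - 1 : ℂ) = l + -(Complex.I * η) by ring,
      Complex.cpow_add _ _ hv0, Complex.cpow_natCast, Complex.cpow_def_of_ne_zero hv0,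
      ← Complex.ofReal_log hv.le]
    congr 2; ring
  unfold eulerIntegrand
  rw [hlog, hcpow]
  have e1 : Complex.exp (Complex.I * ρ * (1 + v * Complex.I))
      = Complex.exp (Complex.I * ρ) * Complex.exp (-(ρ * v)) := by
    rw [← Complex.exp_add]; congr 1
    linear_combination (ρ * v : ℂ) * Complex.I_sq
  have e2 : Complex.exp (Complex.I * η * (Complex.log (1 + (1 + v * Complex.I)) -
      (Real.log v - Real.pi / 2 * Complex.I)))
      = Complex.exp (Complex.I * η * Complex.log (2 + v * Complex.I)) *
        Complex.exp (-(Complex.I * η * Real.log v)) * Real.exp (-(Real.pi * η) / 2) := by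
    rw [Complex.ofReal_exp, ← Complex.exp_add, ← Complex.exp_add,
      show (1 + (1 + v * Complex.I) : ℂ) = 2 + v * Complex.I by ring]
    congr 1
    push_cast
    linear_combination (η * Real.pi / 2 : ℂ) * Complex.I_sq
  have e3 : (1 - (1 + v * Complex.I) ^ 2 : ℂ) = -Complex.I * v * (2 + v * Complex.I) := by
    linear_combination 0 * Complex.I_sq
  have e4 : Complex.I * (1 + v * Complex.I) = Complex.I - v := by
    linear_combination (v : ℂ) * Complex.I_sq
  rw [e1, e2, e3, e4, mul_pow, mul_pow]
  ring

/-- Mean value inequality for the smooth factor, frozen at v = 0. The factor v gained here becomes a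
factor 1/ρ after integration. -/
theorem norm_eulerAux_sub_le (l p : ℕ) (η : ℝ) {v : ℝ} (hv : 0 ≤ v) :
    ‖((Complex.I - v) ^ p * (2 + v * Complex.I) ^ l *
        Complex.exp (Complex.I * η * Complex.log (2 + v * Complex.I)) -
      Complex.I ^ p * 2 ^ l * Complex.exp (Complex.I * η * Real.log 2) : ℂ)‖ ≤
      (p + l + |η|) * Real.exp (|η| * Real.pi) * (2 + v) ^ (p + l) * v := by
  set h : ℝ → ℂ := fun v => (Complex.I - v) ^ p * (2 + v * Complex.I) ^ l *
        Complex.exp (Complex.I * η * Complex.log (2 + v * Complex.I)) with hh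
  set h' : ℝ → ℂ := fun v => ((p * (Complex.I - v) ^ (p - 1) * (-1)) * (2 + v * Complex.I) ^ l
      + (Complex.I - v) ^ p * (l * (2 + v * Complex.I) ^ (l - 1) * Complex.I)) *
        Complex.exp (Complex.I * η * Complex.log (2 + v * Complex.I))
      + (Complex.I - v) ^ p * (2 + v * Complex.I) ^ l *
        (Complex.exp (Complex.I * η * Complex.log (2 + v * Complex.I)) *
          (Complex.I * η * (Complex.I / (2 + v * Complex.I)))) with hh'
  have hd : ∀ t : ℝ, HasDerivAt h (h' t) t := by
    intro t
    have c1 : HasDerivAt (fun v : ℝ => (v : ℂ)) 1 t := Complex.ofRealCLM.hasDerivAt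
    have c2 : HasDerivAt (fun v : ℝ => Complex.I - (v : ℂ)) (-1) t := c1.const_sub _
    have c3 : HasDerivAt (fun v : ℝ => 2 + (v : ℂ) * Complex.I) Complex.I t := by
      simpa using (c1.mul_const Complex.I).const_add 2
    have c4 := ((c3.clog_real (Or.inl (by simp))).const_mul (Complex.I * η)).cexp
    exact ((c2.pow p).mul (c3.pow l)).mul c4
  have hb : ∀ t ∈ Ico (0 : ℝ) v, ‖h' t‖ ≤ (p + l + |η|) * Real.exp (|η| * Real.pi) * (2 + v) ^ (p + l) := by
    intro t ht
    have ht0 := ht.1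
    have n1 : ‖(Complex.I - t : ℂ)‖ ≤ 2 + v := by
      refine (norm_sub_le _ _).trans ?_
      rw [Complex.norm_I, Complex.norm_real, Real.norm_of_nonneg ht0]
      linarith [ht.2]
    have n2 : ‖(2 + t * Complex.I : ℂ)‖ ≤ 2 + v := by
      refine (norm_add_le _ _).trans ?_
      rw [norm_mul, Complex.norm_I, Complex.norm_real, Real.norm_of_nonneg ht0]
      simp
      linarith [ht.2]
    have n3 : 1 ≤ ‖(2 + t * Complex.I : ℂ)‖ := by
      refine le_trans ?_ (Complex.abs_re_le_norm _)
      norm_num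
    have n4 := norm_exp_I_mul_log_le η (2 + t * Complex.I)
    have w1 : (1 : ℝ) ≤ 2 + v := by linarith
    have q1 : ‖((p : ℂ) * (Complex.I - t) ^ (p - 1) * (-1)) * (2 + t * Complex.I) ^ l‖
        ≤ p * (2 + v) ^ (p + l) := by
      rw [norm_mul, norm_mul, norm_mul, norm_neg, norm_one, mul_one, norm_pow, norm_pow,
        Complex.norm_natCast, pow_add, ← mul_assoc]
      have : ‖(Complex.I - t : ℂ)‖ ^ (p - 1) ≤ (2 + v) ^ p :=
        (pow_le_pow_left₀ (norm_nonneg _) n1 _).trans (pow_le_pow_right₀ w1 (Nat.sub_le _ _))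
      gcongr
    have q2 : ‖(Complex.I - t : ℂ) ^ p * (l * (2 + t * Complex.I) ^ (l - 1) * Complex.I)‖
        ≤ l * (2 + v) ^ (p + l) := by
      rw [norm_mul, norm_mul, norm_mul, Complex.norm_I, mul_one, norm_pow, norm_pow,
        Complex.norm_natCast, pow_add]
      have : ‖(2 + t * Complex.I : ℂ)‖ ^ (l - 1) ≤ (2 + v) ^ l :=
        (pow_le_pow_left₀ (norm_nonneg _) n2 _).trans (pow_le_pow_right₀ w1 (Nat.sub_le _ _))
      calc _ ≤ (2 + v) ^ p * (l * (2 + v) ^ l) := by gcongr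
        _ = _ := by ring
    have q3 : ‖(Complex.I - t : ℂ) ^ p * (2 + t * Complex.I) ^ l *
        (Complex.exp (Complex.I * η * Complex.log (2 + t * Complex.I)) *
          (Complex.I * η * (Complex.I / (2 + t * Complex.I))))‖
        ≤ |η| * Real.exp (|η| * Real.pi) * (2 + v) ^ (p + l) := by
      rw [norm_mul, norm_mul, norm_mul, norm_mul, norm_mul, norm_div, Complex.norm_I, one_mul,
        norm_pow, norm_pow, Complex.norm_real, pow_add]
      have : 1 / ‖(2 + t * Complex.I : ℂ)‖ ≤ 1 := by
        rw [div_le_one (by linarith)]; exact n3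
      calc _ ≤ (2 + v) ^ p * (2 + v) ^ l * (Real.exp (|η| * Real.pi) * (|η| * 1)) := by
            rw [Real.norm_eq_abs]; gcongr
        _ = _ := by ring
    refine (norm_add_le _ _).trans ?_
    have q4 := (norm_add_le _ _).trans (add_le_add q1 q2)
    rw [norm_mul]
    calc _ ≤ (p * (2 + v) ^ (p + l) + l * (2 + v) ^ (p + l)) * Real.exp (|η| * Real.pi) +
          |η| * Real.exp (|η| * Real.pi) * (2 + v) ^ (p + l) := by gcongr
      _ = _ := by ring
  have := norm_image_sub_le_of_norm_deriv_right_le_segment (f := h)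
    (fun t _ => (hd t).continuousAt.continuousWithinAt)
    (fun t _ => (hd t).hasDerivWithinAt) hb v (right_mem_Icc.2 hv)
  have h0 : h 0 = Complex.I ^ p * 2 ^ l * Complex.exp (Complex.I * η * Real.log 2) := by
    simp only [hh]
    rw [Complex.ofReal_log (by norm_num)]
    simp
  rw [h0, sub_zero] at this
  exact this

/-- Watson's lemma for the rotated Euler integral. -/
theorem eulerInt_asymptotic (l p : ℕ) (η₁ : ℝ) : ∃ C : ℝ, 0 < C ∧ ∀ η ρ : ℝ, 0 ≤ η → η ≤ η₁ →
    1 ≤ ρ →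
    |ρ ^ (l + 1) * eulerInt l p η ρ - 2 * (Complex.exp (Complex.I * ρ) * (-Complex.I) ^ l *
      Real.exp (-(Real.pi * η) / 2) * (Complex.I ^ p * 2 ^ l *
        Complex.exp (Complex.I * (η * (Real.log 2 + Real.log ρ) : ℝ)) *
        Complex.Gamma (l + 1 - Complex.I * η))).im| ≤ C / ρ := by
  set N := p + l with hN
  -- D collects the mean value constant and the cost of absorbing (2 + v)^N into an exponential. It
  -- vanishes if p = l = η₁ = 0, hence the summand 1 in the final constant.
  set D : ℝ := (p + l + |η₁|) * Real.exp (|η₁| * Real.pi) * (N.factorial * 2 ^ N * Real.exp 1) with hD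
  have hD0 : 0 ≤ D := by positivity
  refine ⟨2 * (D * (2 ^ (l + 2) * Real.Gamma (l + 2))) + 1,
    by have := Real.Gamma_pos_of_pos (show (0 : ℝ) < l + 2 by positivity); positivity,
    fun η ρ hη hη1 hρ => ?_⟩
  have hρ0 : 0 < ρ := by linarith
  set a : ℂ := l + 1 - Complex.I * η with ha
  have hare : a.re = l + 1 := by simp [ha]
  set h : ℝ → ℂ := fun v => (Complex.I - v) ^ p * (2 + v * Complex.I) ^ l *
        Complex.exp (Complex.I * η * Complex.log (2 + v * Complex.I)) with hh
  set h0 : ℂ := Complex.I ^ p * 2 ^ l * Complex.exp (Complex.I * η * Real.log 2) with hh0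
  set g : ℝ → ℂ := fun v => (v : ℂ) ^ (a - 1) * Complex.exp (-(ρ * v)) with hg
  set c : ℂ := Complex.exp (Complex.I * ρ) * (-Complex.I) ^ l * Real.exp (-(Real.pi * η) / 2) with hc
  have hcn : ‖c‖ ≤ 1 := by
    rw [hc, norm_mul, norm_mul, norm_pow, norm_neg, Complex.norm_I, one_pow, mul_one,
      mul_comm Complex.I, Complex.norm_exp_ofReal_mul_I, one_mul, Complex.norm_real,
      Real.norm_of_nonneg (Real.exp_pos _).le, Real.exp_le_one_iff]
    have := mul_nonneg Real.pi_pos.le hη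
    linarith
  have hgI : ∫ v in Ioi (0 : ℝ), g v = (1 / ρ : ℂ) ^ a * Complex.Gamma a :=
    Complex.integral_cpow_mul_exp_neg_mul_Ioi (by rw [hare]; positivity) hρ0
  have hgn : ∀ v ∈ Ioi (0 : ℝ), ‖g v‖ = v ^ (l : ℝ) * Real.exp (-(ρ * v)) := by
    intro v hv
    simp only [hg]
    rw [norm_mul, Complex.norm_cpow_eq_rpow_re_of_pos hv, Complex.norm_exp]
    simp [hare]
  have hgm : Measurable g := by simp only [hg]; fun_prop
  have hhm : Measurable h := by simp only [hh]; fun_prop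
  have hexpI : ∀ s : ℝ, 0 < s → ∀ b : ℝ, 0 < b →
      IntegrableOn (fun v : ℝ => v ^ (s - 1) * Real.exp (-(b * v))) (Ioi 0) := by
    intro s hs b hb
    have := integrableOn_rpow_mul_exp_neg_mul_rpow (s := s - 1) (p := 1) (b := b)
      (by linarith) one_pos hb
    simpa [neg_mul] using this
  have hgint : IntegrableOn g (Ioi 0) := by
    refine (hexpI (l + 1) (by positivity) ρ hρ0).mono' hgm.aestronglyMeasurable ?_
    refine (ae_restrict_iff' measurableSet_Ioi).2 (Eventually.of_forall fun v hv => ?_)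
    rw [hgn v hv]; simp
  have hdiff : ∀ v ∈ Ioi (0 : ℝ), ‖g v * (h v - h0)‖
      ≤ D * (v ^ ((l : ℝ) + 2 - 1) * Real.exp (-(ρ / 2 * v))) := by
    intro v hv
    have hv0 : 0 ≤ v := le_of_lt hv
    have h1 := norm_eulerAux_sub_le l p η hv0
    have hηη : |η| ≤ |η₁| := by
      rw [abs_of_nonneg hη, abs_of_nonneg (hη.trans hη1)]; exact hη1
    have h2 : (2 + v) ^ N ≤ (N.factorial * 2 ^ N * Real.exp 1) * Real.exp (ρ / 2 * v) := by
      -- Only half of the decay e^{-ρv} is spent here: e^{v/2} ≤ e^{ρv/2} because ρ ≥ 1.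
      have h3 := pow_le_factorial_mul_exp N (c := 1 / 2) (t := 2 + v) (by norm_num) (by positivity)
      rw [one_div_one_div] at h3
      refine h3.trans ?_
      rw [mul_assoc ((N.factorial : ℝ) * 2 ^ N), ← Real.exp_add]
      gcongr
      nlinarith
    have hvp : v ^ ((l : ℝ) + 2 - 1) = v ^ (l : ℝ) * v := by
      rw [show (l : ℝ) + 2 - 1 = l + 1 by ring, Real.rpow_add_one hv.ne']
    have hee : Real.exp (-(ρ * v)) * Real.exp (ρ / 2 * v) = Real.exp (-(ρ / 2 * v)) := by
      rw [← Real.exp_add]; congr 1; ring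
    rw [norm_mul, hgn v hv, hvp, ← hee]
    calc _ ≤ v ^ (l : ℝ) * Real.exp (-(ρ * v)) *
          ((p + l + |η₁|) * Real.exp (|η₁| * Real.pi) *
            ((N.factorial * 2 ^ N * Real.exp 1) * Real.exp (ρ / 2 * v)) * v) := by
          refine mul_le_mul_of_nonneg_left (h1.trans ?_) (by positivity)
          gcongr
      _ = _ := by rw [hD]; ring
  have hdiffI : IntegrableOn (fun v => D * (v ^ ((l : ℝ) + 2 - 1) * Real.exp (-(ρ / 2 * v)))) (Ioi 0) :=
    (hexpI (l + 2) (by positivity) (ρ / 2) (by positivity)).const_mul D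
  have hdint : IntegrableOn (fun v => g v * (h v - h0)) (Ioi 0) := by
    refine hdiffI.mono' (hgm.mul (hhm.sub_const _)).aestronglyMeasurable ?_
    exact (ae_restrict_iff' measurableSet_Ioi).2 (Eventually.of_forall hdiff)
  have hA : ∫ v in Ioi (0 : ℝ), eulerIntegrand l p η ρ (1 + v * Complex.I)
      = c * (∫ v in Ioi (0 : ℝ), g v * (h v - h0)) + c * (h0 * ((1 / ρ : ℂ) ^ a * Complex.Gamma a)) := by
    rw [← hgI, ← integral_const_mul, ← integral_const_mul, ← integral_const_mul,
      ← integral_add (hdint.const_mul c) ((hgint.const_mul h0).const_mul c)]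
    refine setIntegral_congr_fun measurableSet_Ioi fun v hv => ?_
    rw [eulerIntegrand_one_add l p η ρ hv]
    simp only [hg, hh, hc, ha]
    ring
  have hEn : ‖∫ v in Ioi (0 : ℝ), g v * (h v - h0)‖ ≤ D * (2 ^ (l + 2) * Real.Gamma (l + 2)) / ρ ^ (l + 2) := by
    refine (norm_integral_le_of_norm_le hdiffI
      ((ae_restrict_iff' measurableSet_Ioi).2 (Eventually.of_forall hdiff))).trans ?_
    rw [integral_const_mul, Real.integral_rpow_mul_exp_neg_mul_Ioi (by positivity) (by positivity)]
    rw [show (l : ℝ) + 2 = ((l + 2 : ℕ) : ℝ) by push_cast; ring, Real.rpow_natCast]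
    apply le_of_eq
    rw [one_div_div, div_pow]
    ring
  -- The imaginary part of the exponent a survives the scaling by ρ: this is the origin of the
  -- logarithmic phase.
  have hpow : (ρ : ℂ) ^ (l + 1) * (1 / ρ : ℂ) ^ a = Complex.exp (Complex.I * (η * Real.log ρ : ℝ)) := by
    have hρc : (ρ : ℂ) ≠ 0 := by exact_mod_cast hρ0.ne'
    rw [one_div, ← Complex.ofReal_inv, Complex.cpow_def_of_ne_zero (by simp [hρ0.ne']),
      ← Complex.ofReal_log (by positivity), Real.log_inv]
    have : (ρ : ℂ) ^ (l + 1) = Complex.exp ((l + 1) * Real.log ρ) := by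
      rw [show ((l : ℂ) + 1) * Real.log ρ = ((l + 1 : ℕ) : ℂ) * Real.log ρ by push_cast; ring,
        Complex.exp_nat_mul, ← Complex.ofReal_exp, Real.exp_log hρ0]
    rw [this, ← Complex.exp_add]
    congr 1
    rw [ha]; push_cast; ring
  rw [eulerInt_eq_vertical l p η hρ0, hA]
  set E := ∫ v in Ioi (0 : ℝ), g v * (h v - h0) with hE
  have hmain : ρ ^ (l + 1) * (2 * (c * E + c * (h0 * ((1 / ρ : ℂ) ^ a * Complex.Gamma a))).im)
      - 2 * (c * (Complex.I ^ p * 2 ^ l *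
        Complex.exp (Complex.I * (η * (Real.log 2 + Real.log ρ) : ℝ)) * Complex.Gamma a)).im
      = 2 * ρ ^ (l + 1) * (c * E).im := by
    have e1 : c * (Complex.I ^ p * 2 ^ l *
        Complex.exp (Complex.I * (η * (Real.log 2 + Real.log ρ) : ℝ)) * Complex.Gamma a)
        = ((ρ ^ (l + 1) : ℝ) : ℂ) * (c * (h0 * ((1 / ρ : ℂ) ^ a * Complex.Gamma a))) := by
      have e2 : Complex.exp (Complex.I * (η * (Real.log 2 + Real.log ρ) : ℝ))
          = Complex.exp (Complex.I * η * Real.log 2) * ((ρ : ℂ) ^ (l + 1) * (1 / ρ : ℂ) ^ a) := by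
        rw [hpow, ← Complex.exp_add]; congr 1; push_cast; ring
      rw [e2, hh0]; push_cast; ring
    rw [e1, Complex.im_ofReal_mul, Complex.add_im]
    ring
  rw [hmain, abs_mul, abs_of_pos (by positivity)]
  have hcE : |(c * E).im| ≤ D * (2 ^ (l + 2) * Real.Gamma (l + 2)) / ρ ^ (l + 2) := by
    refine (Complex.abs_im_le_norm _).trans ?_
    rw [norm_mul]
    exact (mul_le_of_le_one_left (norm_nonneg _) hcn).trans hEn
  calc _ ≤ 2 * ρ ^ (l + 1) * (D * (2 ^ (l + 2) * Real.Gamma (l + 2)) / ρ ^ (l + 2)) := by gcongr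
    _ = 2 * (D * (2 ^ (l + 2) * Real.Gamma (l + 2))) / ρ := by
        rw [pow_succ ρ (l + 1)]; field_simp
    _ ≤ _ := by gcongr; linarith

/-! ### Asymptotics of the Coulomb wave function -/

/-- The phase `√x r + ln r / √x` of the Coulomb function at infinity. -/
noncomputable def coulombPhase (r x : ℝ) : ℝ := √x * r + 1 / √x * Real.log r

/-- Transports the Watson expansion to ρ = √x r. In ln 2 + ln(√x r) the parts independent of r go
into `coulombAmp` and η ln r into `coulombPhase`. The case p = 0 serves the function, p = 1 its
derivative. -/
theorem coulombS_sub_eq (l p : ℕ) {x r : ℝ} (hx : 0 < x) (hr : 0 < r) :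
    coulombConst l x * r ^ (l + 1) * eulerInt l p (1 / √x) (√x * r) -
      (Complex.I ^ p * coulombAmp l x * Complex.exp (Complex.I * coulombPhase r x)).im =
    coulombConst l x / √x ^ (l + 1) * ((√x * r) ^ (l + 1) * eulerInt l p (1 / √x) (√x * r) -
      2 * (Complex.exp (Complex.I * (√x * r : ℝ)) * (-Complex.I) ^ l *
      Real.exp (-(Real.pi * (1 / √x)) / 2) * (Complex.I ^ p * 2 ^ l *
        Complex.exp (Complex.I * (1 / √x * (Real.log 2 + Real.log (√x * r)) : ℝ)) *
        Complex.Gamma (l + 1 - Complex.I * (1 / √x : ℝ)))).im) := by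
  have hk : 0 < √x := Real.sqrt_pos.2 hx
  set X : ℂ := Complex.exp (Complex.I * (√x * r : ℝ)) * (-Complex.I) ^ l *
      Real.exp (-(Real.pi * (1 / √x)) / 2) * (Complex.I ^ p * 2 ^ l *
        Complex.exp (Complex.I * (1 / √x * (Real.log 2 + Real.log (√x * r)) : ℝ)) *
        Complex.Gamma (l + 1 - Complex.I * (1 / √x : ℝ))) with hX
  have h : Complex.I ^ p * coulombAmp l x * Complex.exp (Complex.I * coulombPhase r x)
      = ((2 * (coulombConst l x / √x ^ (l + 1)) : ℝ) : ℂ) * X := by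
    have e : Complex.exp (Complex.I * (√x * r : ℝ)) *
        Complex.exp (Complex.I * (1 / √x * (Real.log 2 + Real.log (√x * r)) : ℝ))
        = Complex.exp (Complex.I * (1 / √x * (Real.log 2 + Real.log √x) : ℝ)) *
          Complex.exp (Complex.I * coulombPhase r x) := by
      rw [← Complex.exp_add, ← Complex.exp_add, Real.log_mul hk.ne' hr.ne', coulombPhase]
      congr 1
      push_cast
      ring
    have e2 : Complex.I * (-Complex.I) ^ (l + 1) = (-Complex.I) ^ l := by
      rw [pow_succ]; linear_combination (-(-Complex.I) ^ l) * Complex.I_sq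
    have e3 : X = (-Complex.I) ^ l * Real.exp (-(Real.pi * (1 / √x)) / 2) * (Complex.I ^ p * 2 ^ l *
        Complex.Gamma (l + 1 - Complex.I * (1 / √x : ℝ))) *
        (Complex.exp (Complex.I * (√x * r : ℝ)) *
        Complex.exp (Complex.I * (1 / √x * (Real.log 2 + Real.log (√x * r)) : ℝ))) := by
      rw [hX]; ring
    rw [e3, e, ← e2, coulombAmp]
    push_cast
    ring
  rw [h, Complex.im_ofReal_mul, mul_pow]
  field_simp

theorem exists_coulombConst_bound (l : ℕ) {c d : ℝ} (hc : 0 < c) :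
    ∃ C : ℝ, 0 < C ∧ ∀ x ∈ Icc c d, |coulombConst l x| ≤ C ∧ |coulombConst l x / √x ^ (l + 1)| ≤ C := by
  have hcont : ContinuousOn (coulombConst l) (Icc c d) := fun x hx =>
    (differentiableAt_coulombConst l (hc.trans_le hx.1)).continuousAt.continuousWithinAt
  have hcont2 : ContinuousOn (fun x => coulombConst l x / √x ^ (l + 1)) (Icc c d) := by
    refine hcont.div (by fun_prop) fun x hx => ?_
    exact pow_ne_zero _ (Real.sqrt_pos.2 (hc.trans_le hx.1)).ne'
  obtain ⟨C1, h1⟩ := isCompact_Icc.exists_bound_of_continuousOn hcont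
  obtain ⟨C2, h2⟩ := isCompact_Icc.exists_bound_of_continuousOn hcont2
  refine ⟨max 1 (max C1 C2), by positivity, fun x hx => ⟨?_, ?_⟩⟩
  · exact (h1 x hx).trans (by simp)
  · exact (h2 x hx).trans (by simp)

/-- Leading asymptotics of the Coulomb wave function and its derivative, locally uniformly in the
energy. -/
theorem coulombS_asymptotic (l : ℕ) {c d : ℝ} (hc : 0 < c) : ∃ C r₀ : ℝ, 0 < C ∧ 0 < r₀ ∧
    ∀ x ∈ Icc c d, ∀ r, r₀ ≤ r →
      |coulombS x l r - (coulombAmp l x * Complex.exp (Complex.I * coulombPhase r x)).im| ≤ C / r ∧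
      |coulombSDeriv x l r -
        √x * (coulombAmp l x * Complex.exp (Complex.I * coulombPhase r x)).re| ≤ C / r := by
  obtain ⟨C0, hC0, hB⟩ := exists_coulombConst_bound l (c := c) (d := d) hc
  obtain ⟨C1, hC1, hA0⟩ := eulerInt_asymptotic l 0 (1 / √c)
  obtain ⟨C2, hC2, hA1⟩ := eulerInt_asymptotic l 1 (1 / √c)
  obtain ⟨C3, r₁, hC3, hr₁, hS⟩ := coulombS_bounds l
  have hsc : 0 < √c := Real.sqrt_pos.2 hc
  set C4 := √(C3 / √c) with hC4
  refine ⟨C0 * C1 / √c + C0 * C2 + (l + 1) * C4, max (1 / √c) 1, by positivity, by positivity,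
    fun x hx r hr => ?_⟩
  have hx0 : 0 < x := hc.trans_le hx.1
  have hk : 0 < √x := Real.sqrt_pos.2 hx0
  have hck : √c ≤ √x := Real.sqrt_le_sqrt hx.1
  have hr1 : 1 / √c ≤ r := (le_max_left _ _).trans hr
  have hr0 : 0 < r := lt_of_lt_of_le (by positivity) hr1
  have hρ : 1 ≤ √x * r := by
    rw [div_le_iff₀ hsc] at hr1
    nlinarith
  have hη : 1 / √x ≤ 1 / √c := one_div_le_one_div_of_le hsc hck
  have a0 := hA0 (1 / √x) (√x * r) (by positivity) hη hρ
  have a1 := hA1 (1 / √x) (√x * r) (by positivity) hη hρ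
  have s0 := coulombS_sub_eq l 0 hx0 hr0
  have s1 := coulombS_sub_eq l 1 hx0 hr0
  have hb := (hB x hx).2
  have e0 : |coulombConst l x * r ^ (l + 1) * eulerInt l 0 (1 / √x) (√x * r) -
      (Complex.I ^ 0 * coulombAmp l x * Complex.exp (Complex.I * coulombPhase r x)).im|
      ≤ C0 * (C1 / (√x * r)) := by
    rw [s0, abs_mul]; gcongr
  have e1 : |coulombConst l x * r ^ (l + 1) * eulerInt l 1 (1 / √x) (√x * r) -
      (Complex.I ^ 1 * coulombAmp l x * Complex.exp (Complex.I * coulombPhase r x)).im|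
      ≤ C0 * (C2 / (√x * r)) := by
    rw [s1, abs_mul]; gcongr
  have hs0 : |coulombS x l r| ≤ C4 := by
    refine Real.abs_le_sqrt ?_
    rw [le_div_iff₀ hsc]
    have := (hS x hx0).1 r hr0.le
    calc _ ≤ coulombS x l r ^ 2 * √x := by gcongr
      _ ≤ C3 := by linarith
  constructor
  · rw [pow_zero, one_mul] at e0
    have e : coulombS x l r = coulombConst l x * r ^ (l + 1) * eulerInt l 0 (1 / √x) (√x * r) := by
      rw [coulombS_eq l hx0, regCoulomb]; ring
    rw [e]
    refine e0.trans ?_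
    calc C0 * (C1 / (√x * r)) ≤ C0 * (C1 / (√c * r)) := by gcongr
      _ = C0 * C1 / √c / r := by field_simp
      _ ≤ _ := by
        gcongr
        have : 0 ≤ C0 * C2 + (l + 1) * C4 := by positivity
        linarith
  -- Differentiating the power r^(l+1) contributes (l + 1) s/r, which is O(1/r) because s is bounded
  -- on this energy range.
  · have e : coulombSDeriv x l r
        = √x * (coulombConst l x * r ^ (l + 1) * eulerInt l 1 (1 / √x) (√x * r))
          + (l + 1) * (coulombS x l r / r) := by
      rw [coulombS_eq l hx0, regCoulomb, coulombSDeriv, regCoulombDeriv, pow_succ]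
      field_simp
      ring
    have him : (Complex.I ^ 1 * coulombAmp l x * Complex.exp (Complex.I * coulombPhase r x)).im
        = (coulombAmp l x * Complex.exp (Complex.I * coulombPhase r x)).re := by
      rw [pow_one, mul_assoc, Complex.I_mul_im]
    rw [him] at e1
    rw [e]
    set T := (coulombAmp l x * Complex.exp (Complex.I * coulombPhase r x)).re
    set J := coulombConst l x * r ^ (l + 1) * eulerInt l 1 (1 / √x) (√x * r)
    have : √x * J + (l + 1) * (coulombS x l r / r) - √x * T
        = √x * (J - T) + (l + 1) * (coulombS x l r / r) := by ring
    rw [this]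
    refine (abs_add_le _ _).trans ?_
    rw [abs_mul, abs_of_pos hk, abs_mul, abs_div, abs_of_pos hr0,
      abs_of_pos (by positivity : (0 : ℝ) < l + 1)]
    calc _ ≤ √x * (C0 * (C2 / (√x * r))) + (l + 1) * (C4 / r) := by gcongr
      _ = (C0 * C2 + (l + 1) * C4) / r := by field_simp
      _ ≤ _ := by
        gcongr
        have : 0 ≤ C0 * C1 / √c := by positivity
        linarith

/-! ### A Riemann-Lebesgue lemma for the Coulomb phase -/

theorem norm_exp_I_mul_ofReal (t : ℝ) : ‖Complex.exp (Complex.I * t)‖ = 1 := by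
  rw [mul_comm, Complex.norm_exp_ofReal_mul_I]

theorem hasDerivAt_coulombPhase (R : ℝ) {x : ℝ} (hx : 0 < x) :
    HasDerivAt (coulombPhase R) (1 / (2 * √x) * (R - Real.log R / x)) x := by
  have hk : 0 < √x := Real.sqrt_pos.2 hx
  have h1 := (hasDerivAt_id x).sqrt hx.ne'
  have h2 := (h1.mul_const R).add ((h1.inv hk.ne').mul_const (Real.log R))
  have : coulombPhase R = fun x => √x * R + (√x)⁻¹ * Real.log R := by
    funext x; rw [coulombPhase, one_div]
  rw [this]
  refine h2.congr_deriv ?_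
  simp only [id]
  rw [Real.sq_sqrt hx.le]
  field_simp
  ring

theorem measurable_coulombPhase (R : ℝ) : Measurable (coulombPhase R) := by
  unfold coulombPhase; fun_prop

theorem tendsto_log_div_atTop : Tendsto (fun R : ℝ => Real.log R / R) atTop (𝓝 0) := by
  simpa using Real.tendsto_pow_log_div_mul_add_atTop 1 0 1 one_ne_zero

theorem continuousOn_coulombPhase (R : ℝ) : ContinuousOn (coulombPhase R) (Ioi 0) := fun _ hx =>
  (hasDerivAt_coulombPhase R hx).continuousAt.continuousWithinAt

/-- One integration by parts with G = 2√x g. As Φ' = (R - ln R/x)/(2√x), R times the integral equals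
boundary and derivative terms, bounded in R, plus ln R times a bounded integral. Division by R
leaves O((1 + ln R)/R). -/
theorem tendsto_intervalIntegral_exp_coulombPhase_of_contDiff {g : ℝ → ℂ} (hg : ContDiff ℝ 1 g)
    {c d : ℝ} (hc : 0 < c) (hcd : c ≤ d) :
    Tendsto (fun R => ∫ x in c..d, g x * Complex.exp (Complex.I * coulombPhase R x)) atTop (𝓝 0) := by
  set G : ℝ → ℂ := fun x => 2 * (√x : ℝ) * g x with hG
  set G' : ℝ → ℂ := fun x => ((1 / √x : ℝ) : ℂ) * g x + 2 * (√x : ℝ) * deriv g x with hG'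
  have hpos : ∀ x ∈ Icc c d, 0 < x := fun x hx => hc.trans_le hx.1
  have hgc : Continuous g := hg.continuous
  have hg'c : Continuous (deriv g) := hg.continuous_deriv le_rfl
  have hGd : ∀ x, 0 < x → HasDerivAt G (G' x) x := by
    intro x hx
    have h1 := (((hasDerivAt_id x).sqrt hx.ne').ofReal_comp).const_mul (2 : ℂ)
    have h2 := ((hg.differentiable one_ne_zero) x).hasDerivAt
    refine (h1.mul h2).congr_deriv ?_
    simp only [id, hG']
    congr 1
    push_cast
    ring
  have hG'cont : ContinuousOn G' (Icc c d) := by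
    simp only [hG']
    have : ∀ x ∈ Icc c d, √x ≠ 0 := fun x hx => (Real.sqrt_pos.2 (hpos x hx)).ne'
    have h1 : ContinuousOn (fun x : ℝ => 1 / √x) (Icc c d) :=
      continuousOn_const.div (by fun_prop) this
    exact ((Complex.continuous_ofReal.comp_continuousOn h1).mul hgc.continuousOn).add (by fun_prop)
  have hEc : ∀ R, ContinuousOn (fun x => Complex.exp (Complex.I * coulombPhase R x)) (Icc c d) := by
    intro R
    have := (continuousOn_coulombPhase R).mono (fun x hx => hpos x hx : Icc c d ⊆ Ioi 0)
    exact ((Complex.continuous_ofReal.comp_continuousOn this).const_smul Complex.I).cexp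
  have hinv : ContinuousOn (fun x : ℝ => g x / x) (Icc c d) :=
    hgc.continuousOn.div (by fun_prop) fun x hx => by exact_mod_cast (hpos x hx).ne'
  obtain ⟨B1, hB1⟩ := isCompact_Icc.exists_bound_of_continuousOn hG'cont
  obtain ⟨B2, hB2⟩ := isCompact_Icc.exists_bound_of_continuousOn hinv
  have key : ∀ R : ℝ, R * (∫ x in c..d, g x * Complex.exp (Complex.I * coulombPhase R x))
      = -Complex.I * (G d * Complex.exp (Complex.I * coulombPhase R d) -
          G c * Complex.exp (Complex.I * coulombPhase R c))
        + Complex.I * (∫ x in c..d, G' x * Complex.exp (Complex.I * coulombPhase R x))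
        + Real.log R * ∫ x in c..d, g x / x * Complex.exp (Complex.I * coulombPhase R x) := by
    intro R
    have i1 : IntervalIntegrable (fun x => G' x * Complex.exp (Complex.I * coulombPhase R x)) volume c d :=
      (hG'cont.mul (hEc R)).intervalIntegrable_of_Icc hcd
    have i2 : IntervalIntegrable (fun x => g x * Complex.exp (Complex.I * coulombPhase R x)) volume c d :=
      (hgc.continuousOn.mul (hEc R)).intervalIntegrable_of_Icc hcd
    have i3 : IntervalIntegrable (fun x => g x / x * Complex.exp (Complex.I * coulombPhase R x)) volume c d :=
      (hinv.mul (hEc R)).intervalIntegrable_of_Icc hcd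
    have hF := intervalIntegral.integral_eq_sub_of_hasDerivAt (a := c) (b := d)
      (f := fun x => G x * Complex.exp (Complex.I * coulombPhase R x))
      (f' := fun x => G' x * Complex.exp (Complex.I * coulombPhase R x) +
        (Complex.I * R * (g x * Complex.exp (Complex.I * coulombPhase R x)) -
          Complex.I * Real.log R * (g x / x * Complex.exp (Complex.I * coulombPhase R x)))) ?_ ?_
    · rw [intervalIntegral.integral_add i1 ((i2.const_mul _).sub (i3.const_mul _)),
        intervalIntegral.integral_sub (i2.const_mul _) (i3.const_mul _),
        intervalIntegral.integral_const_mul, intervalIntegral.integral_const_mul] at hF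
      rw [← hF]
      linear_combination (R * (∫ x in c..d, g x * Complex.exp (Complex.I * coulombPhase R x)) -
        Real.log R * ∫ x in c..d, g x / x * Complex.exp (Complex.I * coulombPhase R x)) * Complex.I_sq
    · intro x hx
      rw [uIcc_of_le hcd] at hx
      have hx0 := hpos x hx
      have hk : ((√x : ℝ) : ℂ) ≠ 0 := by exact_mod_cast (Real.sqrt_pos.2 hx0).ne'
      have hxc : (x : ℂ) ≠ 0 := by exact_mod_cast hx0.ne'
      have h3 := (((hasDerivAt_coulombPhase R hx0).ofReal_comp).const_mul Complex.I).cexp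
      refine ((hGd x hx0).mul h3).congr_deriv ?_
      congr 1
      simp only [hG]
      push_cast
      field_simp
    · exact i1.add ((i2.const_mul _).sub (i3.const_mul _))
  have hbound : ∀ {f : ℝ → ℂ} {B : ℝ}, (∀ x ∈ Icc c d, ‖f x‖ ≤ B) → ∀ R,
      ‖∫ x in c..d, f x * Complex.exp (Complex.I * coulombPhase R x)‖ ≤ B * (d - c) := by
    intro f B hf R
    have := intervalIntegral.norm_integral_le_of_norm_le_const (a := c) (b := d) (C := B)
      (f := fun x => f x * Complex.exp (Complex.I * coulombPhase R x)) ?_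
    · rwa [abs_of_nonneg (by linarith)] at this
    · intro x hx
      rw [uIoc_of_le hcd] at hx
      rw [norm_mul, norm_exp_I_mul_ofReal, mul_one]
      exact hf x (Ioc_subset_Icc_self hx)
  have hlim : Tendsto (fun R : ℝ => (‖G d‖ + ‖G c‖ + B1 * (d - c)) * R⁻¹ +
      (Real.log R / R) * (B2 * (d - c))) atTop (𝓝 0) := by
    simpa using (tendsto_inv_atTop_zero.const_mul (‖G d‖ + ‖G c‖ + B1 * (d - c))).add
      (tendsto_log_div_atTop.mul_const (B2 * (d - c)))
  refine squeeze_zero_norm' ?_ hlim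
  filter_upwards [eventually_ge_atTop 1] with R hR
  have hR0 : 0 < R := by linarith
  have h1 : ‖(R : ℂ) * (∫ x in c..d, g x * Complex.exp (Complex.I * coulombPhase R x))‖
      ≤ (‖G d‖ + ‖G c‖ + B1 * (d - c)) + Real.log R * (B2 * (d - c)) := by
    rw [key R]
    refine (norm_add_le _ _).trans (add_le_add ((norm_add_le _ _).trans (add_le_add ?_ ?_)) ?_)
    · rw [norm_mul, norm_neg, Complex.norm_I, one_mul]
      refine (norm_sub_le _ _).trans ?_
      rw [norm_mul (G d), norm_mul (G c), norm_exp_I_mul_ofReal, norm_exp_I_mul_ofReal, mul_one, mul_one]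
    · rw [norm_mul, Complex.norm_I, one_mul]; exact hbound hB1 R
    · rw [norm_mul, Complex.norm_real, Real.norm_of_nonneg (Real.log_nonneg hR)]
      have := Real.log_nonneg hR
      gcongr
      exact hbound hB2 R
  rw [norm_mul, Complex.norm_real, Real.norm_of_nonneg hR0.le] at h1
  rw [show (‖G d‖ + ‖G c‖ + B1 * (d - c)) * R⁻¹ + (Real.log R / R) * (B2 * (d - c))
    = ((‖G d‖ + ‖G c‖ + B1 * (d - c)) + Real.log R * (B2 * (d - c))) / R by ring, le_div_iff₀ hR0]
  linarith

theorem norm_setIntegral_mul_exp_le {h : ℝ → ℂ} {s : Set ℝ} (hh : IntegrableOn h s) (R : ℝ) :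
    ‖∫ x in s, h x * Complex.exp (Complex.I * coulombPhase R x)‖ ≤ ∫ x in s, ‖h x‖ := by
  refine norm_integral_le_of_norm_le hh.norm (Eventually.of_forall fun x => ?_)
  rw [norm_mul, norm_exp_I_mul_ofReal, mul_one]

theorem integrableOn_mul_exp_coulombPhase {h : ℝ → ℂ} {s : Set ℝ} (hh : IntegrableOn h s) (R : ℝ) :
    IntegrableOn (fun x => h x * Complex.exp (Complex.I * coulombPhase R x)) s := by
  have := measurable_coulombPhase R
  refine Integrable.mono' hh.norm (hh.aestronglyMeasurable.mul
    (Measurable.aestronglyMeasurable (by fun_prop))) (Eventually.of_forall fun x => ?_)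
  rw [norm_mul, norm_exp_I_mul_ofReal, mul_one]

/-- A Riemann-Lebesgue lemma for the Coulomb phase. -/
theorem tendsto_integral_exp_coulombPhase {h : ℝ → ℂ} (hh : IntegrableOn h (Ioi 0)) :
    Tendsto (fun R => ∫ x in Ioi (0 : ℝ), h x * Complex.exp (Complex.I * coulombPhase R x))
      atTop (𝓝 0) := by
  rw [Metric.tendsto_atTop']
  intro ε hε
  have hmem : MemLp ((Ioi (0 : ℝ)).indicator h) 1 volume :=
    memLp_one_iff_integrable.2 ((integrable_indicator_iff measurableSet_Ioi).2 hh)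
  -- Approximation in L¹ by a smooth compactly supported function; since the exponential has modulus
  -- 1, the error is uniform in R.
  obtain ⟨g, hgs, hgc, hgn⟩ := hmem.exist_eLpNorm_sub_le (by simp) le_rfl (show 0 < ε / 4 by positivity)
  have hgI : Integrable g := hgc.continuous.integrable_of_hasCompactSupport hgs
  have hsub : ∫ x in Ioi (0 : ℝ), ‖h x - g x‖ ≤ ε / 4 := by
    have hI : Integrable ((Ioi (0 : ℝ)).indicator h - g) :=
      (memLp_one_iff_integrable.1 hmem).sub hgI
    have h1 : ∫ x, ‖((Ioi (0 : ℝ)).indicator h - g) x‖ ≤ ε / 4 := by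
      rw [eLpNorm_one_eq_lintegral_enorm, ← ofReal_integral_norm_eq_lintegral_enorm hI] at hgn
      exact (ENNReal.ofReal_le_ofReal_iff (by positivity)).1 hgn
    refine le_trans ?_ h1
    calc _ = ∫ x in Ioi (0 : ℝ), ‖((Ioi (0 : ℝ)).indicator h - g) x‖ :=
          setIntegral_congr_fun measurableSet_Ioi fun x hx => by simp [indicator_of_mem hx]
      _ ≤ _ := setIntegral_le_integral hI.norm (Eventually.of_forall fun _ => norm_nonneg _)
  obtain ⟨B, hB⟩ := hgs.exists_bound_of_continuous hgc.continuous
  have hB0 : 0 ≤ B := (norm_nonneg _).trans (hB 0)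
  obtain ⟨d, hd⟩ := (hgs.isCompact.isBounded).subset_closedBall 0
  -- The support of g may reach 0, where the phase is singular. The strip (0, c] is discarded at a
  -- cost of at most Bc ≤ ε/4.
  set c : ℝ := ε / 4 / (B + 1) with hc
  have hc0 : 0 < c := by positivity
  set d' := max d c with hd'
  have hcd : c ≤ d' := le_max_right _ _
  have hgz : ∀ x, d' < x → g x = 0 := by
    intro x hx
    by_contra hne
    have := hd (subset_tsupport _ hne)
    rw [Metric.mem_closedBall, dist_zero_right, Real.norm_eq_abs] at this
    linarith [le_abs_self x, le_max_left d c]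
  have hlim := tendsto_intervalIntegral_exp_coulombPhase_of_contDiff (hgc.of_le (by simp)) hc0 hcd
  rw [Metric.tendsto_atTop'] at hlim
  obtain ⟨N, hN⟩ := hlim (ε / 4) (by positivity)
  refine ⟨N, fun R hR => ?_⟩
  have h2 := hN R hR
  rw [dist_zero_right] at h2 ⊢
  have hgE := fun s : Set ℝ => integrableOn_mul_exp_coulombPhase (hgI.integrableOn (s := s)) R
  have hsplit : ∫ x in Ioi (0 : ℝ), h x * Complex.exp (Complex.I * coulombPhase R x)
      = (∫ x in Ioi (0 : ℝ), (h x - g x) * Complex.exp (Complex.I * coulombPhase R x))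
        + ((∫ x in Ioc 0 c, g x * Complex.exp (Complex.I * coulombPhase R x)) +
          ∫ x in c..d', g x * Complex.exp (Complex.I * coulombPhase R x)) := by
    have e1 : ∫ x in Ioi (0 : ℝ), (h x - g x) * Complex.exp (Complex.I * coulombPhase R x)
        = (∫ x in Ioi (0 : ℝ), h x * Complex.exp (Complex.I * coulombPhase R x))
          - ∫ x in Ioi (0 : ℝ), g x * Complex.exp (Complex.I * coulombPhase R x) := by
      rw [← integral_sub (integrableOn_mul_exp_coulombPhase hh R) (hgE _)]
      simp only [sub_mul]
    have e2 : ∫ x in Ioi (0 : ℝ), g x * Complex.exp (Complex.I * coulombPhase R x)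
        = (∫ x in Ioc 0 c, g x * Complex.exp (Complex.I * coulombPhase R x)) +
          ∫ x in c..d', g x * Complex.exp (Complex.I * coulombPhase R x) := by
      rw [intervalIntegral.integral_of_le hcd,
        ← setIntegral_union (Ioc_disjoint_Ioc_of_le le_rfl) measurableSet_Ioc (hgE _) (hgE _),
        Ioc_union_Ioc_eq_Ioc hc0.le hcd]
      refine (setIntegral_eq_of_subset_of_forall_sdiff_eq_zero measurableSet_Ioi
        Ioc_subset_Ioi_self fun x hx => ?_)
      have : d' < x := by
        by_contra hx'
        exact hx.2 ⟨hx.1, not_lt.1 hx'⟩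
      rw [hgz x this, zero_mul]
    rw [e1, ← e2]
    ring
  rw [hsplit]
  have b1 : ‖∫ x in Ioi (0 : ℝ), (h x - g x) * Complex.exp (Complex.I * coulombPhase R x)‖ ≤ ε / 4 :=
    (norm_setIntegral_mul_exp_le (h := fun x => h x - g x) (hh.sub hgI.integrableOn) R).trans hsub
  have b2 : ‖∫ x in Ioc 0 c, g x * Complex.exp (Complex.I * coulombPhase R x)‖ ≤ ε / 4 := by
    refine (norm_setIntegral_mul_exp_le hgI.integrableOn R).trans ?_
    calc ∫ x in Ioc 0 c, ‖g x‖ ≤ ∫ x in Ioc 0 c, B :=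
          setIntegral_mono hgI.integrableOn.norm (by simp) hB
      _ = B * c := by simp [hc0.le, mul_comm]
      _ ≤ ε / 4 := by
          rw [hc, mul_div_assoc', div_le_iff₀ (by positivity)]; nlinarith
  calc _ ≤ ε / 4 + (ε / 4 + ‖∫ x in c..d', g x * Complex.exp (Complex.I * coulombPhase R x)‖) :=
        (norm_add_le _ _).trans (add_le_add b1 ((norm_add_le _ _).trans (add_le_add_left b2 _)))
    _ < ε := by linarith

/-! ### The Dirichlet integral -/

theorem intervalIntegral_exp_neg_mul_sin (T y : ℝ) :
    ∫ x in (0 : ℝ)..T, Real.exp (-(x * y)) * Real.sin x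
      = (1 + y ^ 2)⁻¹ - Real.exp (-(T * y)) * (Real.cos T + y * Real.sin T) * (1 + y ^ 2)⁻¹ := by
  have hy : (1 + y ^ 2) ≠ 0 := by positivity
  have : ∀ x : ℝ, HasDerivAt (fun x => -(Real.exp (-(x * y)) * (Real.cos x + y * Real.sin x) * (1 + y ^ 2)⁻¹))
      (Real.exp (-(x * y)) * Real.sin x) x := by
    intro x
    have h1 : HasDerivAt (fun x => Real.exp (-(x * y))) (Real.exp (-(x * y)) * (-y)) x := by
      have := ((hasDerivAt_id x).mul_const y).neg.exp
      simpa using this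
    have h2 := (Real.hasDerivAt_cos x).add ((Real.hasDerivAt_sin x).const_mul y)
    refine ((h1.mul h2).mul_const (1 + y ^ 2)⁻¹).neg.congr_deriv ?_
    simp only [Pi.add_apply]
    field_simp
    ring
  rw [intervalIntegral.integral_eq_sub_of_hasDerivAt (fun x _ => this x)
    (Continuous.intervalIntegrable (by fun_prop) _ _)]
  simp
  ring

/-- Writing 1/x = ∫₀^∞ e^{-xy} dy and applying Fubini on the finite range (0, T] leaves ∫₀^∞ dy/(1 +
y²) = π/2, with a remainder dominated by ∫₀^∞ 2e^{-Ty} dy. -/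
theorem intervalIntegral_sinc_sub_le {T : ℝ} (hT : 0 < T) :
    |(∫ x in (0 : ℝ)..T, Real.sinc x) - Real.pi / 2| ≤ 2 / T := by
  set f : ℝ → ℝ → ℝ := fun x y => Real.exp (-(x * y)) * Real.sin x with hf
  have hexp : ∀ x : ℝ, 0 < x → ∫ y in Ioi (0 : ℝ), Real.exp (-(x * y)) = x⁻¹ := by
    intro x hx
    have := integral_exp_neg_mul_rpow (p := 1) (b := x) one_pos hx
    simpa [Real.rpow_neg_one, one_add_one_eq_two] using this
  have hexpI : ∀ x : ℝ, 0 < x → IntegrableOn (fun y => Real.exp (-(x * y))) (Ioi 0) := by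
    intro x hx
    simpa [neg_mul] using exp_neg_integrableOn_Ioi 0 hx
  have hfI : Integrable (Function.uncurry f)
      ((volume.restrict (Ioc 0 T)).prod (volume.restrict (Ioi 0))) := by
    rw [integrable_prod_iff (Continuous.aestronglyMeasurable (by simp only [hf]; fun_prop))]
    constructor
    · refine (ae_restrict_iff' measurableSet_Ioc).2 (Eventually.of_forall fun x hx => ?_)
      exact (hexpI x hx.1).mul_const (Real.sin x)
    · refine Integrable.mono' (g := fun _ => (1 : ℝ)) (by simp) ?_ ?_
      · exact (Continuous.aestronglyMeasurable (by simp only [hf]; fun_prop)).norm.integral_prod_right'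
      · refine (ae_restrict_iff' measurableSet_Ioc).2 (Eventually.of_forall fun x hx => ?_)
        rw [Real.norm_of_nonneg (integral_nonneg fun _ => norm_nonneg _)]
        have : ∀ y, ‖Function.uncurry f (x, y)‖ = Real.exp (-(x * y)) * |Real.sin x| := fun y => by
          simp [hf]
        simp only [this]
        rw [integral_mul_const, hexp x hx.1]
        have h := Real.abs_sin_lt_abs hx.1.ne' |>.le
        rw [abs_of_pos hx.1] at h
        rw [inv_mul_le_iff₀ hx.1]; linarith
  have hswap := integral_integral_swap hfI
  have h1 : ∫ x in Ioc 0 T, ∫ y in Ioi (0 : ℝ), f x y = ∫ x in (0 : ℝ)..T, Real.sinc x := by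
    rw [intervalIntegral.integral_of_le hT.le]
    refine setIntegral_congr_fun measurableSet_Ioc fun x hx => ?_
    simp only [hf]
    rw [integral_mul_const, hexp x hx.1, Real.sinc_of_ne_zero hx.1.ne']
    ring
  have h2 : ∀ y, ∫ x in Ioc 0 T, f x y = (1 + y ^ 2)⁻¹ -
      Real.exp (-(T * y)) * (Real.cos T + y * Real.sin T) * (1 + y ^ 2)⁻¹ := by
    intro y
    rw [← intervalIntegral.integral_of_le hT.le]
    exact intervalIntegral_exp_neg_mul_sin T y
  have hbd : ∀ y ∈ Ioi (0 : ℝ), ‖Real.exp (-(T * y)) * (Real.cos T + y * Real.sin T) * (1 + y ^ 2)⁻¹‖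
      ≤ 2 * Real.exp (-(T * y)) := by
    intro y hy
    have hy0 : 0 < y := hy
    rw [norm_mul, norm_mul, Real.norm_of_nonneg (Real.exp_pos _).le,
      Real.norm_of_nonneg (by positivity : (0 : ℝ) ≤ (1 + y ^ 2)⁻¹)]
    have : ‖Real.cos T + y * Real.sin T‖ ≤ 1 + y := by
      refine (norm_add_le _ _).trans (add_le_add (Real.abs_cos_le_one T) ?_)
      rw [norm_mul, Real.norm_of_nonneg hy0.le]
      exact mul_le_of_le_one_right hy0.le (Real.abs_sin_le_one T)
    have h3 : (1 + y) * (1 + y ^ 2)⁻¹ ≤ 2 := by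
      rw [← div_eq_mul_inv, div_le_iff₀ (by positivity)]
      nlinarith [sq_nonneg (y - 1)]
    calc _ ≤ Real.exp (-(T * y)) * (1 + y) * (1 + y ^ 2)⁻¹ := by gcongr
      _ = Real.exp (-(T * y)) * ((1 + y) * (1 + y ^ 2)⁻¹) := by ring
      _ ≤ Real.exp (-(T * y)) * 2 := by gcongr
      _ = _ := mul_comm _ _
  have hbdI := (hexpI T hT).const_mul 2
  have hrI : IntegrableOn (fun y => Real.exp (-(T * y)) * (Real.cos T + y * Real.sin T) *
      (1 + y ^ 2)⁻¹) (Ioi 0) := by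
    refine hbdI.mono' (Measurable.aestronglyMeasurable (by fun_prop)) ?_
    exact (ae_restrict_iff' measurableSet_Ioi).2 (Eventually.of_forall hbd)
  rw [h1] at hswap
  simp only [h2] at hswap
  rw [integral_sub integrable_inv_one_add_sq.integrableOn hrI, integral_Ioi_inv_one_add_sq,
    Real.arctan_zero, sub_zero] at hswap
  rw [hswap, sub_sub_cancel_left, abs_neg]
  calc _ ≤ ∫ y in Ioi (0 : ℝ), 2 * Real.exp (-(T * y)) :=
        norm_integral_le_of_norm_le hbdI
          ((ae_restrict_iff' measurableSet_Ioi).2 (Eventually.of_forall hbd))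
    _ = _ := by rw [integral_const_mul, hexp T hT]; ring

/-- The Dirichlet integral. -/
theorem tendsto_intervalIntegral_sinc :
    Tendsto (fun T => ∫ x in (0 : ℝ)..T, Real.sinc x) atTop (𝓝 (Real.pi / 2)) := by
  rw [tendsto_iff_norm_sub_tendsto_zero]
  refine squeeze_zero_norm' ?_ (tendsto_const_nhds.div_atTop tendsto_id : Tendsto (fun T : ℝ => 2 / T) atTop (𝓝 0))
  filter_upwards [eventually_gt_atTop 0] with T hT
  rw [norm_norm]
  exact intervalIntegral_sinc_sub_le hT

theorem tendsto_intervalIntegral_sinc_atBot :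
    Tendsto (fun T => ∫ x in (0 : ℝ)..T, Real.sinc x) atBot (𝓝 (-(Real.pi / 2))) := by
  have h := (tendsto_intervalIntegral_sinc.comp tendsto_neg_atBot_atTop).neg
  refine h.congr fun T => ?_
  simp only [Function.comp]
  rw [← intervalIntegral.integral_symm]
  have := intervalIntegral.integral_comp_neg (a := 0) (b := T) Real.sinc
  rw [neg_zero] at this
  rw [← this]
  simp [Real.sinc_neg]

/-! ### The Dirichlet kernel with the Coulomb phase -/

theorem tendsto_setIntegral_exp_coulombPhase {h : ℝ → ℂ} {s : Set ℝ} (hs : MeasurableSet s)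
    (hs0 : s ⊆ Ioi 0) (hh : IntegrableOn h s) :
    Tendsto (fun R => ∫ x in s, h x * Complex.exp (Complex.I * coulombPhase R x)) atTop (𝓝 0) := by
  have h1 : IntegrableOn (s.indicator h) (Ioi 0) :=
    ((integrable_indicator_iff hs).2 hh).integrableOn
  refine (tendsto_integral_exp_coulombPhase h1).congr fun R => ?_
  have : ∀ x, s.indicator h x * Complex.exp (Complex.I * coulombPhase R x)
      = s.indicator (fun x => h x * Complex.exp (Complex.I * coulombPhase R x)) x := by
    intro x
    by_cases hx : x ∈ s <;> simp [hx]
  simp only [this]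
  rw [setIntegral_indicator hs, inter_eq_self_of_subset_right hs0]

theorem tendsto_intervalIntegral_exp_coulombPhase {h : ℝ → ℂ} {a b : ℝ} (ha : 0 < a) (hb : 0 < b)
    (hh : IntervalIntegrable h volume a b) :
    Tendsto (fun R => ∫ x in a..b, h x * Complex.exp (Complex.I * coulombPhase R x)) atTop (𝓝 0) := by
  have h1 := tendsto_setIntegral_exp_coulombPhase measurableSet_Ioc
    (fun x hx => ha.trans hx.1 : Ioc a b ⊆ Ioi 0) hh.1
  have h2 := tendsto_setIntegral_exp_coulombPhase measurableSet_Ioc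
    (fun x hx => hb.trans hx.1 : Ioc b a ⊆ Ioi 0) hh.2
  simpa [intervalIntegral] using h1.sub h2

theorem pos_of_mem_uIcc {a b x : ℝ} (ha : 0 < a) (hb : 0 < b) (hx : x ∈ uIcc a b) : 0 < x :=
  lt_of_lt_of_le (lt_min ha hb) hx.1

theorem continuousOn_mul_sin_coulombPhase_sub (a : ℝ) {f : ℝ → ℝ} {s : Set ℝ} (hs : s ⊆ Ioi 0)
    (hf : ContinuousOn f s) (R : ℝ) :
    ContinuousOn (fun x => f x * Real.sin (coulombPhase R x - coulombPhase R a)) s :=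
  hf.mul (Real.continuous_sin.comp_continuousOn
    (((continuousOn_coulombPhase R).mono hs).sub continuousOn_const))

theorem tendsto_intervalIntegral_sin_coulombPhase_sub {a b : ℝ} (ha : 0 < a) (hb : 0 < b) {h : ℝ → ℝ}
    (hh : IntervalIntegrable h volume a b) :
    Tendsto (fun R => ∫ x in a..b, h x * Real.sin (coulombPhase R x - coulombPhase R a))
      atTop (𝓝 0) := by
  have hC : IntervalIntegrable (fun x => (h x : ℂ)) volume a b := ⟨hh.1.ofReal, hh.2.ofReal⟩
  have h1 := tendsto_intervalIntegral_exp_coulombPhase ha hb hC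
  have hI : ∀ R, IntervalIntegrable
      (fun x => (h x : ℂ) * Complex.exp (Complex.I * coulombPhase R x)) volume a b := fun R =>
    ⟨integrableOn_mul_exp_coulombPhase hC.1 R, integrableOn_mul_exp_coulombPhase hC.2 R⟩
  refine squeeze_zero_norm (fun R => ?_) (tendsto_zero_iff_norm_tendsto_zero.1 h1)
  have : ∫ x in a..b, h x * Real.sin (coulombPhase R x - coulombPhase R a)
      = (Complex.exp (Complex.I * (-coulombPhase R a : ℝ)) *
        ∫ x in a..b, (h x : ℂ) * Complex.exp (Complex.I * coulombPhase R x)).im := by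
    rw [← intervalIntegral.integral_const_mul]
    have := intervalIntegral.intervalIntegral_im (𝕜 := ℂ)
      ((hI R).const_mul (Complex.exp (Complex.I * (-coulombPhase R a : ℝ))))
    simp only [RCLike.im_to_complex] at this
    rw [← this]
    refine intervalIntegral.integral_congr fun x _ => ?_
    rw [show Complex.exp (Complex.I * (-coulombPhase R a : ℝ)) *
        ((h x : ℂ) * Complex.exp (Complex.I * coulombPhase R x))
        = (h x : ℂ) * (Complex.exp (Complex.I * coulombPhase R x) *
          Complex.exp (Complex.I * (-coulombPhase R a : ℝ))) by ring, ← Complex.exp_add,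
      show Complex.I * coulombPhase R x + Complex.I * (-coulombPhase R a : ℝ)
        = ((coulombPhase R x - coulombPhase R a : ℝ) : ℂ) * Complex.I by push_cast; ring,
      Complex.im_ofReal_mul, Complex.exp_ofReal_mul_I_im]
  rw [this]
  refine (Complex.abs_im_le_norm _).trans ?_
  rw [norm_mul, norm_exp_I_mul_ofReal, one_mul]

theorem coulombPhase_sub (R : ℝ) {a x : ℝ} (ha : 0 < a) (hx : 0 < x) :
    coulombPhase R x - coulombPhase R a = (√x - √a) * (R - Real.log R / (√x * √a)) := by
  have hk : 0 < √x := Real.sqrt_pos.2 hx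
  have hκ : 0 < √a := Real.sqrt_pos.2 ha
  rw [coulombPhase, coulombPhase]
  field_simp
  ring

/-- Compares 1/(x - a) with Φ'(x)/(Φ(x) - Φ(a)), the factor that makes the sine integral exact under
the substitution u = Φ(x) - Φ(a). The pole cancels: what remains is a regular coefficient and a
correction of relative size ln R/R. -/
theorem sin_coulombPhase_sub_div {R a x : ℝ} (ha : 0 < a) (hx : 0 < x) (hxa : x ≠ a)
    (hR : R - Real.log R / (√x * √a) ≠ 0) :
    Real.sin (coulombPhase R x - coulombPhase R a) / (x - a) =
      1 / (2 * √x * (√x + √a)) * Real.sin (coulombPhase R x - coulombPhase R a)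
      - Real.log R / (2 * √x ^ 3 * √a * (R - Real.log R / (√x * √a))) *
          Real.sin (coulombPhase R x - coulombPhase R a)
      + Real.sinc (coulombPhase R x - coulombPhase R a) *
          (1 / (2 * √x) * (R - Real.log R / x)) := by
  have hk : 0 < √x := Real.sqrt_pos.2 hx
  have hκ : 0 < √a := Real.sqrt_pos.2 ha
  have hkκ : √x - √a ≠ 0 := fun h => hxa ((Real.sqrt_inj hx.le ha.le).1 (by linarith))
  have hΦ := coulombPhase_sub R ha hx
  have hne : coulombPhase R x - coulombPhase R a ≠ 0 := by
    rw [hΦ]; exact mul_ne_zero hkκ hR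
  rw [Real.sinc_of_ne_zero hne]
  set S := Real.sin (coulombPhase R x - coulombPhase R a)
  rw [hΦ]
  have hxk : x = √x ^ 2 := (Real.sq_sqrt hx.le).symm
  have hak : a = √a ^ 2 := (Real.sq_sqrt ha.le).symm
  set k := √x
  set κ := √a
  rw [hxk, hak]
  have hsum : k + κ ≠ 0 := by positivity
  have hdiff : k ^ 2 - κ ^ 2 ≠ 0 := by
    rw [sq_sub_sq]; exact mul_ne_zero hsum hkκ
  have hD : R * (k * κ) - Real.log R ≠ 0 := by
    intro h
    apply hR
    field_simp
    linarith
  have e : R - Real.log R / (k * κ) = (R * (k * κ) - Real.log R) / (k * κ) := by field_simp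
  rw [e]
  obtain ⟨D, hDdef⟩ : ∃ D, D = R * (k * κ) - Real.log R := ⟨_, rfl⟩
  have hlog : Real.log R = R * (k * κ) - D := by rw [hDdef]; ring
  rw [← hDdef] at hD ⊢
  rw [hlog]
  field_simp
  ring

theorem min_le_sqrt_mul_sqrt {a b x : ℝ} (ha : 0 < a) (hb : 0 < b) (hx : x ∈ uIcc a b) :
    min a b ≤ √x * √a := by
  have hm : 0 ≤ min a b := (lt_min ha hb).le
  calc min a b = √(min a b) * √(min a b) := (Real.mul_self_sqrt hm).symm
    _ ≤ √x * √a := mul_le_mul (Real.sqrt_le_sqrt hx.1) (Real.sqrt_le_sqrt (min_le_left a b))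
        (Real.sqrt_nonneg _) (Real.sqrt_nonneg _)

theorem eventually_log_div_le {c : ℝ} (hc : 0 < c) :
    ∀ᶠ R in atTop, 0 < R ∧ 0 ≤ Real.log R ∧ Real.log R / c ≤ R / 2 := by
  have h := tendsto_log_div_atTop.eventually (gt_mem_nhds (show (0 : ℝ) < c / 2 by positivity))
  filter_upwards [h, eventually_ge_atTop 1] with R h1 h2
  have hR : 0 < R := by linarith
  refine ⟨hR, Real.log_nonneg h2, ?_⟩
  rw [div_lt_iff₀ hR] at h1
  rw [div_le_iff₀ hc]
  linarith

theorem half_le_sub_log_div {a b x R : ℝ} (ha : 0 < a) (hb : 0 < b) (hx : x ∈ uIcc a b)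
    (hlog : 0 ≤ Real.log R) (hR : Real.log R / min a b ≤ R / 2) :
    R / 2 ≤ R - Real.log R / (√x * √a) := by
  have : Real.log R / (√x * √a) ≤ Real.log R / min a b :=
    div_le_div_of_nonneg_left hlog (lt_min ha hb) (min_le_sqrt_mul_sqrt ha hb hx)
  linarith

theorem tendsto_sub_log_div (c : ℝ) : Tendsto (fun R => R - Real.log R / c) atTop atTop := by
  have h : Tendsto (fun R => R * (1 - Real.log R / R / c)) atTop atTop := by
    refine tendsto_id.atTop_mul_pos (C := 1) one_pos ?_
    simpa using (tendsto_const_nhds (x := (1 : ℝ))).sub (tendsto_log_div_atTop.div_const c)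
  refine h.congr' ?_
  filter_upwards [eventually_gt_atTop 0] with R hR
  rw [mul_sub, mul_one]
  congr 1
  field_simp

/-- In the splitting of `sin_coulombPhase_sub_div` the first term tends to 0 by Riemann-Lebesgue,
the second is O(ln R/R), and the third is the sinc integral by substitution. -/
theorem tendsto_intervalIntegral_sin_coulombPhase_div_sub {a b : ℝ} (ha : 0 < a) (hb : 0 < b) :
    Tendsto (fun R => (∫ x in a..b, Real.sin (coulombPhase R x - coulombPhase R a) / (x - a)) -
      ∫ u in (0 : ℝ)..(coulombPhase R b - coulombPhase R a), Real.sinc u) atTop (𝓝 0) := by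
  set c := min a b with hc
  have hcpos : 0 < c := lt_min ha hb
  have hsub : uIcc a b ⊆ Ioi 0 := fun x hx => pos_of_mem_uIcc ha hb hx
  have hsqrt : ∀ x ∈ uIcc a b, 0 < √x := fun x hx => Real.sqrt_pos.2 (hsub hx)
  have hκ : 0 < √a := Real.sqrt_pos.2 ha
  have c1 : ContinuousOn (fun x : ℝ => 1 / (2 * √x * (√x + √a))) (uIcc a b) := by
    refine ContinuousOn.div continuousOn_const (by fun_prop) fun x hx => ?_
    have := hsqrt x hx
    positivity
  have h1 := tendsto_intervalIntegral_sin_coulombPhase_sub ha hb c1.intervalIntegrable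
  have h2 : Tendsto (fun R => ∫ x in a..b,
      Real.log R / (2 * √x ^ 3 * √a * (R - Real.log R / (√x * √a))) *
          Real.sin (coulombPhase R x - coulombPhase R a)) atTop (𝓝 0) := by
    have hl : Tendsto (fun R => Real.log R / R / c ^ 2 * |b - a|) atTop (𝓝 0) := by
      simpa using (tendsto_log_div_atTop.div_const (c ^ 2)).mul_const |b - a|
    refine squeeze_zero_norm' ?_ hl
    filter_upwards [eventually_log_div_le hcpos] with R ⟨hR, hlog, hRc⟩
    refine intervalIntegral.norm_integral_le_of_norm_le_const fun x hx => ?_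
    have hx' := uIoc_subset_uIcc hx
    have hk := hsqrt x hx'
    have hD := half_le_sub_log_div ha hb hx' hlog hRc
    have hkk := min_le_sqrt_mul_sqrt ha hb hx'
    have hxc : c ≤ x := hx'.1
    have hx0 : 0 < x := hsub hx'
    rw [norm_mul, Real.norm_eq_abs, Real.norm_eq_abs, div_div]
    have hDpos : 0 < R - Real.log R / (√x * √a) := by linarith
    have hden : R * c ^ 2 ≤ 2 * √x ^ 3 * √a * (R - Real.log R / (√x * √a)) := by
      have e : 2 * √x ^ 3 * √a = 2 * (√x * √a) * x := by
        have := Real.sq_sqrt (hsub hx').le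
        calc 2 * √x ^ 3 * √a = 2 * (√x * √a) * √x ^ 2 := by ring
          _ = _ := by rw [this]
      rw [e]
      calc R * c ^ 2 = 2 * c * c * (R / 2) := by ring
        _ ≤ 2 * (√x * √a) * x * (R - Real.log R / (√x * √a)) := by gcongr
    rw [abs_of_nonneg (by positivity)]
    calc _ ≤ Real.log R / (2 * √x ^ 3 * √a * (R - Real.log R / (√x * √a))) * 1 := by
          gcongr; exact Real.abs_sin_le_one _
      _ ≤ Real.log R / (R * c ^ 2) := by
          rw [mul_one]; gcongr
  have h3 : Tendsto (fun R => (∫ x in a..b, 1 / (2 * √x * (√x + √a)) *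
      Real.sin (coulombPhase R x - coulombPhase R a)) - ∫ x in a..b,
      Real.log R / (2 * √x ^ 3 * √a * (R - Real.log R / (√x * √a))) *
          Real.sin (coulombPhase R x - coulombPhase R a)) atTop (𝓝 0) := by
    simpa using h1.sub h2
  refine h3.congr' ?_
  filter_upwards [eventually_log_div_le hcpos] with R ⟨hR, hlog, hRc⟩
  have hne : ∀ x ∈ uIcc a b, R - Real.log R / (√x * √a) ≠ 0 := fun x hx => by
    have := half_le_sub_log_div ha hb hx hlog hRc
    exact ne_of_gt (by linarith)
  have c2 : ContinuousOn (fun x : ℝ =>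
      Real.log R / (2 * √x ^ 3 * √a * (R - Real.log R / (√x * √a)))) (uIcc a b) := by
    have hd : ContinuousOn (fun x : ℝ => Real.log R / (√x * √a)) (uIcc a b) :=
      ContinuousOn.div continuousOn_const (by fun_prop)
        fun x hx => (mul_pos (hsqrt x hx) hκ).ne'
    refine ContinuousOn.div continuousOn_const
      (ContinuousOn.mul (by fun_prop) (continuousOn_const.sub hd)) fun x hx => ?_
    have := hsqrt x hx
    exact mul_ne_zero (by positivity) (hne x hx)
  have c3 : ContinuousOn (fun x : ℝ => 1 / (2 * √x) * (R - Real.log R / x)) (uIcc a b) := by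
    refine ContinuousOn.mul (ContinuousOn.div continuousOn_const (by fun_prop) fun x hx => ?_)
      (continuousOn_const.sub (continuousOn_const.div continuousOn_id fun x hx => (hsub hx).ne'))
    have := hsqrt x hx
    positivity
  have c4 : ContinuousOn (fun x : ℝ => Real.sinc (coulombPhase R x - coulombPhase R a))
      (uIcc a b) := Real.continuous_sinc.comp_continuousOn
    (((continuousOn_coulombPhase R).mono hsub).sub continuousOn_const)
  have e1 : ∫ x in a..b, Real.sin (coulombPhase R x - coulombPhase R a) / (x - a) =
      ∫ x in a..b, (1 / (2 * √x * (√x + √a)) * Real.sin (coulombPhase R x - coulombPhase R a)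
      - Real.log R / (2 * √x ^ 3 * √a * (R - Real.log R / (√x * √a))) *
          Real.sin (coulombPhase R x - coulombPhase R a)
      + Real.sinc (coulombPhase R x - coulombPhase R a) *
          (1 / (2 * √x) * (R - Real.log R / x))) := by
    refine intervalIntegral.integral_congr_ae ?_
    filter_upwards [(countable_singleton a).ae_notMem volume] with x hxa hx
    have hx' := uIoc_subset_uIcc hx
    exact sin_coulombPhase_sub_div ha (hsub hx') hxa (hne x hx')
  have i1 := (continuousOn_mul_sin_coulombPhase_sub a hsub c1 R).intervalIntegrable
    (μ := volume)
  have i2 := (continuousOn_mul_sin_coulombPhase_sub a hsub c2 R).intervalIntegrable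
    (μ := volume)
  have e3 : ∫ x in a..b, Real.sinc (coulombPhase R x - coulombPhase R a) *
          (1 / (2 * √x) * (R - Real.log R / x)) =
      ∫ u in (0 : ℝ)..(coulombPhase R b - coulombPhase R a), Real.sinc u := by
    have := intervalIntegral.integral_comp_mul_deriv
      (f := fun x => coulombPhase R x - coulombPhase R a)
      (fun x hx => (hasDerivAt_coulombPhase R (hsub hx)).sub_const _) c3 Real.continuous_sinc
    simpa using this
  have i3 : IntervalIntegrable (fun x => Real.sinc (coulombPhase R x - coulombPhase R a) *
      (1 / (2 * √x) * (R - Real.log R / x))) volume a b := (c4.mul c3).intervalIntegrable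
  rw [e1, intervalIntegral.integral_add (i1.sub i2) i3, intervalIntegral.integral_sub i1 i2, e3]
  ring

theorem tendsto_intervalIntegral_sin_coulombPhase_right {a b : ℝ} (ha : 0 < a) (hab : a < b) :
    Tendsto (fun R => ∫ x in a..b, Real.sin (coulombPhase R x - coulombPhase R a) / (x - a))
      atTop (𝓝 (Real.pi / 2)) := by
  have hb := ha.trans hab
  have hΦ : Tendsto (fun R => coulombPhase R b - coulombPhase R a) atTop atTop := by
    simp only [coulombPhase_sub _ ha hb]
    exact (tendsto_sub_log_div _).const_mul_atTop (sub_pos.2 (Real.sqrt_lt_sqrt ha.le hab))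
  simpa using (tendsto_intervalIntegral_sin_coulombPhase_div_sub ha hb).add
    (tendsto_intervalIntegral_sinc.comp hΦ)

theorem tendsto_intervalIntegral_sin_coulombPhase_left {a b : ℝ} (hb : 0 < b) (hab : b < a) :
    Tendsto (fun R => ∫ x in b..a, Real.sin (coulombPhase R x - coulombPhase R a) / (x - a))
      atTop (𝓝 (Real.pi / 2)) := by
  have ha := hb.trans hab
  have hΦ : Tendsto (fun R => coulombPhase R b - coulombPhase R a) atTop atBot := by
    simp only [coulombPhase_sub _ ha hb]
    exact (tendsto_sub_log_div _).const_mul_atTop_of_neg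
      (sub_neg.2 (Real.sqrt_lt_sqrt hb.le hab))
  have h : Tendsto (fun R => ∫ x in a..b, Real.sin (coulombPhase R x - coulombPhase R a) / (x - a))
      atTop (𝓝 (-(Real.pi / 2))) := by
    simpa using (tendsto_intervalIntegral_sin_coulombPhase_div_sub ha hb).add
      (tendsto_intervalIntegral_sinc_atBot.comp hΦ)
  simp only [intervalIntegral.integral_symm a b]
  simpa using h.neg

/-! ### The truncated inner product and the Wronskian -/

theorem hasDerivAt_coulombS (l : ℕ) {x : ℝ} (hx : 0 < x) (r : ℝ) :
    HasDerivAt (coulombS x l) (coulombSDeriv x l r) r := by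
  rw [show coulombS x l = fun r => coulombConst l x * regCoulomb l (√x) (1 / √x) r from
    funext (coulombS_eq l hx)]
  exact (hasDerivAt_regCoulomb l _ _ r).const_mul _

theorem hasDerivAt_coulombSDeriv (l : ℕ) {x r : ℝ} (hx : 0 < x) (hr : r ≠ 0) :
    HasDerivAt (coulombSDeriv x l)
      (-(x + 2 / r - l * (l + 1) / r ^ 2) * coulombS x l r) r := by
  have hk : √x ≠ 0 := (Real.sqrt_pos.2 hx).ne'
  have h := (hasDerivAt_regCoulombDeriv l (√x) (1 / √x) hr).const_mul (coulombConst l x)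
  refine h.congr_deriv ?_
  rw [coulombS_eq l hx, Real.sq_sqrt hx.le, mul_one_div_cancel hk]
  ring

theorem continuous_regCoulomb (l : ℕ) :
    Continuous (fun p : ℝ × ℝ × ℝ => regCoulomb l p.1 p.2.1 p.2.2) := by
  have h := (continuous_eulerInt l 0).comp
    (by fun_prop : Continuous fun p : ℝ × ℝ × ℝ => (p.2.1, p.1 * p.2.2))
  exact Continuous.mul (by fun_prop) h

theorem continuous_regCoulombDeriv (l : ℕ) :
    Continuous (fun p : ℝ × ℝ × ℝ => regCoulombDeriv l p.1 p.2.1 p.2.2) := by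
  have h p := (continuous_eulerInt l p).comp
    (by fun_prop : Continuous fun p : ℝ × ℝ × ℝ => (p.2.1, p.1 * p.2.2))
  exact (Continuous.mul (by fun_prop) (h 0)).add
    (Continuous.mul (by fun_prop) (Continuous.mul (by fun_prop) (h 1)))

theorem continuous_coulombS (l : ℕ) {x : ℝ} (hx : 0 < x) : Continuous (coulombS x l) :=
  continuous_iff_continuousAt.2 fun r => (hasDerivAt_coulombS l hx r).continuousAt

theorem continuous_coulombSDeriv (l : ℕ) (x : ℝ) : Continuous (coulombSDeriv x l) :=
  continuous_const.mul ((continuous_regCoulombDeriv l).comp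
    (by fun_prop : Continuous fun r : ℝ => (√x, 1 / √x, r)))

theorem continuousOn_coulombConst (l : ℕ) : ContinuousOn (coulombConst l) (Ioi 0) := fun _ hx =>
  (differentiableAt_coulombConst l hx).continuousAt.continuousWithinAt

theorem continuousOn_one_div_sqrt : ContinuousOn (fun x : ℝ => 1 / √x) (Ioi 0) :=
  continuousOn_const.div (by fun_prop) fun _ hx => (Real.sqrt_pos.2 hx).ne'

theorem continuousOn_sqrt_prod (r : ℝ) :
    ContinuousOn (fun x : ℝ => (√x, 1 / √x, r)) (Ioi 0) :=
  ContinuousOn.prodMk (by fun_prop) (continuousOn_one_div_sqrt.prodMk continuousOn_const)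

theorem continuousOn_coulombS (l : ℕ) (r : ℝ) :
    ContinuousOn (fun x => coulombS x l r) (Ioi 0) :=
  ((continuousOn_coulombConst l).mul
    ((continuous_regCoulomb l).comp_continuousOn (continuousOn_sqrt_prod r))).congr
    fun _ hx => coulombS_eq l hx r

theorem continuousOn_coulombSDeriv (l : ℕ) (r : ℝ) :
    ContinuousOn (fun x => coulombSDeriv x l r) (Ioi 0) :=
  (continuousOn_coulombConst l).mul
    ((continuous_regCoulombDeriv l).comp_continuousOn (continuousOn_sqrt_prod r))

/-- The truncated inner product of two Coulomb wave functions. -/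
noncomputable def coulombKernel (l : ℕ) (a R x : ℝ) : ℝ :=
  ∫ r in (0 : ℝ)..R, coulombS x l r * coulombS a l r

/-- The Wronskian at `R` of two Coulomb wave functions. -/
noncomputable def coulombWronskian (l : ℕ) (a R x : ℝ) : ℝ :=
  coulombS x l R * coulombSDeriv a l R - coulombSDeriv x l R * coulombS a l R

theorem intervalIntegrable_coulombS_mul (l : ℕ) {a x : ℝ} (ha : 0 < a) (hx : 0 < x) (R : ℝ) :
    IntervalIntegrable (fun r => coulombS x l r * coulombS a l r) volume 0 R :=
  ((continuous_coulombS l hx).mul (continuous_coulombS l ha)).intervalIntegrable _ _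

theorem coulombS_zero (l : ℕ) {x : ℝ} (hx : 0 < x) : coulombS x l 0 = 0 := by
  simp [coulombS_eq l hx, regCoulomb]

/-- Lagrange's identity. The terms 2/r - l(l+1)/r² are common to both equations and cancel in the
derivative of the Wronskian, and at r = 0 the Wronskian vanishes with the two functions. -/
theorem sub_mul_coulombKernel (l : ℕ) {a x R : ℝ} (ha : 0 < a) (hx : 0 < x) (hR : 0 ≤ R) :
    (x - a) * coulombKernel l a R x = coulombWronskian l a R x := by
  have hc : Continuous fun r => coulombWronskian l a r x :=
    ((continuous_coulombS l hx).mul (continuous_coulombSDeriv l a)).sub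
      ((continuous_coulombSDeriv l x).mul (continuous_coulombS l ha))
  -- The radial equation is available only for r ≠ 0; at the left endpoint continuity of the
  -- Wronskian suffices.
  have h := intervalIntegral.integral_eq_sub_of_hasDerivAt_of_le hR hc.continuousOn
    (f' := fun r => (x - a) * (coulombS x l r * coulombS a l r)) (fun r hr => ?_)
    ((intervalIntegrable_coulombS_mul l ha hx R).const_mul _)
  · rw [intervalIntegral.integral_const_mul] at h
    rw [coulombKernel, h]
    simp [coulombWronskian, coulombS_zero l hx, coulombS_zero l ha]
  · have hr0 : r ≠ 0 := hr.1.ne'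
    refine (((hasDerivAt_coulombS l hx r).mul (hasDerivAt_coulombSDeriv l ha hr0)).sub
      ((hasDerivAt_coulombSDeriv l hx hr0).mul (hasDerivAt_coulombS l ha r))).congr_deriv ?_
    ring

theorem continuousOn_coulombKernel (l : ℕ) {a : ℝ} (ha : 0 < a) (R : ℝ) :
    ContinuousOn (coulombKernel l a R) (Ioi 0) := by
  have hG : Continuous fun q : ℝ × ℝ =>
      ∫ r in (0 : ℝ)..R, regCoulomb l q.1 q.2 r * coulombS a l r := by
    refine intervalIntegral.continuous_parametric_intervalIntegral_of_continuous' ?_ _ _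
    exact ((continuous_regCoulomb l).comp
      (by fun_prop : Continuous fun p : (ℝ × ℝ) × ℝ => (p.1.1, p.1.2, p.2))).mul
      ((continuous_coulombS l ha).comp continuous_snd)
  refine ((continuousOn_coulombConst l).mul (hG.comp_continuousOn
    (ContinuousOn.prodMk (by fun_prop) continuousOn_one_div_sqrt :
      ContinuousOn (fun x : ℝ => (√x, 1 / √x)) (Ioi 0)))).congr fun x hx => ?_
  simp only [coulombKernel, Function.comp, Pi.mul_apply]
  rw [← intervalIntegral.integral_const_mul]
  refine intervalIntegral.integral_congr fun r _ => ?_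
  simp only [coulombS_eq l hx, mul_assoc]

/-! ### Growth in the energy and integrability of the outer integral -/

/-- A bound for the growth in the energy of the Coulomb wave function and of its derivative. -/
noncomputable def coulombWeight (x : ℝ) : ℝ := √(max 1 x / √x)

theorem coulombWeight_pos {x : ℝ} (hx : 0 < x) : 0 < coulombWeight x := by
  have := Real.sqrt_pos.2 hx
  rw [coulombWeight]
  positivity

theorem continuousOn_coulombWeight : ContinuousOn coulombWeight (Ioi 0) :=
  Real.continuous_sqrt.comp_continuousOn (ContinuousOn.div (by fun_prop) (by fun_prop)
    fun _ hx => (Real.sqrt_pos.2 hx).ne')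

theorem sqrt_mul_max_le {x : ℝ} (hx : 0 < x) : √x * max 1 (√x) ≤ max 1 x := by
  rcases le_total x 1 with h | h
  · have : √x ≤ 1 := Real.sqrt_le_one.2 h
    rw [max_eq_left this, mul_one]
    exact this.trans (le_max_left _ _)
  · have : 1 ≤ √x := Real.one_le_sqrt.2 h
    rw [max_eq_right this, Real.mul_self_sqrt hx.le]
    exact le_max_right _ _

theorem abs_le_mul_coulombWeight {x y C : ℝ} (hx : 0 < x) (hC : 0 ≤ C)
    (h : √x * y ^ 2 ≤ C * max 1 x) : |y| ≤ √C * coulombWeight x := by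
  have := Real.sqrt_pos.2 hx
  rw [coulombWeight, ← Real.sqrt_mul hC]
  refine Real.abs_le_sqrt ?_
  rw [← mul_div_assoc, le_div_iff₀ this]
  linarith

theorem exists_coulombWeight_bound (l : ℕ) : ∃ C r₁ : ℝ, 1 ≤ C ∧ 0 < r₁ ∧ ∀ x : ℝ, 0 < x →
    (∀ r, 0 ≤ r → |coulombS x l r| ≤ C * coulombWeight x) ∧
    (∀ r, r₁ ≤ max 1 (√x) * r → |coulombSDeriv x l r| ≤ C * coulombWeight x) := by
  obtain ⟨C, r₁, hC, hr₁, h⟩ := coulombS_bounds l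
  refine ⟨max 1 (√C), r₁, le_max_left _ _, hr₁, fun x hx => ⟨fun r hr => ?_, fun r hr => ?_⟩⟩
  · refine (abs_le_mul_coulombWeight hx hC.le (((h x hx).1 r hr).trans ?_)).trans ?_
    · exact le_mul_of_one_le_right hC.le (le_max_left _ _)
    · exact mul_le_mul_of_nonneg_right (le_max_right _ _) (coulombWeight_pos hx).le
  · refine (abs_le_mul_coulombWeight hx hC.le ?_).trans
      (mul_le_mul_of_nonneg_right (le_max_right _ _) (coulombWeight_pos hx).le)
    calc √x * coulombSDeriv x l r ^ 2 ≤ √x * (C * max 1 (√x)) := by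
          gcongr; exact (h x hx).2 r hr
      _ = C * (√x * max 1 (√x)) := by ring
      _ ≤ C * max 1 x := by gcongr; exact sqrt_mul_max_le hx

theorem norm_coulombAmp_le (l : ℕ) {x : ℝ} (hx : 0 < x) :
    ‖coulombAmp l x‖ ≤ coulombWeight x ∧ √x * ‖coulombAmp l x‖ ≤ coulombWeight x := by
  have hk := Real.sqrt_pos.2 hx
  have hpi : 1 ≤ Real.pi := by linarith [Real.pi_gt_three]
  have hn : √x * ‖coulombAmp l x‖ ^ 2 ≤ 1 := by
    rw [← Complex.normSq_eq_norm_sq, normSq_coulombAmp l hx]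
    rw [mul_one_div, div_le_one (by positivity)]
    exact le_mul_of_one_le_left hk.le hpi
  constructor
  · have := abs_le_mul_coulombWeight (y := ‖coulombAmp l x‖) hx zero_le_one
      (by rw [one_mul]; exact hn.trans (le_max_left _ _))
    simpa using this
  · have := abs_le_mul_coulombWeight (y := √x * ‖coulombAmp l x‖) hx zero_le_one (by
      rw [one_mul]
      calc √x * (√x * ‖coulombAmp l x‖) ^ 2 = √x ^ 2 * (√x * ‖coulombAmp l x‖ ^ 2) := by ring
        _ ≤ √x ^ 2 * 1 := by gcongr
        _ ≤ max 1 x := by rw [Real.sq_sqrt hx.le, mul_one]; exact le_max_right _ _)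
    rw [abs_of_nonneg (by positivity)] at this
    simpa using this

theorem exists_abs_coulombKernel_le (l : ℕ) {a : ℝ} (ha : 0 < a) : ∃ K, 0 < K ∧
    ∀ R x, 0 ≤ R → 0 < x → |coulombKernel l a R x| ≤ K * R * coulombWeight x := by
  obtain ⟨C, r₁, hC, -, h⟩ := exists_coulombWeight_bound l
  have hw := coulombWeight_pos ha
  refine ⟨C * C * coulombWeight a, by positivity, fun R x hR hx => ?_⟩
  have hwx := coulombWeight_pos hx
  have := intervalIntegral.norm_integral_le_of_norm_le_const (a := 0) (b := R)
    (f := fun r => coulombS x l r * coulombS a l r)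
    (C := (C * coulombWeight x) * (C * coulombWeight a)) (fun r hr => by
      rw [uIoc_of_le hR] at hr
      rw [norm_mul]
      exact mul_le_mul ((h x hx).1 r hr.1.le) ((h a ha).1 r hr.1.le) (norm_nonneg _)
        (by positivity))
  rw [sub_zero, abs_of_nonneg hR] at this
  calc _ ≤ _ := this
    _ = _ := by ring

/-- For bounded x the trivial estimate suffices. For large x, dividing the Wronskian by x - a gains
the factor 1/x that makes the outer integral converge. -/
theorem exists_abs_coulombKernel_le_div (l : ℕ) {a R : ℝ} (ha : 0 < a) (hR : 0 < R) : ∃ K,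
    ∀ x, 0 < x → |coulombKernel l a R x| ≤ K * (coulombWeight x / max 1 x) := by
  obtain ⟨K, hK, h⟩ := exists_abs_coulombKernel_le l ha
  obtain ⟨C, r₁, hC, hr₁, hb⟩ := exists_coulombWeight_bound l
  set M := |coulombS a l R| + |coulombSDeriv a l R| with hM
  have hM0 : 0 ≤ M := by positivity
  -- Beyond 2a one has x - a ≥ x/2; beyond (r₁/R)² the bound on the derivative applies at radius R.
  set X := max (max 1 (2 * a)) ((r₁ / R) ^ 2) with hX
  have hX1 : 1 ≤ X := (le_max_left _ _).trans (le_max_left _ _)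
  refine ⟨K * R * X + 2 * C * M, fun x hx => ?_⟩
  have hw := coulombWeight_pos hx
  have hm : 0 < max 1 x := by positivity
  rcases le_total x X with hxX | hxX
  · have hmX : max 1 x ≤ X := max_le hX1 hxX
    calc |coulombKernel l a R x| ≤ K * R * coulombWeight x := h R x hR.le hx
      _ = K * R * max 1 x * (coulombWeight x / max 1 x) := by field_simp
      _ ≤ (K * R * X + 2 * C * M) * (coulombWeight x / max 1 x) := by
          gcongr
          have : K * R * max 1 x ≤ K * R * X := by gcongr
          have : 0 ≤ 2 * C * M := by positivity
          linarith
  · have h1x : 1 ≤ x := hX1.trans hxX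
    have h2 : 2 * a ≤ x := ((le_max_right _ _).trans (le_max_left _ _)).trans hxX
    have h3 : (r₁ / R) ^ 2 ≤ x := (le_max_right _ _).trans hxX
    have h4 : r₁ ≤ max 1 (√x) * R := by
      have : r₁ / R ≤ √x := Real.le_sqrt_of_sq_le h3
      rw [div_le_iff₀ hR] at this
      exact this.trans (mul_le_mul_of_nonneg_right (le_max_right _ _) hR.le)
    have h5 := sub_mul_coulombKernel l ha hx hR.le
    have h6 : |coulombWronskian l a R x| ≤ C * coulombWeight x * M := by
      rw [coulombWronskian]
      refine (abs_sub _ _).trans ?_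
      rw [abs_mul, abs_mul]
      calc _ ≤ C * coulombWeight x * |coulombSDeriv a l R| +
            C * coulombWeight x * |coulombS a l R| := by
            gcongr
            · exact (hb x hx).1 R hR.le
            · exact (hb x hx).2 R h4
        _ = _ := by rw [hM]; ring
    have h7 : x / 2 * |coulombKernel l a R x| ≤ C * coulombWeight x * M := by
      rw [← h5, abs_mul] at h6
      refine le_trans ?_ h6
      gcongr
      rw [abs_of_nonneg (by linarith)]
      linarith
    rw [max_eq_right h1x]
    have h8 : |coulombKernel l a R x| ≤ 2 * C * M * (coulombWeight x / x) := by
      rw [← mul_div_assoc, le_div_iff₀ hx]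
      linarith
    refine h8.trans ?_
    gcongr
    have : 0 ≤ K * R * X := by positivity
    linarith

theorem coulombWeight_div_max_of_le {x : ℝ} (hx : 0 < x) (h : x ≤ 1) :
    coulombWeight x / max 1 x = x ^ (-(1 / 4) : ℝ) := by
  rw [coulombWeight, max_eq_left h, div_one, Real.sqrt_eq_rpow, Real.sqrt_eq_rpow,
    one_div (x ^ _), ← Real.rpow_neg hx.le, ← Real.rpow_mul hx.le]
  norm_num

theorem coulombWeight_div_max_of_ge {x : ℝ} (h : 1 ≤ x) :
    coulombWeight x / max 1 x = x ^ (-(3 / 4) : ℝ) := by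
  have hx : 0 < x := by linarith
  have e : x / x ^ (1 / 2 : ℝ) = x ^ (1 / 2 : ℝ) := by
    rw [div_eq_iff (by positivity), ← Real.rpow_add hx]; norm_num
  rw [coulombWeight, max_eq_right h, Real.sqrt_eq_rpow, Real.sqrt_eq_rpow, e,
    ← Real.rpow_mul hx.le]
  nth_rewrite 2 [← Real.rpow_one x]
  rw [← Real.rpow_sub hx]
  norm_num

/-- The quotient of `coulombWeight` by max(1, x) is x^{-1/4} up to 1 and x^{-3/4} afterwards, so the
hypotheses on φ say precisely that φ is integrable against the kernel bound. -/
theorem integrableOn_abs_mul_coulombWeight {φ : ℝ → ℝ}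
    (h0 : IntegrableOn (fun x : ℝ => x ^ (-(1 / 4) : ℝ) * |φ x|) (Ioc 0 1))
    (h1 : IntegrableOn (fun x : ℝ => x ^ (-(3 / 4) : ℝ) * |φ x|) (Ioi 1)) :
    IntegrableOn (fun x => coulombWeight x / max 1 x * |φ x|) (Ioi 0) := by
  rw [← Ioc_union_Ioi_eq_Ioi (zero_le_one' ℝ)]
  refine IntegrableOn.union (h0.congr_fun (fun x hx => ?_) measurableSet_Ioc)
    (h1.congr_fun (fun x hx => ?_) measurableSet_Ioi)
  · simp only [coulombWeight_div_max_of_le hx.1 hx.2]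
  · simp only [coulombWeight_div_max_of_ge (le_of_lt hx)]

/-! ### Piecewise continuously differentiable functions -/

theorem countable_inter_Ioi {S : Set ℝ} (hS : ∀ c d : ℝ, 0 < c → (S ∩ Icc c d).Finite) :
    (S ∩ Ioi 0).Countable := by
  refine (countable_iUnion fun n : ℕ => (hS (1 / (n + 1)) n (by positivity)).countable).mono ?_
  rintro x ⟨hxS, hx⟩
  obtain ⟨n, hn⟩ := exists_nat_ge (max x (1 / x))
  have hx0 : 0 < x := hx
  refine mem_iUnion.2 ⟨n, hxS, ?_, (le_max_left _ _).trans hn⟩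
  rw [div_le_iff₀ (by positivity)]
  have := (le_max_right x (1 / x)).trans hn
  rw [div_le_iff₀ hx0] at this
  nlinarith

theorem PiecewiseC1OnPos.aestronglyMeasurable {φ : ℝ → ℝ} (hφ : PiecewiseC1OnPos φ) :
    AEStronglyMeasurable φ (volume.restrict (Ioi 0)) := by
  obtain ⟨S, hS, hd, -⟩ := hφ
  have hc := countable_inter_Ioi hS
  have hcont : ContinuousOn φ (Ioi 0 \ (S ∩ Ioi 0)) := fun x hx =>
    (hd x ⟨hx.1, fun h => hx.2 ⟨h, hx.1⟩⟩).1.continuousAt.continuousWithinAt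
  have h := hcont.aestronglyMeasurable (μ := volume) (measurableSet_Ioi.diff hc.measurableSet)
  have e : (Ioi 0 \ (S ∩ Ioi 0) : Set ℝ) =ᵐ[volume] Ioi 0 := sdiff_null_ae_eq_self (hc.measure_zero _)
  rwa [Measure.restrict_congr_set e] at h

theorem eventually_notMem_of_finite {S : Set ℝ} {a : ℝ}
    (hS : ∀ c d : ℝ, 0 < c → (S ∩ Icc c d).Finite) (ha : 0 < a) : ∀ᶠ x in 𝓝[≠] a, x ∉ S := by
  have hf : ((S ∩ Icc (a / 2) (2 * a)) \ {a}).Finite := (hS _ _ (half_pos ha)).subset sdiff_subset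
  have h1 : ∀ᶠ x in 𝓝 a, x ∉ (S ∩ Icc (a / 2) (2 * a)) \ {a} :=
    hf.isClosed.isOpen_compl.mem_nhds fun h => h.2 rfl
  have h2 : ∀ᶠ x in 𝓝 a, x ∈ Icc (a / 2) (2 * a) := Icc_mem_nhds (by linarith) (by linarith)
  filter_upwards [h1.filter_mono nhdsWithin_le_nhds, h2.filter_mono nhdsWithin_le_nhds,
    self_mem_nhdsWithin] with x hx hx2 hxa hxS
  exact hx ⟨⟨hxS, hx2⟩, hxa⟩

theorem abs_sub_le_mul_of_tendsto {f : ℝ → ℝ} {a L M x : ℝ} {s : Set ℝ} {F : Filter ℝ}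
    [F.NeBot] (hF : F ≤ 𝓝 a) (hs : Convex ℝ s) (hsF : s ∈ F)
    (hd : ∀ y ∈ s, DifferentiableAt ℝ f y) (hM : ∀ y ∈ s, ‖deriv f y‖ ≤ M)
    (hL : Tendsto f F (𝓝 L)) (hx : x ∈ s) : |f x - L| ≤ M * |x - a| := by
  have h1 : Tendsto (fun y => |f x - f y|) F (𝓝 |f x - L|) := (tendsto_const_nhds.sub hL).abs
  have h2 : Tendsto (fun y => M * |x - y|) F (𝓝 (M * |x - a|)) :=
    ((tendsto_const_nhds.sub (tendsto_id.mono_right hF)).abs).const_mul M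
  refine le_of_tendsto_of_tendsto h1 h2 ?_
  filter_upwards [hsF] with y hy
  exact hs.norm_image_sub_le_of_norm_deriv_le hd hM hy hx

theorem eventually_norm_le_of_tendsto {f : ℝ → ℝ} {L : ℝ} {F : Filter ℝ} (h : Tendsto f F (𝓝 L)) :
    ∀ᶠ x in F, ‖f x‖ ≤ |L| + 1 :=
  (h.norm.eventually (gt_mem_nhds (lt_add_one |L|))).mono fun _ hx => le_of_lt hx

/-- Next to a there are no break points, and φ' is bounded because it has a one-sided limit. The
mean value inequality then passes to the limit at a, so the difference quotient at the one-sided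
value L stays bounded. -/
theorem PiecewiseC1OnPos.exists_lipschitz_right {φ : ℝ → ℝ} (hφ : PiecewiseC1OnPos φ) {a L : ℝ}
    (ha : 0 < a) (hL : Tendsto φ (𝓝[>] a) (𝓝 L)) :
    ∃ M ε, 0 ≤ M ∧ 0 < ε ∧ ∀ x ∈ Ioo a (a + ε), |φ x - L| ≤ M * |x - a| := by
  obtain ⟨S, hS, hd, hlim⟩ := hφ
  obtain ⟨D, hD⟩ := (hlim a ha).2.2.2
  have h1 := (eventually_notMem_of_finite hS ha).filter_mono (nhdsWithin_mono a fun x hx => ne_of_gt hx : 𝓝[>] a ≤ _)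
  obtain ⟨u, hu, hu'⟩ := mem_nhdsGT_iff_exists_Ioo_subset.1 (h1.and (eventually_norm_le_of_tendsto hD))
  refine ⟨|D| + 1, u - a, by positivity, sub_pos.2 hu, fun x hx => ?_⟩
  rw [add_sub_cancel] at hx
  exact abs_sub_le_mul_of_tendsto (s := Ioo a u) nhdsWithin_le_nhds (convex_Ioo _ _)
    (Ioo_mem_nhdsGT hu) (fun y hy => (hd y ⟨ha.trans hy.1, (hu' hy).1⟩).1) (fun y hy => (hu' hy).2)
    hL hx

theorem PiecewiseC1OnPos.exists_lipschitz_left {φ : ℝ → ℝ} (hφ : PiecewiseC1OnPos φ) {a L : ℝ}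
    (ha : 0 < a) (hL : Tendsto φ (𝓝[<] a) (𝓝 L)) :
    ∃ M ε, 0 ≤ M ∧ 0 < ε ∧ ∀ x ∈ Ioo (a - ε) a, |φ x - L| ≤ M * |x - a| := by
  obtain ⟨S, hS, hd, hlim⟩ := hφ
  obtain ⟨D, hD⟩ := (hlim a ha).2.2.1
  have h1 := (eventually_notMem_of_finite hS ha).filter_mono (nhdsWithin_mono a fun x hx => ne_of_lt hx : 𝓝[<] a ≤ _)
  have h2 : ∀ᶠ x in 𝓝[<] a, 0 < x := (lt_mem_nhds ha).filter_mono nhdsWithin_le_nhds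
  obtain ⟨u, hu, hu'⟩ := mem_nhdsLT_iff_exists_Ioo_subset.1
    ((h1.and (eventually_norm_le_of_tendsto hD)).and h2)
  refine ⟨|D| + 1, a - u, by positivity, sub_pos.2 hu, fun x hx => ?_⟩
  rw [sub_sub_cancel] at hx
  exact abs_sub_le_mul_of_tendsto (s := Ioo u a) nhdsWithin_le_nhds (convex_Ioo _ _)
    (Ioo_mem_nhdsLT hu) (fun y hy => (hd y ⟨(hu' hy).2, (hu' hy).1.1⟩).1)
    (fun y hy => (hu' hy).1.2) hL hx

/-! ### The Wronskian against an integrable function -/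

theorem integrableOn_mul_coulombKernel (l : ℕ) {a R : ℝ} (ha : 0 < a) (hR : 0 < R) {φ : ℝ → ℝ}
    (hm : AEStronglyMeasurable φ (volume.restrict (Ioi 0)))
    (hφ : IntegrableOn (fun x => coulombWeight x / max 1 x * |φ x|) (Ioi 0)) :
    IntegrableOn (fun x => φ x * coulombKernel l a R x) (Ioi 0) := by
  obtain ⟨K, hK⟩ := exists_abs_coulombKernel_le_div l ha hR
  refine (hφ.const_mul K).mono' (hm.mul
    ((continuousOn_coulombKernel l ha R).aestronglyMeasurable measurableSet_Ioi)) ?_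
  filter_upwards [self_mem_ae_restrict measurableSet_Ioi] with x hx
  rw [norm_mul, Real.norm_eq_abs, Real.norm_eq_abs, mul_comm]
  calc _ ≤ K * (coulombWeight x / max 1 x) * |φ x| :=
        mul_le_mul_of_nonneg_right (hK x hx) (abs_nonneg _)
    _ = _ := by ring

theorem im_integral {f : ℝ → ℂ} {μ : Measure ℝ} (hf : Integrable f μ) :
    ∫ x, (f x).im ∂μ = (∫ x, f x ∂μ).im := integral_im hf

theorem re_integral {f : ℝ → ℂ} {μ : Measure ℝ} (hf : Integrable f μ) :
    ∫ x, (f x).re ∂μ = (∫ x, f x ∂μ).re := integral_re hf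

theorem continuousOn_coulombAmp (l : ℕ) : ContinuousOn (coulombAmp l) (Ioi 0) := fun _ hx =>
  (differentiableAt_coulombAmp l hx).continuousAt.continuousWithinAt

/-- Dominated convergence replaces f by its asymptotic profile p. Pointwise asymptotics in x are
enough, since the uniform bounds dominate. -/
theorem tendsto_integral_mul_of_asymptotic {g : ℝ → ℝ}
    (hm : AEStronglyMeasurable g (volume.restrict (Ioi 0)))
    (hg : IntegrableOn (fun x => |g x| * coulombWeight x) (Ioi 0)) {f p : ℝ → ℝ → ℝ} {C R₀ : ℝ}
    (hfc : ∀ R, ContinuousOn (f R) (Ioi 0)) (hpc : ∀ R, ContinuousOn (p R) (Ioi 0))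
    (hf : ∀ R x, R₀ ≤ R → 0 < x → |f R x| ≤ C * coulombWeight x)
    (hp : ∀ R x, 0 < x → |p R x| ≤ coulombWeight x)
    (hfp : ∀ x, 0 < x → Tendsto (fun R => f R x - p R x) atTop (𝓝 0))
    (hlim : Tendsto (fun R => ∫ x in Ioi (0 : ℝ), g x * p R x) atTop (𝓝 0)) :
    Tendsto (fun R => ∫ x in Ioi (0 : ℝ), g x * f R x) atTop (𝓝 0) := by
  have hfm R := hm.mul ((hfc R).aestronglyMeasurable (μ := volume) measurableSet_Ioi)
  have hpm R := hm.mul ((hpc R).aestronglyMeasurable (μ := volume) measurableSet_Ioi)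
  have hfi : ∀ R, R₀ ≤ R → IntegrableOn (fun x => g x * f R x) (Ioi 0) := fun R hR => by
    refine (hg.const_mul C).mono' (hfm R) ?_
    filter_upwards [self_mem_ae_restrict measurableSet_Ioi] with x hx
    rw [norm_mul, Real.norm_eq_abs, Real.norm_eq_abs]
    calc _ ≤ |g x| * (C * coulombWeight x) :=
          mul_le_mul_of_nonneg_left (hf R x hR hx) (abs_nonneg _)
      _ = _ := by ring
  have hpi : ∀ R, IntegrableOn (fun x => g x * p R x) (Ioi 0) := fun R => by
    refine hg.mono' (hpm R) ?_
    filter_upwards [self_mem_ae_restrict measurableSet_Ioi] with x hx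
    rw [norm_mul, Real.norm_eq_abs, Real.norm_eq_abs]
    exact mul_le_mul_of_nonneg_left (hp R x hx) (abs_nonneg _)
  have h1 : Tendsto (fun R => ∫ x in Ioi (0 : ℝ), g x * f R x - g x * p R x) atTop
      (𝓝 (∫ x in Ioi (0 : ℝ), (0 : ℝ))) := by
    refine tendsto_integral_filter_of_dominated_convergence
      (fun x => (C + 1) * (|g x| * coulombWeight x)) ?_ ?_ (hg.const_mul _) ?_
    · exact Eventually.of_forall fun R => (hfm R).sub (hpm R)
    · filter_upwards [eventually_ge_atTop R₀] with R hR
      filter_upwards [self_mem_ae_restrict measurableSet_Ioi] with x hx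
      rw [← mul_sub, norm_mul, Real.norm_eq_abs, Real.norm_eq_abs]
      calc |g x| * |f R x - p R x| ≤ |g x| * (C * coulombWeight x + coulombWeight x) := by
            gcongr
            exact (abs_sub _ _).trans (add_le_add (hf R x hR hx) (hp R x hx))
        _ = _ := by ring
    · filter_upwards [self_mem_ae_restrict measurableSet_Ioi] with x hx
      simpa [mul_sub] using (hfp x hx).const_mul (g x)
  rw [integral_zero] at h1
  have h2 := h1.add hlim
  rw [zero_add] at h2
  refine h2.congr' ?_
  filter_upwards [eventually_ge_atTop R₀] with R hR
  rw [integral_sub (hfi R hR) (hpi R)]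
  ring

theorem integrableOn_ofReal_mul_of_norm_le {g : ℝ → ℝ} {b : ℝ → ℂ}
    (hm : AEStronglyMeasurable g (volume.restrict (Ioi 0)))
    (hg : IntegrableOn (fun x => |g x| * coulombWeight x) (Ioi 0))
    (hbc : ContinuousOn b (Ioi 0)) (hb : ∀ x, 0 < x → ‖b x‖ ≤ coulombWeight x) :
    IntegrableOn (fun x => (g x : ℂ) * b x) (Ioi 0) := by
  refine hg.mono' ((Complex.continuous_ofReal.comp_aestronglyMeasurable hm).mul
    (hbc.aestronglyMeasurable measurableSet_Ioi)) ?_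
  filter_upwards [self_mem_ae_restrict measurableSet_Ioi] with x hx
  rw [norm_mul, Complex.norm_real, Real.norm_eq_abs]
  exact mul_le_mul_of_nonneg_left (hb x hx) (abs_nonneg _)

theorem tendsto_of_abs_le_div {u : ℝ → ℝ} {C r₀ : ℝ} (h : ∀ r, r₀ ≤ r → |u r| ≤ C / r) :
    Tendsto u atTop (𝓝 0) :=
  squeeze_zero_norm' ((eventually_ge_atTop r₀).mono h) (tendsto_const_nhds.div_atTop tendsto_id)

theorem continuousOn_exp_coulombPhase (R : ℝ) :
    ContinuousOn (fun x => Complex.exp (Complex.I * coulombPhase R x)) (Ioi 0) :=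
  Complex.continuous_exp.comp_continuousOn (continuousOn_const.mul
    (Complex.continuous_ofReal.comp_continuousOn (continuousOn_coulombPhase R)))

/-- The amplitude is absorbed into the integrable factor, after which the profile integral is the
imaginary part of a Riemann-Lebesgue integral. -/
theorem tendsto_integral_mul_coulombS (l : ℕ) {g : ℝ → ℝ}
    (hm : AEStronglyMeasurable g (volume.restrict (Ioi 0)))
    (hg : IntegrableOn (fun x => |g x| * coulombWeight x) (Ioi 0)) :
    Tendsto (fun R => ∫ x in Ioi (0 : ℝ), g x * coulombS x l R) atTop (𝓝 0) := by
  obtain ⟨C, r₁, hC, hr₁, hb⟩ := exists_coulombWeight_bound l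
  have hint := integrableOn_ofReal_mul_of_norm_le hm hg (continuousOn_coulombAmp l)
    fun x hx => (norm_coulombAmp_le l hx).1
  refine tendsto_integral_mul_of_asymptotic hm hg (C := C) (R₀ := 0)
    (p := fun R x => (coulombAmp l x * Complex.exp (Complex.I * coulombPhase R x)).im)
    (continuousOn_coulombS l) (fun R => Complex.continuous_im.comp_continuousOn
      ((continuousOn_coulombAmp l).mul (continuousOn_exp_coulombPhase R)))
    (fun R x hR hx => (hb x hx).1 R hR) (fun R x hx => ?_) (fun x hx => ?_) ?_
  · refine (Complex.abs_im_le_norm _).trans ?_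
    rw [norm_mul, norm_exp_I_mul_ofReal, mul_one]
    exact (norm_coulombAmp_le l hx).1
  · obtain ⟨C, r₀, -, -, h⟩ := coulombS_asymptotic l (d := x) hx
    exact tendsto_of_abs_le_div fun r hr => (h x ⟨le_rfl, le_rfl⟩ r hr).1
  · have h := (Complex.continuous_im.tendsto _).comp (tendsto_integral_exp_coulombPhase hint)
    rw [Complex.zero_im] at h
    refine h.congr fun R => ?_
    rw [Function.comp, ← im_integral (integrableOn_mul_exp_coulombPhase hint R)]
    refine integral_congr_ae (Eventually.of_forall fun x => ?_)
    simp only [mul_assoc, Complex.im_ofReal_mul]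

theorem tendsto_integral_mul_coulombSDeriv (l : ℕ) {g : ℝ → ℝ}
    (hm : AEStronglyMeasurable g (volume.restrict (Ioi 0)))
    (hg : IntegrableOn (fun x => |g x| * coulombWeight x) (Ioi 0)) :
    Tendsto (fun R => ∫ x in Ioi (0 : ℝ), g x * coulombSDeriv x l R) atTop (𝓝 0) := by
  obtain ⟨C, r₁, hC, hr₁, hb⟩ := exists_coulombWeight_bound l
  have hac : ContinuousOn (fun x => (√x : ℂ) * coulombAmp l x) (Ioi 0) :=
    ContinuousOn.mul (by fun_prop) (continuousOn_coulombAmp l)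
  have han : ∀ x, 0 < x → ‖(√x : ℂ) * coulombAmp l x‖ ≤ coulombWeight x := fun x hx => by
    rw [norm_mul, Complex.norm_real, Real.norm_of_nonneg (Real.sqrt_nonneg x)]
    exact (norm_coulombAmp_le l hx).2
  have hint := integrableOn_ofReal_mul_of_norm_le hm hg hac han
  refine tendsto_integral_mul_of_asymptotic hm hg (C := C) (R₀ := r₁)
    (p := fun R x => ((√x : ℂ) * coulombAmp l x *
      Complex.exp (Complex.I * coulombPhase R x)).re)
    (continuousOn_coulombSDeriv l) (fun R => Complex.continuous_re.comp_continuousOn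
      (hac.mul (continuousOn_exp_coulombPhase R)))
    (fun R x hR hx => (hb x hx).2 R (hR.trans ?_)) (fun R x hx => ?_) (fun x hx => ?_) ?_
  · exact le_mul_of_one_le_left (hr₁.le.trans hR) (le_max_left _ _)
  · refine (Complex.abs_re_le_norm _).trans ?_
    rw [norm_mul, norm_exp_I_mul_ofReal, mul_one]
    exact han x hx
  · obtain ⟨C, r₀, -, -, h⟩ := coulombS_asymptotic l (d := x) hx
    refine tendsto_of_abs_le_div (C := C) (r₀ := r₀) fun r hr => ?_
    have := (h x ⟨le_rfl, le_rfl⟩ r hr).2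
    rwa [← Complex.re_ofReal_mul, ← mul_assoc] at this
  · have h := (Complex.continuous_re.tendsto _).comp (tendsto_integral_exp_coulombPhase hint)
    rw [Complex.zero_re] at h
    refine h.congr fun R => ?_
    rw [Function.comp, ← re_integral (integrableOn_mul_exp_coulombPhase hint R)]
    refine integral_congr_ae (Eventually.of_forall fun x => ?_)
    simp only [mul_assoc, Complex.re_ofReal_mul]

theorem integrableOn_mul_coulombS (l : ℕ) {g : ℝ → ℝ}
    (hm : AEStronglyMeasurable g (volume.restrict (Ioi 0)))
    (hg : IntegrableOn (fun x => |g x| * coulombWeight x) (Ioi 0)) : ∃ R₀, 0 < R₀ ∧ ∀ R, R₀ ≤ R →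
    IntegrableOn (fun x => g x * coulombS x l R) (Ioi 0) ∧
    IntegrableOn (fun x => g x * coulombSDeriv x l R) (Ioi 0) := by
  obtain ⟨C, r₁, hC, hr₁, hb⟩ := exists_coulombWeight_bound l
  refine ⟨r₁, hr₁, fun R hR => ⟨?_, ?_⟩⟩
  · refine (hg.const_mul C).mono' (hm.mul
      ((continuousOn_coulombS l R).aestronglyMeasurable measurableSet_Ioi)) ?_
    filter_upwards [self_mem_ae_restrict measurableSet_Ioi] with x hx
    rw [norm_mul, Real.norm_eq_abs, Real.norm_eq_abs, mul_left_comm]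
    exact mul_le_mul_of_nonneg_left ((hb x hx).1 R (hr₁.le.trans hR)) (abs_nonneg _)
  · refine (hg.const_mul C).mono' (hm.mul
      ((continuousOn_coulombSDeriv l R).aestronglyMeasurable measurableSet_Ioi)) ?_
    filter_upwards [self_mem_ae_restrict measurableSet_Ioi] with x hx
    rw [norm_mul, Real.norm_eq_abs, Real.norm_eq_abs, mul_left_comm]
    exact mul_le_mul_of_nonneg_left ((hb x hx).2 R (hR.trans
      (le_mul_of_one_le_left (hr₁.le.trans hR) (le_max_left _ _)))) (abs_nonneg _)

/-- The Wronskian is linear in the values at R of s(x,l;·) and its derivative, with coefficients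
depending only on a and bounded for large R. -/
theorem tendsto_integral_mul_coulombWronskian (l : ℕ) {a : ℝ} (ha : 0 < a) {g : ℝ → ℝ}
    (hm : AEStronglyMeasurable g (volume.restrict (Ioi 0)))
    (hg : IntegrableOn (fun x => |g x| * coulombWeight x) (Ioi 0)) :
    Tendsto (fun R => ∫ x in Ioi (0 : ℝ), g x * coulombWronskian l a R x) atTop (𝓝 0) := by
  obtain ⟨C, r₁, hC, hr₁, hb⟩ := exists_coulombWeight_bound l
  obtain ⟨R₀, hR₀, hint⟩ := integrableOn_mul_coulombS l hm hg
  have hbd : ∀ {f : ℝ → ℝ} {B : ℝ}, (∀ R, r₁ ≤ R → |f R| ≤ B) →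
      IsBoundedUnder (· ≤ ·) atTop (norm ∘ f) := fun {f B} h =>
    isBoundedUnder_of_eventually_le (a := B) ((eventually_ge_atTop r₁).mono h)
  have h1 := (tendsto_integral_mul_coulombS l hm hg).zero_mul_isBoundedUnder_le
    (hbd (f := coulombSDeriv a l) fun R hR => (hb a ha).2 R (hR.trans
      (le_mul_of_one_le_left (hr₁.le.trans hR) (le_max_left _ _))))
  have h2 := (tendsto_integral_mul_coulombSDeriv l hm hg).zero_mul_isBoundedUnder_le
    (hbd (f := coulombS a l) fun R hR => (hb a ha).1 R (hr₁.le.trans hR))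
  have h3 := h1.sub h2
  rw [sub_zero] at h3
  refine h3.congr' ?_
  filter_upwards [eventually_ge_atTop R₀] with R hR
  rw [← integral_mul_const, ← integral_mul_const,
    ← integral_sub ((hint R hR).1.mul_const _) ((hint R hR).2.mul_const _)]
  refine integral_congr_ae (Eventually.of_forall fun x => ?_)
  simp only [coulombWronskian]
  ring

/-! ### The kernel near x = a -/

/-- The leading part, for large `R`, of the truncated inner product `coulombKernel l a R x` when
`x` is near `a`. -/
noncomputable def coulombLocalKernel (l : ℕ) (a R x : ℝ) : ℝ :=
  √a * Complex.normSq (coulombAmp l a) *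
      dslope (fun x => Real.sin (coulombPhase R x - coulombPhase R a)) a x +
    √a * (starRingEnd ℂ (coulombAmp l a * Complex.exp (Complex.I * coulombPhase R a)) *
      (dslope (coulombAmp l) a x * Complex.exp (Complex.I * coulombPhase R x))).im -
    (coulombAmp l a * Complex.exp (Complex.I * coulombPhase R a)).im *
      (coulombAmp l x / (√x + √a : ℝ) * Complex.exp (Complex.I * coulombPhase R x)).re

theorem exp_I_mul_ofReal_eq (t : ℝ) :
    Complex.exp (Complex.I * t) = ⟨Real.cos t, Real.sin t⟩ := by
  rw [mul_comm]
  exact Complex.ext (Complex.exp_ofReal_mul_I_re t) (Complex.exp_ofReal_mul_I_im t)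

/-- The three terms of the local kernel come from the Wronskian of the leading profiles by writing
b(x) = b(a) + (x - a) q(x) and √x - √a = (x - a)/(√x + √a). Only the term with |b(a)|² keeps the
singular quotient of the sine; the others have continuous coefficients. -/
theorem sub_mul_coulombLocalKernel (l : ℕ) {a x : ℝ} (ha : 0 < a) (hx : 0 < x) (hxa : x ≠ a)
    (R : ℝ) : (x - a) * coulombLocalKernel l a R x =
      (coulombAmp l x * Complex.exp (Complex.I * coulombPhase R x)).im *
        (√a * (coulombAmp l a * Complex.exp (Complex.I * coulombPhase R a)).re) -
      √x * (coulombAmp l x * Complex.exp (Complex.I * coulombPhase R x)).re *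
        (coulombAmp l a * Complex.exp (Complex.I * coulombPhase R a)).im := by
  have hk := Real.sqrt_pos.2 hx
  have hκ := Real.sqrt_pos.2 ha
  have hy : x - a ≠ 0 := sub_ne_zero.2 hxa
  have hs : √x + √a ≠ 0 := by positivity
  have hxy : x - a = (√x - √a) * (√x + √a) := by
    nth_rewrite 1 [← Real.sq_sqrt hx.le, ← Real.sq_sqrt ha.le]; ring
  rw [coulombLocalKernel, dslope_of_ne _ hxa, dslope_of_ne _ hxa, slope, slope, vsub_eq_sub,
    vsub_eq_sub, sub_self, Real.sin_zero, sub_zero, Real.sin_sub,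
    exp_I_mul_ofReal_eq, exp_I_mul_ofReal_eq]
  have e1 : ∀ z : ℂ, (coulombAmp l x / (√x + √a : ℝ) * z).re
      = (√x + √a)⁻¹ * (coulombAmp l x * z).re := fun z => by
    rw [← Complex.re_ofReal_mul, Complex.ofReal_inv]; congr 1; ring
  have e2 : ∀ z w : ℂ, (w * ((x - a)⁻¹ • (coulombAmp l x - coulombAmp l a) * z)).im
      = (x - a)⁻¹ * (w * ((coulombAmp l x - coulombAmp l a) * z)).im := fun z w => by
    rw [← Complex.im_ofReal_mul, Complex.real_smul]; congr 1; ring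
  rw [e1, e2, smul_eq_mul]
  have h1 : (x - a) * (√x + √a)⁻¹ = √x - √a := by rw [hxy]; field_simp
  have h2 : ∀ A B C D E : ℝ, (x - a) * (√a * A * ((x - a)⁻¹ * B) + √a * ((x - a)⁻¹ * C) -
      D * ((√x + √a)⁻¹ * E)) = √a * (A * B + C) - D * (√x - √a) * E := fun A B C D E => by
    rw [← h1]; field_simp
  rw [h2]
  simp only [Complex.normSq_apply, Complex.mul_re, Complex.mul_im, Complex.conj_re,
    Complex.conj_im, Complex.sub_re, Complex.sub_im]
  ring

theorem continuousOn_dslope_of_pos {E : Type*} [NormedAddCommGroup E] [NormedSpace ℝ E]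
    {f : ℝ → E} {a : ℝ} (ha : 0 < a) (hf : ∀ x, 0 < x → DifferentiableAt ℝ f x) :
    ContinuousOn (dslope f a) (Ioi 0) :=
  (continuousOn_dslope (Ioi_mem_nhds ha)).2
    ⟨fun x hx => (hf x hx).continuousAt.continuousWithinAt, hf a ha⟩

theorem continuousOn_dslope_sin_coulombPhase {a : ℝ} (ha : 0 < a) (R : ℝ) :
    ContinuousOn (dslope (fun x => Real.sin (coulombPhase R x - coulombPhase R a)) a) (Ioi 0) :=
  continuousOn_dslope_of_pos ha fun _ hx =>
    ((hasDerivAt_coulombPhase R hx).sub_const _).sin.differentiableAt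

theorem continuousOn_dslope_coulombAmp (l : ℕ) {a : ℝ} (ha : 0 < a) :
    ContinuousOn (dslope (coulombAmp l) a) (Ioi 0) :=
  continuousOn_dslope_of_pos ha fun _ hx => differentiableAt_coulombAmp l hx

theorem continuousOn_coulombAmp_div (l : ℕ) (a : ℝ) :
    ContinuousOn (fun x => coulombAmp l x / (√x + √a : ℝ)) (Ioi 0) :=
  (continuousOn_coulombAmp l).div (by fun_prop) fun x hx => by
    have := Real.sqrt_pos.2 (show 0 < x from hx)
    exact Complex.ofReal_ne_zero.2 (by positivity)

theorem continuousOn_coulombLocalKernel (l : ℕ) {a : ℝ} (ha : 0 < a) (R : ℝ) :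
    ContinuousOn (coulombLocalKernel l a R) (Ioi 0) := by
  refine ((continuousOn_const.mul (continuousOn_dslope_sin_coulombPhase ha R)).add
    (continuousOn_const.mul (Complex.continuous_im.comp_continuousOn (continuousOn_const.mul
      ((continuousOn_dslope_coulombAmp l ha).mul (continuousOn_exp_coulombPhase R)))))).sub
    (continuousOn_const.mul (Complex.continuous_re.comp_continuousOn
      ((continuousOn_coulombAmp_div l a).mul (continuousOn_exp_coulombPhase R))))

theorem abs_sqrt_sub_sqrt_le {a x : ℝ} (ha : 0 < a) (hx : 0 ≤ x) :
    |√x - √a| ≤ |x - a| / √a := by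
  have hκ := Real.sqrt_pos.2 ha
  have hk := Real.sqrt_nonneg x
  have hxy : x - a = (√x - √a) * (√x + √a) := by
    nth_rewrite 1 [← Real.sq_sqrt hx, ← Real.sq_sqrt ha.le]; ring
  rw [le_div_iff₀ hκ]
  rw [hxy]
  rw [abs_mul, abs_of_nonneg (show 0 ≤ √x + √a by positivity)]
  gcongr
  linarith

/-- A crude bound, of use where |x - a| is small compared with 1/R. The growth R comes from |Φ_R(x)
- Φ_R(a)| ≤ R |x - a|/√a. -/
theorem exists_abs_coulombLocalKernel_le (l : ℕ) {a b : ℝ} (ha : 0 < a) (hb : 0 < b) :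
    ∃ C, 0 ≤ C ∧ ∀ᶠ R in atTop, ∀ x ∈ uIcc a b, x ≠ a → |coulombLocalKernel l a R x| ≤ C * R := by
  have hsub : uIcc a b ⊆ Ioi 0 := fun x hx => pos_of_mem_uIcc ha hb hx
  obtain ⟨B₁, hB₁⟩ := isCompact_uIcc.exists_bound_of_continuousOn
    ((continuousOn_dslope_coulombAmp l ha).mono hsub)
  obtain ⟨B₂, hB₂⟩ := isCompact_uIcc.exists_bound_of_continuousOn
    ((continuousOn_coulombAmp_div l a).mono hsub)
  have hB₁0 : 0 ≤ B₁ := (norm_nonneg _).trans (hB₁ a left_mem_uIcc)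
  have hB₂0 : 0 ≤ B₂ := (norm_nonneg _).trans (hB₂ a left_mem_uIcc)
  have hκ := Real.sqrt_pos.2 ha
  set β := coulombAmp l a
  refine ⟨Complex.normSq β + √a * (‖β‖ * B₁) + ‖β‖ * B₂, ?_, ?_⟩
  · have := Complex.normSq_nonneg β
    positivity
  filter_upwards [eventually_log_div_le (lt_min ha hb), eventually_ge_atTop 1]
    with R ⟨hR, hlog, hRc⟩ hR1 x hx hxa
  have hx0 : 0 < x := hsub hx
  have hE : ‖β * Complex.exp (Complex.I * coulombPhase R a)‖ = ‖β‖ := by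
    rw [norm_mul, norm_exp_I_mul_ofReal, mul_one]
  have hy : 0 < |x - a| := abs_pos.2 (sub_ne_zero.2 hxa)
  have t1 : |dslope (fun x => Real.sin (coulombPhase R x - coulombPhase R a)) a x| ≤ R / √a := by
    rw [dslope_of_ne _ hxa, slope, vsub_eq_sub, sub_self, Real.sin_zero, sub_zero,
      smul_eq_mul, abs_mul, abs_inv, inv_mul_le_iff₀ hy]
    refine Real.abs_sin_le_abs.trans ?_
    rw [coulombPhase_sub R ha hx0, abs_mul]
    have h1 := half_le_sub_log_div ha hb hx hlog hRc
    have h2 : 0 ≤ Real.log R / (√x * √a) := by positivity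
    calc _ ≤ |x - a| / √a * R := by
          gcongr
          · exact abs_sqrt_sub_sqrt_le ha hx0.le
          · rw [abs_of_nonneg (by linarith)]; linarith
      _ = _ := by ring
  have t2 : |(starRingEnd ℂ (β * Complex.exp (Complex.I * coulombPhase R a)) *
      (dslope (coulombAmp l) a x * Complex.exp (Complex.I * coulombPhase R x))).im|
      ≤ ‖β‖ * B₁ := by
    refine (Complex.abs_im_le_norm _).trans ?_
    rw [norm_mul, RCLike.norm_conj, hE, norm_mul, norm_exp_I_mul_ofReal, mul_one]
    gcongr
    exact hB₁ x hx
  have t3 : |(β * Complex.exp (Complex.I * coulombPhase R a)).im *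
      (coulombAmp l x / (√x + √a : ℝ) * Complex.exp (Complex.I * coulombPhase R x)).re|
      ≤ ‖β‖ * B₂ := by
    rw [abs_mul]
    refine mul_le_mul ((Complex.abs_im_le_norm _).trans hE.le) ?_ (abs_nonneg _) (norm_nonneg _)
    refine (Complex.abs_re_le_norm _).trans ?_
    rw [norm_mul, norm_exp_I_mul_ofReal, mul_one]
    exact hB₂ x hx
  rw [coulombLocalKernel]
  refine (abs_sub _ _).trans ((add_le_add_left (abs_add_le _ _) _).trans ?_)
  have hn := Complex.normSq_nonneg β
  rw [abs_mul, abs_of_nonneg (show 0 ≤ √a * Complex.normSq β by positivity), abs_mul,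
    abs_of_pos hκ]
  calc _ ≤ √a * Complex.normSq β * (R / √a) + √a * (‖β‖ * B₁) + ‖β‖ * B₂ := by gcongr
    _ = Complex.normSq β * R + (√a * (‖β‖ * B₁) + ‖β‖ * B₂) * 1 := by field_simp; ring
    _ ≤ Complex.normSq β * R + (√a * (‖β‖ * B₁) + ‖β‖ * B₂) * R := by gcongr
    _ = _ := by ring

theorem exists_abs_coulombWronskian_sub_le (l : ℕ) {a b : ℝ} (ha : 0 < a) (hb : 0 < b) :
    ∃ C, 0 ≤ C ∧ ∀ᶠ R in atTop, ∀ x ∈ uIcc a b, x ≠ a →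
      |coulombWronskian l a R x - (x - a) * coulombLocalKernel l a R x| ≤ C / R := by
  have hsub : uIcc a b ⊆ Ioi 0 := fun x hx => pos_of_mem_uIcc ha hb hx
  obtain ⟨B, hB⟩ := isCompact_uIcc.exists_bound_of_continuousOn
    (continuousOn_coulombWeight.mono hsub)
  obtain ⟨C, r₁, hC, hr₁, hbd⟩ := exists_coulombWeight_bound l
  obtain ⟨D, r₀, hD, hr₀, has⟩ := coulombS_asymptotic l (d := max a b) (lt_min ha hb)
  have hw : ∀ x ∈ uIcc a b, coulombWeight x ≤ B := fun x hx => (le_abs_self _).trans (hB x hx)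
  have hB0 : 0 ≤ B := (norm_nonneg _).trans (hB a left_mem_uIcc)
  refine ⟨4 * (C * B) * D, by positivity, ?_⟩
  filter_upwards [eventually_ge_atTop r₁, eventually_ge_atTop r₀] with R hR₁ hR₀ x hx hxa
  have hR : 0 < R := hr₁.trans_le hR₁
  have hx0 : 0 < x := hsub hx
  rw [sub_mul_coulombLocalKernel l ha hx0 hxa, coulombWronskian]
  have hCB : ∀ y ∈ uIcc a b, C * coulombWeight y ≤ C * B := fun y hy =>
    mul_le_mul_of_nonneg_left (hw y hy) (by linarith)
  have hBC : B ≤ C * B := le_mul_of_one_le_left hB0 hC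
  have b1 : |coulombSDeriv a l R| ≤ C * B := ((hbd a ha).2 R (hR₁.trans
    (le_mul_of_one_le_left hR.le (le_max_left _ _)))).trans (hCB a left_mem_uIcc)
  have b2 : |coulombS a l R| ≤ C * B := ((hbd a ha).1 R hR.le).trans (hCB a left_mem_uIcc)
  obtain ⟨a1, a2⟩ := has a left_mem_uIcc R hR₀
  obtain ⟨x1, x2⟩ := has x hx R hR₀
  have hn := norm_coulombAmp_le l hx0
  have hE : ‖coulombAmp l x * Complex.exp (Complex.I * coulombPhase R x)‖ = ‖coulombAmp l x‖ := by
    rw [norm_mul, norm_exp_I_mul_ofReal, mul_one]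
  set E := coulombAmp l x * Complex.exp (Complex.I * coulombPhase R x)
  set F := coulombAmp l a * Complex.exp (Complex.I * coulombPhase R a)
  have b3 : |E.im| ≤ C * B :=
    ((Complex.abs_im_le_norm _).trans (hE.le.trans (hn.1.trans (hw x hx)))).trans hBC
  have b4 : |√x * E.re| ≤ C * B := by
    rw [abs_mul, abs_of_nonneg (Real.sqrt_nonneg x)]
    refine (le_trans ?_ (hn.2.trans (hw x hx))).trans hBC
    rw [← hE]
    gcongr
    exact Complex.abs_re_le_norm _
  have hCB0 : 0 ≤ C * B := by positivity
  have hDR : 0 ≤ D / R := by positivity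
  rw [show coulombS x l R * coulombSDeriv a l R - coulombSDeriv x l R * coulombS a l R -
      (E.im * (√a * F.re) - √x * E.re * F.im) =
      (coulombS x l R - E.im) * coulombSDeriv a l R + E.im * (coulombSDeriv a l R - √a * F.re) -
      ((coulombSDeriv x l R - √x * E.re) * coulombS a l R +
        √x * E.re * (coulombS a l R - F.im)) by ring]
  refine (abs_sub _ _).trans ((add_le_add (abs_add_le _ _) (abs_add_le _ _)).trans ?_)
  simp only [abs_mul _ (coulombSDeriv a l R), abs_mul E.im, abs_mul _ (coulombS a l R),
    abs_mul (√x * E.re)]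
  calc _ ≤ D / R * (C * B) + C * B * (D / R) + (D / R * (C * B) + C * B * (D / R)) := by gcongr
    _ = _ := by ring

/-- The powers of x - a and of a - x are added in norm, so that one dominating function serves on
either side of a. -/
theorem exists_intervalIntegrable_ge_one_div_sqrt (a b : ℝ) :
    ∃ f : ℝ → ℝ, IntervalIntegrable f volume a b ∧ ∀ x, x ≠ a → 1 / √|x - a| ≤ f x := by
  have h1 := (intervalIntegral.intervalIntegrable_rpow' (a := a - a) (b := b - a)
    (show -1 < (-(1 / 2) : ℝ) by norm_num)).comp_sub_right a
  have h2 := (intervalIntegral.intervalIntegrable_rpow' (a := a - a) (b := a - b)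
    (show -1 < (-(1 / 2) : ℝ) by norm_num)).comp_sub_left a
  simp only [sub_add_cancel, sub_sub_cancel] at h1 h2
  refine ⟨_, h1.norm.add h2.norm, fun x hx => ?_⟩
  have e : ∀ y : ℝ, 0 < y → 1 / √y ≤ ‖y ^ (-(1 / 2) : ℝ)‖ := fun y hy => by
    rw [Real.norm_of_nonneg (Real.rpow_nonneg hy.le _), Real.rpow_neg hy.le, ← Real.sqrt_eq_rpow,
      one_div]
  rcases lt_or_gt_of_ne hx with h | h
  · rw [abs_of_neg (by linarith), neg_sub]
    exact (e _ (by linarith)).trans (le_add_of_nonneg_left (norm_nonneg _))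
  · rw [abs_of_pos (by linarith)]
    exact (e _ (by linarith)).trans (le_add_of_nonneg_right (norm_nonneg _))

/-- The difference of the kernels is at most C/(R|x - a|) and also at most C'R. Neither bound is
integrable uniformly in R, but their geometric mean is a multiple of |x - a|^{-1/2}, free of R and
integrable. The first bound gives the pointwise limit 0. -/
theorem tendsto_intervalIntegral_coulombKernel_sub_local (l : ℕ) {a b : ℝ} (ha : 0 < a)
    (hb : 0 < b) : Tendsto (fun R => (∫ x in a..b, coulombKernel l a R x) -
      ∫ x in a..b, coulombLocalKernel l a R x) atTop (𝓝 0) := by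
  have hsub : uIcc a b ⊆ Ioi 0 := fun x hx => pos_of_mem_uIcc ha hb hx
  obtain ⟨C₁, hC₁, h₁⟩ := exists_abs_coulombLocalKernel_le l ha hb
  obtain ⟨C₂, hC₂, h₂⟩ := exists_abs_coulombWronskian_sub_le l ha hb
  obtain ⟨K, hK, hker⟩ := exists_abs_coulombKernel_le l ha
  obtain ⟨B, hB⟩ := isCompact_uIcc.exists_bound_of_continuousOn
    (continuousOn_coulombWeight.mono hsub)
  have hB0 : 0 ≤ B := (norm_nonneg _).trans (hB a left_mem_uIcc)
  obtain ⟨f, hf, hfx⟩ := exists_intervalIntegrable_ge_one_div_sqrt a b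
  have hsmall : ∀ᶠ R in atTop, ∀ x ∈ uIcc a b, x ≠ a →
      |coulombKernel l a R x - coulombLocalKernel l a R x| ≤ C₂ / R / |x - a| := by
    filter_upwards [h₂, eventually_gt_atTop 0] with R hR2 hR x hx hxa
    have hy : 0 < |x - a| := abs_pos.2 (sub_ne_zero.2 hxa)
    have := hR2 x hx hxa
    rw [← sub_mul_coulombKernel l ha (hsub hx) hR.le, ← mul_sub, abs_mul] at this
    rw [le_div_iff₀ hy]
    linarith
  have hc : ∀ R, ContinuousOn (fun x => coulombKernel l a R x - coulombLocalKernel l a R x)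
      (uIcc a b) := fun R => ((continuousOn_coulombKernel l ha R).mono hsub).sub
        ((continuousOn_coulombLocalKernel l ha R).mono hsub)
  have hmain : Tendsto (fun R => ∫ x in a..b, (coulombKernel l a R x - coulombLocalKernel l a R x))
      atTop (𝓝 (∫ x in a..b, (0 : ℝ))) := by
    refine intervalIntegral.tendsto_integral_filter_of_dominated_convergence
      (fun x => √((K * B + C₁) * C₂) * f x) ?_ ?_ (hf.const_mul _) ?_
    · exact Eventually.of_forall fun R => ((hc R).mono uIoc_subset_uIcc).aestronglyMeasurable
        measurableSet_uIoc
    · filter_upwards [hsmall, h₁, eventually_gt_atTop 0] with R hRs hR1 hR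
      filter_upwards [(countable_singleton a).ae_notMem volume] with x hxa hx
      have hx' := uIoc_subset_uIcc hx
      have hxa' : x ≠ a := hxa
      have hy : 0 < |x - a| := abs_pos.2 (sub_ne_zero.2 hxa')
      have s1 := hRs x hx' hxa'
      have s2 : |coulombKernel l a R x - coulombLocalKernel l a R x| ≤ (K * B + C₁) * R := by
        refine (abs_sub _ _).trans ((add_le_add (hker R x hR.le (hsub hx'))
          (hR1 x hx' hxa')).trans ?_)
        have : coulombWeight x ≤ B := (le_abs_self _).trans (hB x hx')
        calc _ ≤ K * R * B + C₁ * R := by gcongr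
          _ = _ := by ring
      rw [Real.norm_eq_abs]
      refine le_trans ?_ (mul_le_mul_of_nonneg_left (hfx x hxa') (Real.sqrt_nonneg _))
      rw [mul_one_div, ← Real.sqrt_div (by positivity)]
      refine Real.abs_le_sqrt ?_
      rw [← sq_abs, sq]
      calc _ ≤ (K * B + C₁) * R * (C₂ / R / |x - a|) := by gcongr
        _ = _ := by field_simp
    · filter_upwards [(countable_singleton a).ae_notMem volume] with x hxa hx
      have hx' := uIoc_subset_uIcc hx
      refine squeeze_zero_norm' (hsmall.mono fun R hR => hR x hx' hxa) ?_
      simpa using ((tendsto_const_nhds (x := C₂)).div_atTop tendsto_id).div_const |x - a|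
  rw [intervalIntegral.integral_zero] at hmain
  refine hmain.congr fun R => ?_
  exact intervalIntegral.integral_sub
    ((continuousOn_coulombKernel l ha R).mono hsub).intervalIntegrable
    ((continuousOn_coulombLocalKernel l ha R).mono hsub).intervalIntegrable

/-- Riemann-Lebesgue removes the two terms with continuous coefficients, since their factors
depending on R are bounded. The remaining constant is √a |b(a)|² = 1/π. -/
theorem tendsto_intervalIntegral_coulombLocalKernel_sub (l : ℕ) {a b : ℝ} (ha : 0 < a)
    (hb : 0 < b) : Tendsto (fun R => (∫ x in a..b, coulombLocalKernel l a R x) -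
      1 / Real.pi * ∫ x in a..b, Real.sin (coulombPhase R x - coulombPhase R a) / (x - a))
      atTop (𝓝 0) := by
  have hsub : uIcc a b ⊆ Ioi 0 := fun x hx => pos_of_mem_uIcc ha hb hx
  have hκ := Real.sqrt_pos.2 ha
  set E : ℝ → ℂ := fun R => coulombAmp l a * Complex.exp (Complex.I * coulombPhase R a) with hE
  have hEn : ∀ R, ‖E R‖ = ‖coulombAmp l a‖ := fun R => by
    rw [hE, norm_mul, norm_exp_I_mul_ofReal, mul_one]
  set q : ℝ → ℂ := dslope (coulombAmp l) a with hq
  set p : ℝ → ℂ := fun x => coulombAmp l x / (√x + √a : ℝ) with hp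
  set e : ℝ → ℝ → ℂ := fun R x => Complex.exp (Complex.I * coulombPhase R x) with he
  have hqc : ContinuousOn q (uIcc a b) := (continuousOn_dslope_coulombAmp l ha).mono hsub
  have hpc : ContinuousOn p (uIcc a b) := (continuousOn_coulombAmp_div l a).mono hsub
  have hec : ∀ R, ContinuousOn (e R) (uIcc a b) := fun R =>
    (continuousOn_exp_coulombPhase R).mono hsub
  have hQ := tendsto_intervalIntegral_exp_coulombPhase ha hb hqc.intervalIntegrable
  have hP := tendsto_intervalIntegral_exp_coulombPhase ha hb hpc.intervalIntegrable
  have h1 : Tendsto (fun R => √a * (starRingEnd ℂ (E R) * ∫ x in a..b, q x * e R x).im)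
      atTop (𝓝 0) := by
    refine squeeze_zero_norm (a := fun R => √a * (‖coulombAmp l a‖ *
      ‖∫ x in a..b, q x * e R x‖)) (fun R => ?_) ?_
    · rw [norm_mul, Real.norm_of_nonneg hκ.le]
      gcongr
      refine (Complex.abs_im_le_norm _).trans ?_
      rw [norm_mul, RCLike.norm_conj, hEn]
    · simpa using (hQ.norm.const_mul ‖coulombAmp l a‖).const_mul √a
  have h2 : Tendsto (fun R => (E R).im * (∫ x in a..b, p x * e R x).re) atTop (𝓝 0) := by
    refine squeeze_zero_norm (a := fun R => ‖coulombAmp l a‖ *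
      ‖∫ x in a..b, p x * e R x‖) (fun R => ?_) ?_
    · rw [norm_mul]
      exact mul_le_mul ((Complex.abs_im_le_norm _).trans (hEn R).le) (Complex.abs_re_le_norm _)
        (norm_nonneg _) (norm_nonneg _)
    · simpa using hP.norm.const_mul ‖coulombAmp l a‖
  have h3 := h1.sub h2
  rw [sub_zero] at h3
  refine h3.congr fun R => ?_
  have i1 : IntervalIntegrable (fun x => q x * e R x) volume a b :=
    (hqc.mul (hec R)).intervalIntegrable
  have i2 : IntervalIntegrable (fun x => p x * e R x) volume a b :=
    (hpc.mul (hec R)).intervalIntegrable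
  have i3 : IntervalIntegrable (dslope (fun x => Real.sin (coulombPhase R x - coulombPhase R a)) a)
      volume a b := ((continuousOn_dslope_sin_coulombPhase ha R).mono hsub).intervalIntegrable
  have e1 : ∫ x in a..b, Real.sin (coulombPhase R x - coulombPhase R a) / (x - a) =
      ∫ x in a..b, dslope (fun x => Real.sin (coulombPhase R x - coulombPhase R a)) a x := by
    refine intervalIntegral.integral_congr_ae ?_
    filter_upwards [(countable_singleton a).ae_notMem volume] with x hxa _
    rw [dslope_of_ne _ hxa, slope, vsub_eq_sub, sub_self, Real.sin_zero, sub_zero,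
      smul_eq_mul, div_eq_inv_mul]
  have e2 : √a * Complex.normSq (coulombAmp l a) = 1 / Real.pi := by
    rw [normSq_coulombAmp l ha]; field_simp
  have e3 : (starRingEnd ℂ (E R) * ∫ x in a..b, q x * e R x).im =
      ∫ x in a..b, (starRingEnd ℂ (E R) * (q x * e R x)).im := by
    rw [← intervalIntegral.integral_const_mul]
    exact (intervalIntegral.intervalIntegral_im (𝕜 := ℂ) (i1.const_mul _)).symm
  have e4 : (∫ x in a..b, p x * e R x).re = ∫ x in a..b, (p x * e R x).re :=
    (intervalIntegral.intervalIntegral_re (𝕜 := ℂ) i2).symm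
  have j1 : IntervalIntegrable (fun x => (starRingEnd ℂ (E R) * (q x * e R x)).im) volume a b :=
    (Complex.continuous_im.comp_continuousOn
      (continuousOn_const.mul (hqc.mul (hec R)))).intervalIntegrable
  have j2 : IntervalIntegrable (fun x => (p x * e R x).re) volume a b :=
    (Complex.continuous_re.comp_continuousOn (hpc.mul (hec R))).intervalIntegrable
  simp only [coulombLocalKernel]
  rw [intervalIntegral.integral_sub ((i3.const_mul _).add (j1.const_mul _)) (j2.const_mul _),
    intervalIntegral.integral_add (i3.const_mul _) (j1.const_mul _),
    intervalIntegral.integral_const_mul, intervalIntegral.integral_const_mul,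
    intervalIntegral.integral_const_mul, e1, e2, e3, e4]
  ring

theorem tendsto_intervalIntegral_coulombKernel_right (l : ℕ) {a b : ℝ} (ha : 0 < a) (hab : a < b) :
    Tendsto (fun R => ∫ x in a..b, coulombKernel l a R x) atTop (𝓝 (1 / 2)) := by
  have hb := ha.trans hab
  have h := ((tendsto_intervalIntegral_coulombKernel_sub_local l ha hb).add
    (tendsto_intervalIntegral_coulombLocalKernel_sub l ha hb)).add
    ((tendsto_intervalIntegral_sin_coulombPhase_right ha hab).const_mul (1 / Real.pi))
  rw [show 0 + 0 + 1 / Real.pi * (Real.pi / 2) = 1 / 2 by field_simp; ring] at h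
  exact h.congr fun R => by ring

theorem tendsto_intervalIntegral_coulombKernel_left (l : ℕ) {a b : ℝ} (hb : 0 < b) (hab : b < a) :
    Tendsto (fun R => ∫ x in b..a, coulombKernel l a R x) atTop (𝓝 (1 / 2)) := by
  have ha := hb.trans hab
  have h := ((tendsto_intervalIntegral_coulombKernel_sub_local l ha hb).add
    (tendsto_intervalIntegral_coulombLocalKernel_sub l ha hb)).neg.add
    ((tendsto_intervalIntegral_sin_coulombPhase_left hb hab).const_mul (1 / Real.pi))
  rw [show -(0 + 0) + 1 / Real.pi * (Real.pi / 2) = 1 / 2 by field_simp; ring] at h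
  refine h.congr fun R => ?_
  simp only [intervalIntegral.integral_symm b a]
  ring

/-! ### Splitting φ at a and conclusion -/

theorem max_one_le_mul_abs_sub {a ε x : ℝ} (ha : 0 < a) (hε : 0 < ε) (hx : ε ≤ |x - a|) :
    max 1 x ≤ (1 + (a + 1) / ε) * |x - a| := by
  have h0 : 0 ≤ |x - a| := abs_nonneg _
  have h1 : a + 1 ≤ (a + 1) / ε * |x - a| := by
    rw [div_mul_eq_mul_div, le_div_iff₀ hε]
    gcongr
  have h2 := le_abs_self (x - a)
  refine max_le ?_ ?_ <;> nlinarith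

theorem integrableOn_indicator_mul {f : ℝ → ℝ} {c d : ℝ} (hc : 0 < c)
    (hf : ContinuousOn f (Ioi 0)) (L : ℝ) :
    IntegrableOn (fun x => (Ioc c d).indicator (fun _ => L) x * f x) (Ioi 0) := by
  have h : IntegrableOn (fun x => L * f x) (Ioc c d) :=
    ((hf.mono fun x hx => hc.trans_le hx.1 : ContinuousOn f (Icc c d)).integrableOn_Icc.mono_set
      Ioc_subset_Icc_self).const_mul L
  have e : (fun x => (Ioc c d).indicator (fun _ => L) x * f x)
      = (Ioc c d).indicator fun x => L * f x := by
    ext x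
    by_cases hx : x ∈ Ioc c d <;> simp [hx]
  rw [e]
  exact (h.integrable_indicator measurableSet_Ioc).integrableOn

/-- Within ε of a the Lipschitz bound cancels the pole. Elsewhere max(1, x) is at most a constant
times |x - a|, so division by x - a is as good as division by max(1, x). -/
theorem integrableOn_div_sub_mul_coulombWeight {φ : ℝ → ℝ} {a ε M : ℝ} (ha : 0 < a) (hε : 0 < ε)
    (hεa : ε < a) (hm : AEStronglyMeasurable φ (volume.restrict (Ioi 0)))
    (hφ : IntegrableOn (fun x => coulombWeight x / max 1 x * |φ x|) (Ioi 0))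
    (hM : ∀ x, |x - a| < ε → x ≠ a → |φ x| ≤ M * |x - a|) :
    IntegrableOn (fun x => |φ x / (x - a)| * coulombWeight x) (Ioi 0) := by
  set s := Ioc (a - ε) (a + ε) with hs
  have hM0 : 0 ≤ M := by
    have h := hM (a + ε / 2) (by rw [add_sub_cancel_left, abs_of_pos] <;> linarith)
      (by linarith)
    rw [add_sub_cancel_left, abs_of_pos (half_pos hε)] at h
    exact nonneg_of_mul_nonneg_left ((abs_nonneg _).trans h) (half_pos hε)
  have hwi := integrableOn_indicator_mul (c := a - ε) (d := a + ε) (by linarith)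
    continuousOn_coulombWeight M
  have hsm : AEStronglyMeasurable (fun x => |φ x / (x - a)| * coulombWeight x)
      (volume.restrict (Ioi 0)) := by
    have h1 : AEStronglyMeasurable (fun x : ℝ => x - a) (volume.restrict (Ioi 0)) :=
      (by fun_prop : Continuous fun x : ℝ => x - a).aestronglyMeasurable
    exact ((hm.aemeasurable.div h1.aemeasurable).abs.mul
      (continuousOn_coulombWeight.aemeasurable measurableSet_Ioi)).aestronglyMeasurable
  refine ((hφ.const_mul (1 + (a + 1) / ε)).add hwi).mono' hsm ?_
  filter_upwards [self_mem_ae_restrict measurableSet_Ioi] with x hx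
  have hw := coulombWeight_pos hx
  have hmx : 0 < max 1 x := by positivity
  have hK : 0 ≤ 1 + (a + 1) / ε := by positivity
  rw [Real.norm_of_nonneg (by positivity), abs_div, Pi.add_apply]
  by_cases hxs : |x - a| < ε
  · have hxs' : x ∈ s := ⟨by linarith [(abs_lt.1 hxs).1], by linarith [(abs_lt.1 hxs).2]⟩
    rw [indicator_of_mem hxs']
    have : |φ x| / |x - a| ≤ M := by
      rcases eq_or_ne x a with rfl | hxa
      · simpa using hM0
      · rw [div_le_iff₀ (abs_pos.2 (sub_ne_zero.2 hxa))]
        exact hM x hxs hxa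
    refine le_add_of_nonneg_of_le (by positivity) ?_
    gcongr
  · rw [not_lt] at hxs
    have hy : 0 < |x - a| := hε.trans_le hxs
    refine le_add_of_le_of_nonneg ?_ (mul_nonneg (indicator_nonneg (fun _ _ => hM0) x) hw.le)
    rw [div_mul_eq_mul_div, div_le_iff₀ hy]
    have h := max_one_le_mul_abs_sub ha hε hxs
    calc |φ x| * coulombWeight x = coulombWeight x / max 1 x * |φ x| * max 1 x := by field_simp
        _ ≤ coulombWeight x / max 1 x * |φ x| * ((1 + (a + 1) / ε) * |x - a|) := by gcongr
        _ = _ := by ring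

theorem setIntegral_indicator_mul {f : ℝ → ℝ} {c d : ℝ} (hc : 0 < c) (hcd : c ≤ d) (L : ℝ) :
    ∫ x in Ioi 0, (Ioc c d).indicator (fun _ => L) x * f x = L * ∫ x in c..d, f x := by
  have e : (fun x => (Ioc c d).indicator (fun _ => L) x * f x)
      = (Ioc c d).indicator fun x => L * f x := by
    ext x
    by_cases hx : x ∈ Ioc c d <;> simp [hx]
  rw [e, setIntegral_indicator measurableSet_Ioc,
    inter_eq_self_of_subset_right
      ((Ioc_subset_Ioi_self).trans (Ioi_subset_Ioi hc.le)), integral_const_mul,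
    intervalIntegral.integral_of_le hcd]

/-- The two step functions carry the one-sided limits, each with kernel mass 1/2. For the remainder
ψ, Lagrange's identity turns ψ K_R into ψ/(x - a) W_R, whose integral tends to 0. -/
theorem tendsto_integral_mul_coulombKernel (l : ℕ) {a : ℝ} (ha : 0 < a) {φ : ℝ → ℝ}
    (hφ : PiecewiseC1OnPos φ)
    (hint : IntegrableOn (fun x => coulombWeight x / max 1 x * |φ x|) (Ioi 0))
    {φleft φright : ℝ} (hleft : Tendsto φ (𝓝[<] a) (𝓝 φleft))
    (hright : Tendsto φ (𝓝[>] a) (𝓝 φright)) :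
    Tendsto (fun R => ∫ x in Ioi (0 : ℝ), φ x * coulombKernel l a R x) atTop
      (𝓝 ((1 / 2) * (φright + φleft))) := by
  have hm := hφ.aestronglyMeasurable
  obtain ⟨M₁, ε₁, hM₁, hε₁, hr⟩ := hφ.exists_lipschitz_right ha hright
  obtain ⟨M₂, ε₂, hM₂, hε₂, hl⟩ := hφ.exists_lipschitz_left ha hleft
  have ha2 : 0 < a / 2 := half_pos ha
  -- The outer endpoints 2a and a/2 have no significance: any intervals with compact closure in (0,
  -- ∞) on the two sides of a would do.
  set u : ℝ → ℝ := (Ioc a (2 * a)).indicator fun _ => φright with hu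
  set v : ℝ → ℝ := (Ioc (a / 2) a).indicator fun _ => φleft with hv
  set ψ : ℝ → ℝ := fun x => φ x - u x - v x with hψ
  -- The bound a/2 keeps the ε-neighbourhood of a within the union of the two supports.
  set ε := min (a / 2) (min ε₁ ε₂) with hε
  have hε0 : 0 < ε := by positivity
  have hum : Measurable u := measurable_const.indicator measurableSet_Ioc
  have hvm : Measurable v := measurable_const.indicator measurableSet_Ioc
  have hψm : AEStronglyMeasurable ψ (volume.restrict (Ioi 0)) :=
    (hm.sub hum.aestronglyMeasurable).sub hvm.aestronglyMeasurable
  have hwm : ContinuousOn (fun x => coulombWeight x / max 1 x) (Ioi 0) :=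
    continuousOn_coulombWeight.div (by fun_prop) fun x _ => by positivity
  have hψi : IntegrableOn (fun x => coulombWeight x / max 1 x * |ψ x|) (Ioi 0) := by
    have hui := (integrableOn_indicator_mul (d := 2 * a) ha hwm φright).norm
    have hvi := (integrableOn_indicator_mul (d := a) ha2 hwm φleft).norm
    refine ((hint.add hui).add hvi).mono' ((hwm.aestronglyMeasurable measurableSet_Ioi).mul
      hψm.norm) ?_
    filter_upwards [self_mem_ae_restrict measurableSet_Ioi] with x hx
    have hw := coulombWeight_pos hx
    have hq : 0 ≤ coulombWeight x / max 1 x := by positivity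
    simp only [Pi.add_apply, norm_mul, Real.norm_eq_abs, abs_abs, abs_of_nonneg hq]
    calc _ ≤ coulombWeight x / max 1 x * (|φ x| + |u x| + |v x|) := by
          gcongr
          exact (abs_sub _ _).trans (by gcongr; exact abs_sub _ _)
      _ = _ := by ring
  have hψM : ∀ x, |x - a| < ε → x ≠ a → |ψ x| ≤ max M₁ M₂ * |x - a| := fun x hx hxa => by
    obtain ⟨h1, h2⟩ := abs_lt.1 hx
    have e1 : ε ≤ a / 2 := min_le_left _ _
    have e2 : ε ≤ ε₁ := (min_le_right _ _).trans (min_le_left _ _)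
    have e3 : ε ≤ ε₂ := (min_le_right _ _).trans (min_le_right _ _)
    rcases lt_or_gt_of_ne hxa with h | h
    · have : ψ x = φ x - φleft := by
        simp only [hψ, hu, hv]
        rw [indicator_of_notMem (fun hx => absurd hx.1 (by linarith)),
          indicator_of_mem (show x ∈ Ioc (a / 2) a from ⟨by linarith, h.le⟩), sub_zero]
      rw [this]
      exact (hl x ⟨by linarith, h⟩).trans (by gcongr; exact le_max_right _ _)
    · have : ψ x = φ x - φright := by
        simp only [hψ, hu, hv]
        rw [indicator_of_mem (show x ∈ Ioc a (2 * a) from ⟨h, by linarith⟩),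
          indicator_of_notMem (fun hx => absurd hx.2 (by linarith)), sub_zero]
      rw [this]
      exact (hr x ⟨h, by linarith⟩).trans (by gcongr; exact le_max_left _ _)
  have hεa : ε < a := (min_le_left _ _).trans_lt (half_lt_self ha)
  have hg := integrableOn_div_sub_mul_coulombWeight ha hε0 hεa hψm hψi hψM
  have hgm : AEStronglyMeasurable (fun x => ψ x / (x - a)) (volume.restrict (Ioi 0)) :=
    (hψm.aemeasurable.div (measurable_id.sub_const a).aemeasurable).aestronglyMeasurable
  have h := (((tendsto_intervalIntegral_coulombKernel_right l ha
    (show a < 2 * a by linarith)).const_mul φright).add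
    ((tendsto_intervalIntegral_coulombKernel_left l ha2 (half_lt_self ha)).const_mul φleft)).add
    (tendsto_integral_mul_coulombWronskian l ha hgm hg)
  rw [show φright * (1 / 2) + φleft * (1 / 2) + 0 = 1 / 2 * (φright + φleft) by ring] at h
  refine h.congr' ?_
  filter_upwards [eventually_gt_atTop 0] with R hR
  have hk := continuousOn_coulombKernel l ha R
  have e1 : ∫ x in Ioi (0 : ℝ), ψ x / (x - a) * coulombWronskian l a R x =
      ∫ x in Ioi (0 : ℝ), ψ x * coulombKernel l a R x := by
    refine setIntegral_congr_ae measurableSet_Ioi ?_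
    filter_upwards [(countable_singleton a).ae_notMem volume] with x hxa hx
    have : x - a ≠ 0 := sub_ne_zero.2 hxa
    rw [← sub_mul_coulombKernel l ha hx hR.le]
    field_simp
  have i1 : IntegrableOn (fun x => u x * coulombKernel l a R x) (Ioi 0) :=
    integrableOn_indicator_mul ha hk _
  have i2 : IntegrableOn (fun x => v x * coulombKernel l a R x) (Ioi 0) :=
    integrableOn_indicator_mul ha2 hk _
  have i12 : IntegrableOn (fun x => u x * coulombKernel l a R x + v x * coulombKernel l a R x)
      (Ioi 0) := i1.add i2
  have i3 := integrableOn_mul_coulombKernel l ha hR hψm hψi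
  have e2 : (fun x => φ x * coulombKernel l a R x) = fun x => u x * coulombKernel l a R x +
      v x * coulombKernel l a R x + ψ x * coulombKernel l a R x := by
    ext x
    simp only [hψ]
    ring
  rw [e1, e2, integral_add i12 i3, integral_add i1 i2,
    setIntegral_indicator_mul ha (by linarith), setIntegral_indicator_mul ha2 (by linarith)]

theorem theorem2 (l : ℕ) (a : ℝ) (ha : 0 < a) (φ : ℝ → ℝ) (hφ : PiecewiseC1OnPos φ)
    (h0 : IntegrableOn (fun x : ℝ => x ^ (-(1 / 4) : ℝ) * |φ x|) (Ioc 0 1))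
    (h1 : IntegrableOn (fun x : ℝ => x ^ (-(3 / 4) : ℝ) * |φ x|) (Ioi 1))
    (φleft φright : ℝ) (hleft : Tendsto φ (𝓝[<] a) (𝓝 φleft))
    (hright : Tendsto φ (𝓝[>] a) (𝓝 φright)) :
    (∀ R : ℝ, 0 < R →
      (∀ x : ℝ, 0 < x →
        IntervalIntegrable (fun r => coulombS x l r * coulombS a l r) volume 0 R) ∧
      IntegrableOn
        (fun x : ℝ => φ x * ∫ r in (0 : ℝ)..R, coulombS x l r * coulombS a l r) (Ioi 0)) ∧
    Tendsto
      (fun R : ℝ => ∫ x in Ioi (0 : ℝ),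
        φ x * ∫ r in (0 : ℝ)..R, coulombS x l r * coulombS a l r)
      atTop (𝓝 ((1 / 2) * (φright + φleft))) := by
  have hint := integrableOn_abs_mul_coulombWeight h0 h1
  exact ⟨fun R hR => ⟨fun x hx => intervalIntegrable_coulombS_mul l ha hx R,
    integrableOn_mul_coulombKernel l ha hR hφ.aestronglyMeasurable hint⟩,
    tendsto_integral_mul_coulombKernel l ha hφ hint hleft hright⟩
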